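/- For $a\in\mathbb C$ consider the Weber equation $u''(x)+\left(\frac{x^2}{4}-a\right)u(x)=0$, $x\in\mathbb C$. There are functions $E_\pm(a,x)$, entire in $(a,x)\in\mathbb C^2$, such that for every $a\in\mathbb C$ the functions $E_+(a,\cdot)$, $E_-(a,\cdot)$ are two linearly independent solutions of this equation, and the following hold. (1) Put $\alpha_\pm=\frac14\pm\frac{ia}{2}$. If $|\arg x|<\frac{\pi}{4}$ and $\alpha_\pm\notin\{0,-1,-2,\dots\}$, then $E_\pm(a,x)=v_\pm(x^2)$, where for $\mathrm{Re}\,s>0$ $$v_\pm(s)=\frac{e^{\pm is/4}}{\Gamma\left(\frac14\pm\frac{ia}{2}\right)}\int_0^\infty e^{-ps}\,p^{\pm\frac{ia}{2}-\frac34}\,(1\pm 2ip)^{\mp\frac{ia}{2}-\frac34}\,dp$$ with principal branches. The integral converges absolutely if $\mathrm{Re}\,\alpha_\pm>0$, and in general it is understood as the Hadamard finite part: for $f(p)=\sum_n f_np^n$ analytic in $|p|<R$ and continuous up to the boundary, the finite part of $\int_0^\infty p^{\alpha-1}f(p)\,dp$ is $\sum_{n\ge0}\frac{f_n}{n+\alpha}R^{n+\alpha}+\int_R^\infty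 p^{\alpha-1}f(p)\,dp$. Since $E_\pm$ is entire in $a$, the singularities $\alpha_\pm=0,-1,-2,\dots$ of these formulas are removable. (2) For every $a\in\mathbb C$, $E_\pm(a,x)=e^{\pm ix^2/4}(x^2)^{\mp\frac{ia}{2}-\frac14}\left(1+O(x^{-2})\right)$ as $x\to\infty$ in the sector $|\arg x|<\frac{\pi}{4}$. (3) For all $a,x\in\mathbb C$, $$E_-(a,-x)=ie^{\pi a}E_-(a,x)+\frac{\sqrt{2\pi}}{\Gamma\left(\frac12-ia\right)}e^{\pi a/2}E_+(a,x),\qquad E_+(a,-x)=-ie^{\pi a}E_+(a,x)+\frac{\sqrt{2\pi}}{\Gamma\left(\frac12+ia\right)}e^{\pi a/2}E_-(a,x).$$ (4) For real $a$ let $W(a,\cdot)$ be Whittaker's solution of the Weber equation, with $W(a,0)=2^{-3/4}\left|\frac{\Gamma(1/4+ia/2)}{\Gamma(3/4+ia/2)}\right|^{1/2}$ and $W'(a,0)=-2^{-1/4}\left|\frac{\Gamma(3/4+ia/2)}{\Gamma(1/4+ia/2)}\right|^{1/2}$, let $k=\sqrt{1+e^{2\pi a}}-e^{\pi a}$, and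 let $\phi_2(a)$ be the phase of $\Gamma(\frac12+ia)$, continuous in $a\in\mathbb R$ with $\phi_2(0)=0$. The classical solutions $E(a,x)=k^{-1/2}W(a,x)+ik^{1/2}W(a,-x)$ and $E^*(a,x)=k^{-1/2}W(a,x)-ik^{1/2}W(a,-x)$ satisfy, for all $x\in\mathbb C$, $$E(a,x)=\sqrt2\,e^{\frac{\pi i}{4}+\frac{i\phi_2}{2}}E_+(a,x),\qquad E^*(a,x)=\sqrt2\,e^{-\frac{\pi i}{4}-\frac{i\phi_2}{2}}E_-(a,x).$$ The same two identities hold for every $a\in\mathbb C$, whatever complex number $\phi_2$ is used, if $E$ and $E^*$ are given by the classical formulas $E(a,x)=\sqrt2\,e^{\pi a/4}e^{i\rho}\,U(ia,xe^{-\pi i/4})$, $E^*(a,x)=\sqrt2\,e^{\pi a/4}e^{-i\rho}\,U(-ia,xe^{\pi i/4})$, $\rho=\frac{\pi}{8}+\frac{\phi_2}{2}$. Here $U(b,\cdot)$ is the parabolic cylinder function, that is, the solution of $w''-\left(\frac{z^2}{4}+b\right)w=0$ with $U(b,0)=\frac{\sqrt\pi}{2^{b/2+1/4}\Gamma(3/4+b/2)}$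 and $U'(b,0)=-\frac{\sqrt\pi}{2^{b/2-1/4}\Gamma(1/4+b/2)}$. -/

import Mathlib

noncomputable section

namespace Weber

open Complex Set

/-- `u` is an entire solution of the Weber equation `u'' + (x² / 4 - a) u = 0`. -/
def IsWeberSolution (a : ℂ) (u : ℂ → ℂ) : Prop :=
  Differentiable ℂ u ∧ ∀ x : ℂ, deriv (deriv u) x + (x ^ 2 / 4 - a) * u x = 0

/-- The open sector `|arg x| < π / 4` (without the origin, where Mathlib sets `arg 0 = 0`).
It is mapped bijectively by `x ↦ x²` onto the half plane `Re s > 0`. -/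
def sector : Set ℂ := {x : ℂ | x ≠ 0 ∧ |x.arg| < Real.pi / 4}

/-! ### Hadamard finite part -/

/-- `J` is the Hadamard finite part of `∫₀^∞ p ^ (α - 1) f p dp`, where `f` is analytic near `0`
and `α` is not one of `0, -1, -2, …`.  On a disc of radius `R` on which `f = ∑ fₙ pⁿ` is analytic
(and continuous up to the boundary) the finite part of `∫₀^R` is `∑ fₙ R ^ (n + α) / (n + α)`;
to this the absolutely convergent integral over `(R, ∞)` is added. -/
def HasFinitePart (α : ℂ) (f : ℂ → ℂ) (J : ℂ) : Prop :=
  (∀ n : ℕ, α ≠ -(n : ℂ)) ∧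
  ∃ R : ℝ, 0 < R ∧ DiffContOnCl ℂ f (Metric.ball 0 R) ∧
    MeasureTheory.IntegrableOn (fun p : ℝ => (p : ℂ) ^ (α - 1) * f p) (Ioi R) ∧
    HasSum (fun n : ℕ =>
        iteratedDeriv n f 0 / (n.factorial : ℂ) / ((n : ℂ) + α) * (R : ℂ) ^ ((n : ℂ) + α))
      (J - ∫ p in Ioi R, (p : ℂ) ^ (α - 1) * f p)

/-- `J` is the value of `∫₀^∞ p ^ (α - 1) f p dp`: the finite part, which is the ordinary
(absolutely convergent) integral when `Re α > 0`. -/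
def IsRegularizedIntegral (α : ℂ) (f : ℂ → ℂ) (J : ℂ) : Prop :=
  HasFinitePart α f J ∧
  (0 < α.re →
    MeasureTheory.IntegrableOn (fun p : ℝ => (p : ℂ) ^ (α - 1) * f p) (Ioi 0) ∧
    ∫ p in Ioi (0 : ℝ), (p : ℂ) ^ (α - 1) * f p = J)

/-- The exponent `α₊ = i a / 2 + 1 / 4`, so that `p ^ (α₊ - 1) = p ^ (i a / 2 - 3 / 4)`. -/
def alphaPlus (a : ℂ) : ℂ := I * a / 2 + 1 / 4

/-- The exponent `α₋ = - i a / 2 + 1 / 4`, so that `p ^ (α₋ - 1) = p ^ (- i a / 2 - 3 / 4)`. -/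
def alphaMinus (a : ℂ) : ℂ := -(I * a / 2) + 1 / 4

/-- The factor `e ^ (-p s) (1 + 2 i p) ^ (- i a / 2 - 3 / 4)`, analytic for `|p| < 1 / 2`. -/
def kernelPlus (a s p : ℂ) : ℂ := exp (-(p * s)) * (1 + 2 * I * p) ^ (-(I * a / 2) - 3 / 4)

/-- The factor `e ^ (-p s) (1 - 2 i p) ^ (i a / 2 - 3 / 4)`, analytic for `|p| < 1 / 2`. -/
def kernelMinus (a s p : ℂ) : ℂ := exp (-(p * s)) * (1 - 2 * I * p) ^ (I * a / 2 - 3 / 4)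

/-- `v` is the value `v₊(s)` of the normalised Laplace integral
`1 / Γ(i a / 2 + 1 / 4) e ^ (i s / 4) ∫₀^∞ e ^ (-p s) p ^ (i a / 2 - 3 / 4)
(1 + 2 i p) ^ (- i a / 2 - 3 / 4) dp`. -/
def IsLaplacePlus (a s v : ℂ) : Prop :=
  ∃ J : ℂ, IsRegularizedIntegral (alphaPlus a) (kernelPlus a s) J ∧
    v = 1 / Gamma (alphaPlus a) * exp (I * s / 4) * J

/-- `v` is the value `v₋(s)` of the normalised Laplace integral
`1 / Γ(- i a / 2 + 1 / 4) e ^ (- i s / 4) ∫₀^∞ e ^ (-p s) p ^ (- i a / 2 - 3 / 4)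
(1 - 2 i p) ^ (i a / 2 - 3 / 4) dp`. -/
def IsLaplaceMinus (a s v : ℂ) : Prop :=
  ∃ J : ℂ, IsRegularizedIntegral (alphaMinus a) (kernelMinus a s) J ∧
    v = 1 / Gamma (alphaMinus a) * exp (-(I * s / 4)) * J

/-! ### The classical pair `E`, `E*` -/

/-- `W` is Whittaker's function `W(a, ·)`, `a` real: the solution of the Weber equation with
`W(a, 0) = 2 ^ (-3/4) |Γ(1/4 + ia/2) / Γ(3/4 + ia/2)| ^ (1/2)` and
`W'(a, 0) = -2 ^ (-1/4) |Γ(3/4 + ia/2) / Γ(1/4 + ia/2)| ^ (1/2)`. -/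
def IsWhittakerW (a : ℝ) (W : ℂ → ℂ) : Prop :=
  IsWeberSolution a W ∧
  W 0 = (((2 : ℝ) ^ (-(3 / 4) : ℝ) *
    Real.sqrt ‖Gamma (1 / 4 + I * a / 2) / Gamma (3 / 4 + I * a / 2)‖ : ℝ) : ℂ) ∧
  deriv W 0 = ((-(2 : ℝ) ^ (-(1 / 4) : ℝ) *
    Real.sqrt ‖Gamma (3 / 4 + I * a / 2) / Gamma (1 / 4 + I * a / 2)‖ : ℝ) : ℂ)

/-- `k = √(1 + e ^ (2 π a)) - e ^ (π a)`, a positive number. -/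
def weberK (a : ℝ) : ℝ :=
  Real.sqrt (1 + Real.exp (2 * Real.pi * a)) - Real.exp (Real.pi * a)

/-- `E = k ^ (-1/2) W(a, x) + i k ^ (1/2) W(a, -x)`. -/
def classicalE (a : ℝ) (W : ℂ → ℂ) (x : ℂ) : ℂ :=
  ((Real.sqrt (weberK a))⁻¹ : ℝ) * W x + I * (Real.sqrt (weberK a) : ℝ) * W (-x)

/-- `E* = k ^ (-1/2) W(a, x) - i k ^ (1/2) W(a, -x)`. -/
def classicalEStar (a : ℝ) (W : ℂ → ℂ) (x : ℂ) : ℂ :=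
  ((Real.sqrt (weberK a))⁻¹ : ℝ) * W x - I * (Real.sqrt (weberK a) : ℝ) * W (-x)

/-- `φ = φ₂` is the phase of `Γ(1/2 + i a)` for real `a`: the continuous branch that vanishes at
`a = 0`.  (These conditions determine `φ`.) -/
def IsGammaPhase (φ : ℝ → ℝ) : Prop :=
  Continuous φ ∧ φ 0 = 0 ∧
  ∀ a : ℝ, Gamma (1 / 2 + I * a) = (‖Gamma (1 / 2 + I * a)‖ : ℂ) * exp (I * φ a)

/-- `U` is the parabolic cylinder function `U(a, ·)`: the entire solution of
`w'' - (z² / 4 + a) w = 0` with `U(a, 0) = √π / (2 ^ (a/2 + 1/4) Γ(3/4 + a/2))` and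
`U'(a, 0) = -√π / (2 ^ (a/2 - 1/4) Γ(1/4 + a/2))`. -/
def IsParabolicU (a : ℂ) (U : ℂ → ℂ) : Prop :=
  Differentiable ℂ U ∧
  (∀ z : ℂ, deriv (deriv U) z - (z ^ 2 / 4 + a) * U z = 0) ∧
  U 0 = (Real.sqrt Real.pi : ℂ) / ((2 : ℂ) ^ (a / 2 + 1 / 4) * Gamma (3 / 4 + a / 2)) ∧
  deriv U 0 = -((Real.sqrt Real.pi : ℂ) / ((2 : ℂ) ^ (a / 2 - 1 / 4) * Gamma (1 / 4 + a / 2)))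

/-- The form `√2 e ^ (π a / 4) e ^ (i ρ) U(i a, x e ^ (- π i / 4))`, `ρ = π / 8 + φ / 2`, of the
classical `E`, in which `a` may be complex; `U` stands for `U(i a, ·)`. -/
def complexE (a φ : ℂ) (U : ℂ → ℂ) (x : ℂ) : ℂ :=
  (Real.sqrt 2 : ℂ) * exp (Real.pi * a / 4) * exp (I * (Real.pi / 8 + φ / 2)) *
    U (x * exp (-(Real.pi * I / 4)))

/-- The form `√2 e ^ (π a / 4) e ^ (- i ρ) U(- i a, x e ^ (π i / 4))`, `ρ = π / 8 + φ / 2`, of the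
classical `E*`, in which `a` may be complex; `U` stands for `U(- i a, ·)`. -/
def complexEStar (a φ : ℂ) (U : ℂ → ℂ) (x : ℂ) : ℂ :=
  (Real.sqrt 2 : ℂ) * exp (Real.pi * a / 4) * exp (-(I * (Real.pi / 8 + φ / 2))) *
    U (x * exp (Real.pi * I / 4))

end Weber

end

/-!
The functions `E₊` and `E₋` (`weberE I` and `weberE (-I)`) are defined by their initial values at
the origin: the Weber equation has an even and an odd solution, entire in `(a, x)`, given by
Kummer's function (`isWeberSolution_weberEven`, `isWeberSolution_weberOdd`), and the initial
values of `E_±` are products of powers and reciprocal Gamma functions, hence entire in `a`.  Both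
signs are treated at once, with a parameter `η = ± i` and `α = η a / 2 + 1 / 4`.

For `Re α > 0` the Laplace integral, multiplied by `e ^ (η x² / 4) / Γ(α)`, solves the Weber
equation in the sector `|arg x| < π / 4`; its value and derivative have limits at the vertex,
equal to the initial values of `E_±`, and Wronskians identify the two functions
(`weberE_eq_laplaceInt`).  The limit of the value, and the first term of the expansion at infinity
with an error that is uniform in the open sector (`exists_norm_laplaceInt_sub_le`), are read off
from a dual form of the integral (`laplaceInt_dual`), in which `s = x²` appears in the base of a
power and not in an exponential.

The ladder relation `weberE_add` expresses `E_±(a + 2 η, x)` through `E_±(a, x)` and its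
derivative, and `a ↦ a + 2 η` lowers `α` by one.  Induction along this ladder
(`weberAlpha_induction`) carries the asymptotics (`amplitude_isBigO`) to all `a`.  It also carries
the integral representation to all `a` for which `α` is not a pole of `Γ`
(`isFinitePart_amplitude`), because the Hadamard finite part is linear and admits integration by
parts without boundary terms (`IsFinitePart.of_deriv`).

The connection formulas, the linear independence and the relation with the parabolic cylinder
function are identities between initial values at the origin; they follow from the reflection and
duplication formulas of the Gamma function.  For the classical pair with real `a` the same formulas
only give the square of the initial value (`classicalFactor_mul_weberE₀_sq`), as half of the phase
of `Γ(1/2 + i a)` occurs.  The sign is settled by continuity in `a` and inspection of `a = 0`.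
-/

noncomputable section

namespace Weber

open Complex Set Filter Topology MeasureTheory Asymptotics

/-! ### Series of entire functions -/

/-- A series of entire functions that is dominated by a summable series on every ball is entire.
The derivatives of the terms are bounded on a ball by Cauchy's estimate along complex lines,
applied on the ball with radius larger by one. -/
theorem differentiable_tsum_of_summable_norm {E : Type*} [NormedAddCommGroup E] [NormedSpace ℂ E]
    {F : ℕ → E → ℂ} (hF : ∀ n, Differentiable ℂ (F n))
    (hb : ∀ r : ℝ, ∃ u : ℕ → ℝ, Summable u ∧ ∀ n x, ‖x‖ ≤ r → ‖F n x‖ ≤ u n) :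
    Differentiable ℂ fun x => ∑' n, F n x := by
  intro x
  obtain ⟨u, hu, hle⟩ := hb (‖x‖ + 2)
  have hx : x ∈ Metric.ball (0 : E) (‖x‖ + 1) := by simp
  refine (hasFDerivAt_tsum_of_isPreconnected hu (Metric.isOpen_ball (x := (0 : E)) (ε := ‖x‖ + 1))
    (convex_ball _ _).isPreconnected (f' := fun n y => fderiv ℂ (F n) y)
    (fun n y _ => (hF n y).hasFDerivAt) ?_ hx ?_ hx).differentiableAt
  · intro n y hy
    have hy' : ‖y‖ < ‖x‖ + 1 := by simpa using hy
    have hu0 : 0 ≤ u n := (norm_nonneg _).trans (hle n 0 (by simp; positivity))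
    refine ContinuousLinearMap.opNorm_le_bound _ hu0 fun v => ?_
    rcases eq_or_ne v 0 with rfl | hv
    · simp
    have hv' : 0 < ‖v‖ := norm_pos_iff.2 hv
    have hd : HasDerivAt (fun t : ℂ => F n (y + t • v)) (fderiv ℂ (F n) y v) 0 := by
      have h1 : HasDerivAt (fun t : ℂ => y + t • v) v 0 := by
        simpa using ((hasDerivAt_id (0 : ℂ)).smul_const v).const_add y
      have h2 : HasFDerivAt (F n) (fderiv ℂ (F n) y) (y + (0 : ℂ) • v) := by
        simpa using (hF n y).hasFDerivAt
      exact h2.comp_hasDerivAt 0 h1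
    have hdiff : Differentiable ℂ fun t : ℂ => F n (y + t • v) := by
      have := hF n
      fun_prop
    have := Complex.norm_deriv_le_of_forall_mem_sphere_norm_le (c := 0) (R := ‖v‖⁻¹) (C := u n)
      (by positivity) hdiff.diffContOnCl (fun t ht => by
        refine hle n _ ?_
        have ht' : ‖t‖ = ‖v‖⁻¹ := by simpa using ht
        calc ‖y + t • v‖ ≤ ‖y‖ + ‖t • v‖ := norm_add_le _ _
          _ = ‖y‖ + 1 := by rw [norm_smul, ht', inv_mul_cancel₀ hv'.ne']
          _ ≤ _ := by linarith)
    rw [hd.deriv] at this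
    simpa [div_eq_mul_inv] using this
  · exact Summable.of_norm_bounded hu fun n => hle n x (by linarith)

/-- Termwise differentiation of a power series. -/
theorem hasSum_deriv_powerSeries {c : ℕ → ℂ} {f : ℂ → ℂ} {ρ : ℝ}
    (h : ∀ z ∈ Metric.ball (0 : ℂ) ρ, HasSum (fun n => c n * z ^ n) (f z)) {z : ℂ}
    (hz : z ∈ Metric.ball (0 : ℂ) ρ) :
    HasSum (fun n : ℕ => (n + 1) * c (n + 1) * z ^ n) (deriv f z) := by
  have hz' : ‖z‖ < ρ := by simpa using hz
  obtain ⟨r, hzr, hr⟩ := exists_between hz'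
  have hr0 : 0 ≤ r := (norm_nonneg z).trans hzr.le
  have hsum : Summable fun n => ‖c n‖ * r ^ n := by
    have := (h (r : ℂ) (by simp [abs_of_nonneg hr0, hr])).summable.norm
    simpa [abs_of_nonneg hr0] using this
  have hzU : z ∈ Metric.ball (0 : ℂ) r := by simpa using hzr
  have key := hasSum_deriv_of_summable_norm (F := fun n z => c n * z ^ n) hsum
    (fun n => (by fun_prop : Differentiable ℂ fun z : ℂ => c n * z ^ n).differentiableOn)
    Metric.isOpen_ball (fun n w hw => by
      have hw' : ‖w‖ < r := by simpa using hw
      rw [norm_mul, norm_pow]; gcongr) hzU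
  have heq : (fun w : ℂ => ∑' n, c n * w ^ n) =ᶠ[𝓝 z] f := by
    filter_upwards [Metric.isOpen_ball.mem_nhds hz] with w hw using (h w hw).tsum_eq
  rw [heq.deriv_eq] at key
  rw [← hasSum_nat_add_iff' 1] at key
  simp only [Finset.sum_range_one, pow_zero, mul_one, deriv_const, sub_zero] at key
  refine key.congr_fun fun n => ?_
  simp
  ring

/-! ### Kummer's function -/

/-- The coefficient `(α)ₙ / ((b)ₙ n!)` of Kummer's confluent hypergeometric series. -/
def kummerCoeff (b α : ℂ) (n : ℕ) : ℂ := ∏ j ∈ Finset.range n, (α + j) / ((b + j) * (j + 1))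

/-- Kummer's function `M(α, b, z) = ₁F₁(α; b; z)`.  It is only used for `b = 1 / 2` and
`b = 3 / 2`, where no denominator vanishes. -/
def kummer (b α z : ℂ) : ℂ := ∑' n, kummerCoeff b α n * z ^ n

theorem kummerCoeff_succ {b : ℂ} (hb : 1 / 2 ≤ b.re) (α : ℂ) (n : ℕ) :
    (b + n) * (n + 1) * kummerCoeff b α (n + 1) = (α + n) * kummerCoeff b α n := by
  have h1 : (b + n : ℂ) ≠ 0 := fun h => by
    have := congrArg re h
    simp at this
    have hn : (0 : ℝ) ≤ n := n.cast_nonneg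
    linarith
  have h2 : (n + 1 : ℂ) ≠ 0 := n.cast_add_one_ne_zero
  rw [kummerCoeff, Finset.prod_range_succ, ← kummerCoeff]
  field_simp

/-- The bound is uniform for `α` in a disc, so that Kummer's function is entire in `α` as well. -/
theorem norm_kummerCoeff_le {b : ℂ} (hb : 1 / 2 ≤ b.re) {α : ℂ} {K : ℝ} (hα : ‖α‖ ≤ K) (n : ℕ) :
    ‖kummerCoeff b α n‖ ≤ (2 * (K + 1)) ^ n / n.factorial := by
  have hK : 0 ≤ K := (norm_nonneg _).trans hα
  induction n with
  | zero => simp [kummerCoeff]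
  | succ n ih =>
    have hn : (0 : ℝ) ≤ n := n.cast_nonneg
    have h1 : ‖α + n‖ ≤ (K + 1) * (n + 1) := by
      calc ‖α + n‖ ≤ ‖α‖ + ‖(n : ℂ)‖ := norm_add_le _ _
        _ ≤ K + n := by simpa using hα
        _ ≤ _ := by nlinarith
    have h2 : (n + 1 : ℝ) / 2 ≤ ‖b + n‖ := by
      refine le_trans ?_ (Complex.re_le_norm _)
      simp
      linarith
    have h3 : ‖(n + 1 : ℂ)‖ = n + 1 := by
      rw [← Nat.cast_add_one, Complex.norm_natCast]; push_cast; rfl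
    rw [kummerCoeff, Finset.prod_range_succ, ← kummerCoeff, norm_mul, norm_div, norm_mul, h3,
      Nat.factorial_succ, pow_succ]
    calc ‖kummerCoeff b α n‖ * (‖α + n‖ / (‖b + n‖ * (n + 1)))
        ≤ (2 * (K + 1)) ^ n / n.factorial *
          ((K + 1) * (n + 1) / ((n + 1) / 2 * (n + 1))) := by gcongr
      _ = _ := by push_cast; field_simp

theorem summable_pow_mul_pow_div_factorial (A r : ℝ) :
    Summable fun n : ℕ => A ^ n / n.factorial * r ^ n := by
  have := Real.summable_pow_div_factorial (A * r)
  refine this.congr fun n => ?_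
  rw [mul_pow]; ring

theorem hasSum_kummer {b : ℂ} (hb : 1 / 2 ≤ b.re) (α z : ℂ) :
    HasSum (fun n => kummerCoeff b α n * z ^ n) (kummer b α z) := by
  refine Summable.hasSum (Summable.of_norm_bounded
    (summable_pow_mul_pow_div_factorial (2 * (‖α‖ + 1)) ‖z‖) fun n => ?_)
  rw [norm_mul, norm_pow]
  gcongr
  exact norm_kummerCoeff_le hb le_rfl n

theorem differentiable_kummer {b : ℂ} (hb : 1 / 2 ≤ b.re) :
    Differentiable ℂ fun q : ℂ × ℂ => kummer b q.1 q.2 := by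
  have hF (n : ℕ) : Differentiable ℂ fun q : ℂ × ℂ => kummerCoeff b q.1 n * q.2 ^ n := by
    refine Differentiable.mul ?_ (by fun_prop)
    induction n with
    | zero => simp only [kummerCoeff, Finset.range_zero, Finset.prod_empty]; fun_prop
    | succ n ih =>
      simp only [kummerCoeff, Finset.prod_range_succ] at ih ⊢
      refine ih.mul ?_
      simp only [div_eq_mul_inv]
      fun_prop
  have hb' (r : ℝ) : ∃ u : ℕ → ℝ, Summable u ∧
      ∀ n (q : ℂ × ℂ), ‖q‖ ≤ r → ‖kummerCoeff b q.1 n * q.2 ^ n‖ ≤ u n := by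
    refine ⟨_, summable_pow_mul_pow_div_factorial (2 * (r + 1)) r, fun n q hq => ?_⟩
    have hr : 0 ≤ r := (norm_nonneg _).trans hq
    rw [norm_mul, norm_pow]
    have h2 := (norm_snd_le q).trans hq
    exact mul_le_mul (norm_kummerCoeff_le hb ((norm_fst_le q).trans hq) n)
      (pow_le_pow_left₀ (norm_nonneg _) h2 n) (by positivity) (by positivity)
  exact differentiable_tsum_of_summable_norm hF hb'

theorem differentiable_kummer_right {b : ℂ} (hb : 1 / 2 ≤ b.re) (α : ℂ) :
    Differentiable ℂ (kummer b α) :=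
  Differentiable.comp (g := fun q : ℂ × ℂ => kummer b q.1 q.2) (f := fun z => (α, z))
    (differentiable_kummer hb) (by fun_prop)

@[simp] theorem kummer_zero (b α : ℂ) : kummer b α 0 = 1 := by
  rw [kummer, tsum_eq_single 0]
  · simp [kummerCoeff]
  · intro n hn
    simp [hn]

/-- Kummer's differential equation. -/
theorem kummer_ode {b : ℂ} (hb : 1 / 2 ≤ b.re) (α z : ℂ) :
    z * deriv (deriv (kummer b α)) z + (b - z) * deriv (kummer b α) z - α * kummer b α z = 0 := by
  have h0 : HasSum _ (kummer b α z) := hasSum_kummer hb α z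
  have hz : z ∈ Metric.ball (0 : ℂ) (‖z‖ + 1) := by simp
  have hd : ∀ w ∈ Metric.ball (0 : ℂ) (‖z‖ + 1), HasSum _ (deriv (kummer b α) w) :=
    fun w hw => hasSum_deriv_powerSeries (fun w _ => hasSum_kummer hb α w) hw
  have h1 := hd z hz
  have h2 := hasSum_deriv_powerSeries hd hz
  have h1' : HasSum (fun n : ℕ => n * kummerCoeff b α n * z ^ n) (z * deriv (kummer b α) z) := by
    rw [← hasSum_nat_add_iff' 1]
    simp only [Finset.sum_range_one, Nat.cast_zero, zero_mul, sub_zero]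
    refine (h1.mul_left z).congr_fun fun n => ?_
    push_cast; ring
  have h2' : HasSum (fun n : ℕ => n * (n + 1) * kummerCoeff b α (n + 1) * z ^ n)
      (z * deriv (deriv (kummer b α)) z) := by
    rw [← hasSum_nat_add_iff' 1]
    simp only [Finset.sum_range_one, Nat.cast_zero, zero_mul, sub_zero]
    refine (h2.mul_left z).congr_fun fun n => ?_
    push_cast; ring
  have h := ((h2'.add (h1.mul_left b)).sub h1').sub (h0.mul_left α)
  have h3 := h.congr_fun (g := fun _ => (0 : ℂ)) fun n => by
    linear_combination -z ^ n * kummerCoeff_succ hb α n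
  have := h3.unique hasSum_zero
  linear_combination this

/-! ### The even and the odd solution -/

/-- The even solution of the Weber equation with value `1` at the origin. -/
def weberEven (a x : ℂ) : ℂ :=
  exp (I * x ^ 2 / 4) * kummer (1 / 2) (I * a / 2 + 1 / 4) (-(I * x ^ 2 / 2))

/-- The odd solution of the Weber equation with derivative `1` at the origin. -/
def weberOdd (a x : ℂ) : ℂ :=
  x * (exp (I * x ^ 2 / 4) * kummer (3 / 2) (I * a / 2 + 3 / 4) (-(I * x ^ 2 / 2)))

theorem IsWeberSolution.hasDerivAt {a : ℂ} {u : ℂ → ℂ} (h : IsWeberSolution a u) (x : ℂ) :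
    HasDerivAt u (deriv u x) x :=
  (h.1 x).hasDerivAt

theorem IsWeberSolution.hasDerivAt_deriv {a : ℂ} {u : ℂ → ℂ} (h : IsWeberSolution a u) (x : ℂ) :
    HasDerivAt (deriv u) (-(x ^ 2 / 4 - a) * u x) x := by
  have h1 : Differentiable ℂ (deriv u) := h.1.deriv
  have := (h1 x).hasDerivAt
  rwa [show deriv (deriv u) x = -(x ^ 2 / 4 - a) * u x by linear_combination h.2 x] at this

theorem isWeberSolution_of_hasDerivAt {a : ℂ} {u u₁ : ℂ → ℂ} (h : ∀ x, HasDerivAt u (u₁ x) x)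
    (h₁ : ∀ x, HasDerivAt u₁ (-(x ^ 2 / 4 - a) * u x) x) : IsWeberSolution a u := by
  refine ⟨fun x => (h x).differentiableAt, fun x => ?_⟩
  rw [show deriv u = u₁ from funext fun x => (h x).deriv, (h₁ x).deriv]
  ring

/-- The substitution `z = -i x² / 2` that turns Kummer's equation into the Weber equation. -/
theorem hasDerivAt_exp_mul_comp {f f₁ : ℂ → ℂ} (hf : ∀ z, HasDerivAt f (f₁ z) z) (x : ℂ) :
    HasDerivAt (fun x => exp (I * x ^ 2 / 4) * f (-(I * x ^ 2 / 2)))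
      (exp (I * x ^ 2 / 4) * (I * x / 2 * f (-(I * x ^ 2 / 2)) -
        I * x * f₁ (-(I * x ^ 2 / 2)))) x := by
  have h1 : HasDerivAt (fun x : ℂ => I * x ^ 2 / 4) (I * x / 2) x := by
    refine (((hasDerivAt_pow 2 x).const_mul I).div_const 4).congr_deriv ?_
    push_cast; ring
  have h2 : HasDerivAt (fun x : ℂ => -(I * x ^ 2 / 2)) (-(I * x)) x := by
    refine (((hasDerivAt_pow 2 x).const_mul I).div_const 2).neg.congr_deriv ?_
    push_cast; ring
  refine (h1.cexp.mul ((hf _).comp x h2)).congr_deriv ?_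
  simp only [Function.comp_apply]
  ring

theorem isWeberSolution_weberEven (a : ℂ) : IsWeberSolution a (weberEven a) := by
  have hb : 1 / 2 ≤ (1 / 2 : ℂ).re := by norm_num
  set f := kummer (1 / 2) (I * a / 2 + 1 / 4) with hf
  have hd : Differentiable ℂ f := differentiable_kummer_right hb _
  have h1 (z) : HasDerivAt f (deriv f z) z := (hd z).hasDerivAt
  have h2 (z) : HasDerivAt (deriv f) (deriv (deriv f) z) z := (hd.deriv z).hasDerivAt
  have hx (x : ℂ) : HasDerivAt (fun x => I * x) I x := by
    simpa using (hasDerivAt_id x).const_mul I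
  refine isWeberSolution_of_hasDerivAt (hasDerivAt_exp_mul_comp h1) fun x => ?_
  have h3 := ((hx x).mul ((hasDerivAt_exp_mul_comp h1 x).const_mul (1 / 2))).sub
    ((hx x).mul (hasDerivAt_exp_mul_comp h2 x))
  refine (h3.congr_of_eventuallyEq (Eventually.of_forall fun y => ?_)).congr_deriv ?_
  · simp only [Pi.sub_apply, Pi.mul_apply]
    ring
  · have key := kummer_ode hb (I * a / 2 + 1 / 4) (-(I * x ^ 2 / 2))
    rw [← hf] at key
    have hw : weberEven a x = exp (I * x ^ 2 / 4) * f (-(I * x ^ 2 / 2)) := rfl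
    rw [hw]
    linear_combination (-2 * I * exp (I * x ^ 2 / 4)) * key +
      exp (I * x ^ 2 / 4) * (f (-(I * x ^ 2 / 2)) * (x ^ 2 / 4 - a)) * I_sq

theorem isWeberSolution_weberOdd (a : ℂ) : IsWeberSolution a (weberOdd a) := by
  have hb : 1 / 2 ≤ (3 / 2 : ℂ).re := by norm_num
  set f := kummer (3 / 2) (I * a / 2 + 3 / 4) with hf
  have hd : Differentiable ℂ f := differentiable_kummer_right hb _
  have h1 (z) : HasDerivAt f (deriv f z) z := (hd z).hasDerivAt
  have h2 (z) : HasDerivAt (deriv f) (deriv (deriv f) z) z := (hd.deriv z).hasDerivAt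
  have hx (x : ℂ) : HasDerivAt (fun x => I * x ^ 2) (I * (2 * x)) x := by
    simpa using (hasDerivAt_pow 2 x).const_mul I
  refine isWeberSolution_of_hasDerivAt
    (fun x => (hasDerivAt_id x).mul (hasDerivAt_exp_mul_comp h1 x)) fun x => ?_
  have h3 := (hasDerivAt_exp_mul_comp h1 x).add (((hx x).mul
    ((hasDerivAt_exp_mul_comp h1 x).const_mul (1 / 2))).sub
    ((hx x).mul (hasDerivAt_exp_mul_comp h2 x)))
  refine (h3.congr_of_eventuallyEq (Eventually.of_forall fun y => ?_)).congr_deriv ?_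
  · simp only [Pi.sub_apply, Pi.mul_apply, Pi.add_apply, id]
    ring
  · have key := kummer_ode hb (I * a / 2 + 3 / 4) (-(I * x ^ 2 / 2))
    rw [← hf] at key
    have hw : weberOdd a x = x * (exp (I * x ^ 2 / 4) * f (-(I * x ^ 2 / 2))) := rfl
    rw [hw]
    linear_combination (-2 * I * x * exp (I * x ^ 2 / 4)) * key +
      x * exp (I * x ^ 2 / 4) * (f (-(I * x ^ 2 / 2)) * (x ^ 2 / 4 - a)) * I_sq

@[simp] theorem weberEven_zero (a : ℂ) : weberEven a 0 = 1 := by simp [weberEven]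

@[simp] theorem weberOdd_zero (a : ℂ) : weberOdd a 0 = 0 := by simp [weberOdd]

@[simp] theorem deriv_weberEven_zero (a : ℂ) : deriv (weberEven a) 0 = 0 := by
  have hd := differentiable_kummer_right (b := 1 / 2) (by norm_num) (I * a / 2 + 1 / 4)
  refine (hasDerivAt_exp_mul_comp (fun z => (hd z).hasDerivAt) 0).deriv.trans ?_
  simp

@[simp] theorem deriv_weberOdd_zero (a : ℂ) : deriv (weberOdd a) 0 = 1 := by
  have hd := differentiable_kummer_right (b := 3 / 2) (by norm_num) (I * a / 2 + 3 / 4)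
  have := ((hasDerivAt_id (0 : ℂ)).mul
    (hasDerivAt_exp_mul_comp (fun z => (hd z).hasDerivAt) 0)).deriv
  refine Eq.trans ?_ (this.trans ?_)
  · rfl
  · simp

theorem differentiable_weberEven : Differentiable ℂ fun q : ℂ × ℂ => weberEven q.1 q.2 := by
  have h := Differentiable.comp (g := fun q : ℂ × ℂ => kummer (1 / 2) q.1 q.2)
    (f := fun q : ℂ × ℂ => (I * q.1 / 2 + 1 / 4, -(I * q.2 ^ 2 / 2)))
    (differentiable_kummer (by norm_num)) (by fun_prop)
  have h' : Differentiable ℂ fun q : ℂ × ℂ => exp (I * q.2 ^ 2 / 4) := by fun_prop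
  exact h'.mul h

theorem differentiable_weberOdd : Differentiable ℂ fun q : ℂ × ℂ => weberOdd q.1 q.2 := by
  have h := Differentiable.comp (g := fun q : ℂ × ℂ => kummer (3 / 2) q.1 q.2)
    (f := fun q : ℂ × ℂ => (I * q.1 / 2 + 3 / 4, -(I * q.2 ^ 2 / 2)))
    (differentiable_kummer (by norm_num)) (by fun_prop)
  have h' : Differentiable ℂ fun q : ℂ × ℂ => exp (I * q.2 ^ 2 / 4) := by fun_prop
  exact differentiable_snd.mul (h'.mul h)

/-! ### Wronskians and uniqueness -/

/-- The Wronskian of two solutions of `y'' = r y` on a connected open set is constant. -/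
theorem wronskian_eq {D : Set ℂ} (hD : IsOpen D) (hD' : IsPreconnected D)
    {u u₁ v v₁ r : ℂ → ℂ} (hu : ∀ x ∈ D, HasDerivAt u (u₁ x) x)
    (hu₁ : ∀ x ∈ D, HasDerivAt u₁ (r x * u x) x) (hv : ∀ x ∈ D, HasDerivAt v (v₁ x) x)
    (hv₁ : ∀ x ∈ D, HasDerivAt v₁ (r x * v x) x) {x y : ℂ} (hx : x ∈ D) (hy : y ∈ D) :
    u x * v₁ x - u₁ x * v x = u y * v₁ y - u₁ y * v y := by
  have hd : ∀ z ∈ D, HasDerivAt (fun z => u z * v₁ z - u₁ z * v z) 0 z := fun z hz => by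
    refine (((hu z hz).mul (hv₁ z hz)).sub ((hu₁ z hz).mul (hv z hz))).congr_deriv ?_
    ring
  exact hD.is_const_of_deriv_eq_zero hD'
    (fun z hz => (hd z hz).differentiableAt.differentiableWithinAt)
    (fun z hz => (hd z hz).deriv) hx hy

theorem IsWeberSolution.wronskian_eq_wronskian_zero {a : ℂ} {u v : ℂ → ℂ} (hu : IsWeberSolution a u)
    (hv : IsWeberSolution a v) (x : ℂ) :
    u x * deriv v x - deriv u x * v x = u 0 * deriv v 0 - deriv u 0 * v 0 :=
  wronskian_eq isOpen_univ isPreconnected_univ (r := fun x => -(x ^ 2 / 4 - a))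
    (fun x _ => hu.hasDerivAt x) (fun x _ => hu.hasDerivAt_deriv x)
    (fun x _ => hv.hasDerivAt x) (fun x _ => hv.hasDerivAt_deriv x) (mem_univ x) (mem_univ 0)

theorem wronskian_weberEven_weberOdd (a x : ℂ) :
    weberEven a x * deriv (weberOdd a) x - deriv (weberEven a) x * weberOdd a x = 1 := by
  simpa using (isWeberSolution_weberEven a).wronskian_eq_wronskian_zero
    (isWeberSolution_weberOdd a) x

theorem IsWeberSolution.eq_weberEven_add_weberOdd {a : ℂ} {u : ℂ → ℂ} (hu : IsWeberSolution a u)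
    (x : ℂ) : u x = u 0 * weberEven a x + deriv u 0 * weberOdd a x := by
  have h1 := hu.wronskian_eq_wronskian_zero (isWeberSolution_weberEven a) x
  have h2 := hu.wronskian_eq_wronskian_zero (isWeberSolution_weberOdd a) x
  have h3 := wronskian_weberEven_weberOdd a x
  simp only [weberEven_zero, weberOdd_zero, deriv_weberEven_zero, deriv_weberOdd_zero] at h1 h2
  linear_combination -u x * h3 + weberEven a x * h2 - weberOdd a x * h1

theorem IsWeberSolution.ext {a : ℂ} {u v : ℂ → ℂ} (hu : IsWeberSolution a u)
    (hv : IsWeberSolution a v) (h0 : u 0 = v 0) (h1 : deriv u 0 = deriv v 0) : u = v := by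
  funext x
  rw [hu.eq_weberEven_add_weberOdd, hv.eq_weberEven_add_weberOdd, h0, h1]

theorem IsWeberSolution.linearCombination {a : ℂ} {u v : ℂ → ℂ} (hu : IsWeberSolution a u)
    (hv : IsWeberSolution a v) (c d : ℂ) : IsWeberSolution a fun x => c * u x + d * v x := by
  refine isWeberSolution_of_hasDerivAt
    (fun x => ((hu.hasDerivAt x).const_mul c).add ((hv.hasDerivAt x).const_mul d)) fun x => ?_
  refine (((hu.hasDerivAt_deriv x).const_mul c).add
    ((hv.hasDerivAt_deriv x).const_mul d)).congr_deriv ?_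
  ring

theorem IsWeberSolution.deriv_linearCombination {a : ℂ} {u v : ℂ → ℂ} (hu : IsWeberSolution a u)
    (hv : IsWeberSolution a v) (c d x : ℂ) :
    deriv (fun x => c * u x + d * v x) x = c * deriv u x + d * deriv v x :=
  (((hu.hasDerivAt x).const_mul c).add ((hv.hasDerivAt x).const_mul d)).deriv

theorem IsWeberSolution.hasDerivAt_comp_neg {a : ℂ} {u : ℂ → ℂ} (hu : IsWeberSolution a u)
    (x : ℂ) : HasDerivAt (fun x => u (-x)) (-deriv u (-x)) x :=
  ((hu.hasDerivAt (-x)).comp x (hasDerivAt_neg x)).congr_deriv (by ring)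

theorem IsWeberSolution.comp_neg {a : ℂ} {u : ℂ → ℂ} (hu : IsWeberSolution a u) :
    IsWeberSolution a fun x => u (-x) := by
  refine isWeberSolution_of_hasDerivAt hu.hasDerivAt_comp_neg fun x => ?_
  refine ((hu.hasDerivAt_deriv (-x)).comp x (hasDerivAt_neg x)).neg.congr_deriv ?_
  ring

/-! ### Estimates for complex powers -/

theorem norm_cpow_le_rpow_mul_exp (z w : ℂ) :
    ‖z ^ w‖ ≤ ‖z‖ ^ w.re * Real.exp (Real.pi * |w.im|) := by
  refine (norm_cpow_le z w).trans ?_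
  rw [div_eq_mul_inv, ← Real.exp_neg]
  gcongr
  calc -(arg z * w.im) ≤ |arg z * w.im| := neg_le_abs _
    _ = |arg z| * |w.im| := abs_mul _ _
    _ ≤ _ := by gcongr; exact abs_arg_le_pi z

theorem rpow_mul_exp_le_norm_cpow {z : ℂ} (hz : z ≠ 0) (w : ℂ) :
    ‖z‖ ^ w.re * Real.exp (-(Real.pi * |w.im|)) ≤ ‖z ^ w‖ := by
  rw [norm_cpow_of_ne_zero hz, div_eq_mul_inv, ← Real.exp_neg]
  refine mul_le_mul_of_nonneg_left (Real.exp_le_exp.2 (neg_le_neg ?_)) (by positivity)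
  calc arg z * w.im ≤ |arg z * w.im| := le_abs_self _
    _ = |arg z| * |w.im| := abs_mul _ _
    _ ≤ _ := by gcongr; exact abs_arg_le_pi z

/-- Multiplicativity of the principal power: the arguments of two factors in the right half plane
add up to less than `π`. -/
theorem mul_cpow_of_re {u v : ℂ} (hu0 : u ≠ 0) (hu : 0 ≤ u.re) (hv : 0 < v.re) (w : ℂ) :
    (u * v) ^ w = u ^ w * v ^ w := by
  have hv0 : v ≠ 0 := fun h => by simp [h] at hv
  have h1 := abs_le.1 (abs_arg_le_pi_div_two_iff.2 hu)
  have h2 := abs_lt.1 (abs_arg_lt_pi_div_two_iff.2 (Or.inl hv))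
  rw [cpow_def_of_ne_zero (mul_ne_zero hu0 hv0), cpow_def_of_ne_zero hu0,
    cpow_def_of_ne_zero hv0, log_mul hu0 hv0 ⟨by linarith, by linarith⟩, ← exp_add]
  ring_nf

theorem mul_ofReal_cpow {y : ℝ} (hy : 0 < y) {u : ℂ} (hu : u ≠ 0) (w : ℂ) :
    (u * y) ^ w = u ^ w * (y : ℂ) ^ w := by
  have hy' : (y : ℂ) ≠ 0 := ofReal_ne_zero.2 hy.ne'
  rw [cpow_def_of_ne_zero (mul_ne_zero hu hy'), cpow_def_of_ne_zero hu, cpow_def_of_ne_zero hy',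
    log_mul_ofReal y hy u hu, ofReal_log hy.le, ← exp_add]
  ring_nf

theorem ofReal_cpow_sub_one_mul {p : ℝ} (hp : 0 < p) (μ : ℂ) :
    (p : ℂ) ^ (μ - 1) * p = (p : ℂ) ^ μ := by
  have hp' : (p : ℂ) ≠ 0 := ofReal_ne_zero.2 hp.ne'
  rw [cpow_sub _ _ hp', cpow_one, div_mul_cancel₀ _ hp']

theorem exists_one_add_pow_le_exp (N : ℕ) {τ : ℝ} (hτ : 0 < τ) :
    ∃ C : ℝ, 0 ≤ C ∧ ∀ y : ℝ, 0 ≤ y → (1 + 4 * y) ^ N ≤ C * Real.exp (τ * y) := by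
  refine ⟨N.factorial * (4 / τ) ^ N * Real.exp (τ / 4), by positivity, fun y hy => ?_⟩
  have h := Real.pow_div_factorial_le_exp (x := τ / 4 * (1 + 4 * y)) (by positivity) N
  have h2 : Real.exp (τ / 4 * (1 + 4 * y)) = Real.exp (τ / 4) * Real.exp (τ * y) := by
    rw [← Real.exp_add]; ring_nf
  rw [h2, div_le_iff₀ (by positivity), mul_pow] at h
  calc (1 + 4 * y) ^ N = (4 / τ) ^ N * ((τ / 4) ^ N * (1 + 4 * y) ^ N) := by
        rw [← mul_assoc, ← mul_pow]; field_simp; simp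
    _ ≤ (4 / τ) ^ N * (Real.exp (τ / 4) * Real.exp (τ * y) * N.factorial) := by gcongr
    _ = _ := by ring

theorem integrableOn_rpow_mul_exp_neg {ν τ : ℝ} (hν : 0 < ν) (hτ : 0 < τ) :
    IntegrableOn (fun p : ℝ => p ^ (ν - 1) * Real.exp (-(τ * p))) (Ioi 0) := by
  have := integrableOn_rpow_mul_exp_neg_mul_rpow (p := 1) (s := ν - 1) (b := τ) (by linarith)
    one_pos hτ
  simpa using this

theorem integrableOn_cpow_mul {μ : ℂ} (hμ : 0 < μ.re) {g : ℝ → ℂ} (hg : ContinuousOn g (Ioi 0))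
    {C τ : ℝ} (hτ : 0 < τ) (hC : ∀ p : ℝ, 0 < p → ‖g p‖ ≤ C * Real.exp (-(τ * p))) :
    IntegrableOn (fun p : ℝ => (p : ℂ) ^ (μ - 1) * g p) (Ioi 0) := by
  have hc : ContinuousOn (fun p : ℝ => (p : ℂ) ^ (μ - 1) * g p) (Ioi 0) := by
    refine ContinuousOn.mul (fun p hp => ?_) hg
    exact (continuousAt_ofReal_cpow_const p (μ - 1) (Or.inr (ne_of_gt hp))).continuousWithinAt
  refine Integrable.mono' ((integrableOn_rpow_mul_exp_neg hμ hτ).const_mul C)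
    (hc.aestronglyMeasurable measurableSet_Ioi) ?_
  refine ae_restrict_of_forall_mem measurableSet_Ioi fun p hp => ?_
  rw [norm_mul, norm_cpow_eq_rpow_re_of_pos hp]
  calc p ^ (μ - 1).re * ‖g p‖ ≤ p ^ (μ - 1).re * (C * Real.exp (-(τ * p))) := by
        gcongr
        · exact Real.rpow_nonneg (le_of_lt hp) _
        · exact hC p hp
    _ = _ := by simp; ring

/-! ### The Laplace integrals -/

theorem unit_sq {η : ℂ} (hη : η = I ∨ η = -I) : η ^ 2 = -1 := by
  rcases hη with rfl | rfl <;> simp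

theorem unit_ne_zero {η : ℂ} (hη : η = I ∨ η = -I) : η ≠ 0 := by
  rcases hη with rfl | rfl <;> simp

theorem unit_re {η : ℂ} (hη : η = I ∨ η = -I) : η.re = 0 := by
  rcases hη with rfl | rfl <;> simp

theorem one_add_unit_mul_re {η : ℂ} (hη : η = I ∨ η = -I) (p : ℝ) : (1 + 2 * η * p).re = 1 := by
  simp [unit_re hη]

theorem one_add_unit_mul_ne_zero {η : ℂ} (hη : η = I ∨ η = -I) (p : ℝ) : 1 + 2 * η * p ≠ 0 := by
  intro h
  have := one_add_unit_mul_re hη p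
  simp [h] at this

theorem one_add_unit_mul_mem_slitPlane {η : ℂ} (hη : η = I ∨ η = -I) (p : ℝ) :
    1 + 2 * η * p ∈ slitPlane := Or.inl (by rw [one_add_unit_mul_re hη]; exact one_pos)

/-- The kernel `e ^ (-p s) (1 + 2 η p) ^ (-β)`, where `η = ± i`. -/
def laplaceKernel (η β s p : ℂ) : ℂ := exp (-(p * s)) * (1 + 2 * η * p) ^ (-β)

/-- The Laplace integral `∫₀^∞ p ^ (μ - 1) e ^ (-p s) (1 + 2 η p) ^ (-β) dp`. -/
def laplaceInt (η μ β s : ℂ) : ℂ :=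
  ∫ p in Ioi (0 : ℝ), (p : ℂ) ^ (μ - 1) * laplaceKernel η β s p

theorem rpow_le_pow_of_mem_Icc {r M e : ℝ} {N : ℕ} (hr : M⁻¹ ≤ r) (hrM : r ≤ M) (hM : 1 ≤ M)
    (hN : |e| ≤ N) : r ^ e ≤ M ^ N := by
  have hM0 : 0 < M := by linarith
  have hr0 : 0 < r := (inv_pos.2 hM0).trans_le hr
  have key : ∀ t : ℝ, 0 < t → t ≤ M → ∀ f : ℝ, 0 ≤ f → f ≤ N → t ^ f ≤ M ^ N := by
    intro t ht htM f hf hfN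
    calc t ^ f ≤ M ^ f := Real.rpow_le_rpow ht.le htM hf
      _ ≤ M ^ (N : ℝ) := Real.rpow_le_rpow_of_exponent_le hM hfN
      _ = M ^ N := Real.rpow_natCast _ _
  rcases le_total 0 e with he | he
  · exact key r hr0 hrM e he (by rwa [abs_of_nonneg he] at hN)
  · have h := key r⁻¹ (inv_pos.2 hr0) (inv_le_of_inv_le₀ hM0 hr) (-e) (by linarith)
      (by rwa [abs_of_nonpos he] at hN)
    rwa [Real.inv_rpow hr0.le, Real.rpow_neg hr0.le, inv_inv] at h

/-- For real `p` the base `1 + 2 η p` has real part `1`, so its power grows at most polynomially,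
and this is absorbed by half of the exponential decay. -/
theorem exists_norm_laplaceKernel_le {η : ℂ} (hη : η = I ∨ η = -I) (β : ℂ) {σ : ℝ} (hσ : 0 < σ) :
    ∃ C : ℝ, 0 ≤ C ∧ ∀ s : ℂ, σ ≤ s.re → ∀ p : ℝ, 0 < p →
      ‖laplaceKernel η β s p‖ ≤ C * Real.exp (-(σ / 2 * p)) := by
  obtain ⟨N, hN⟩ := exists_nat_ge |(-β).re|
  obtain ⟨C, hC0, hC⟩ := exists_one_add_pow_le_exp N (half_pos hσ)
  refine ⟨C * Real.exp (Real.pi * |(-β).im|), by positivity, fun s hs p hp => ?_⟩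
  have h1 : 1 ≤ ‖1 + 2 * η * p‖ := by
    refine le_trans ?_ (re_le_norm _)
    rw [one_add_unit_mul_re hη]
  have h2 : ‖1 + 2 * η * p‖ ≤ 1 + 4 * p := by
    have : ‖η‖ = 1 := by rcases hη with rfl | rfl <;> simp
    calc ‖1 + 2 * η * p‖ ≤ ‖(1 : ℂ)‖ + ‖2 * η * p‖ := norm_add_le _ _
      _ = 1 + 2 * p := by simp [this, abs_of_pos hp]
      _ ≤ _ := by linarith
  have h3 : ‖1 + 2 * η * p‖ ^ (-β).re ≤ (1 + 4 * p) ^ N := by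
    refine rpow_le_pow_of_mem_Icc ?_ h2 (by linarith) hN
    exact (inv_le_one_of_one_le₀ (by linarith)).trans h1
  have h4 : ‖exp (-((p : ℂ) * s))‖ ≤ Real.exp (-(σ * p)) := by
    rw [norm_exp]
    refine Real.exp_le_exp.2 ?_
    simp
    nlinarith
  have h5 : Real.exp (-(σ * p)) * Real.exp (σ / 2 * p) = Real.exp (-(σ / 2 * p)) := by
    rw [← Real.exp_add]; ring_nf
  rw [laplaceKernel, norm_mul]
  calc ‖exp (-((p : ℂ) * s))‖ * ‖(1 + 2 * η * p) ^ (-β)‖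
      ≤ Real.exp (-(σ * p)) * (C * Real.exp (σ / 2 * p) * Real.exp (Real.pi * |(-β).im|)) := by
        gcongr
        refine (norm_cpow_le_rpow_mul_exp _ _).trans ?_
        gcongr
        exact h3.trans (hC p hp.le)
    _ = C * Real.exp (Real.pi * |(-β).im|) *
          (Real.exp (-(σ * p)) * Real.exp (σ / 2 * p)) := by ring
    _ = _ := by rw [h5]

theorem continuous_laplaceKernel {η : ℂ} (hη : η = I ∨ η = -I) (β s : ℂ) :
    Continuous fun p : ℝ => laplaceKernel η β s p := by
  unfold laplaceKernel
  refine Continuous.mul (by fun_prop) ?_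
  exact Continuous.cpow (by fun_prop) continuous_const
    fun p => one_add_unit_mul_mem_slitPlane hη p

theorem integrableOn_laplaceInt {η : ℂ} (hη : η = I ∨ η = -I) {μ : ℂ} (hμ : 0 < μ.re) (β : ℂ)
    {s : ℂ} (hs : 0 < s.re) :
    IntegrableOn (fun p : ℝ => (p : ℂ) ^ (μ - 1) * laplaceKernel η β s p) (Ioi 0) := by
  obtain ⟨C, -, hC⟩ := exists_norm_laplaceKernel_le hη β hs
  exact integrableOn_cpow_mul hμ (continuous_laplaceKernel hη β s).continuousOn (half_pos hs)
    fun p hp => hC s le_rfl p hp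

theorem hasDerivAt_laplaceInt {η : ℂ} (hη : η = I ∨ η = -I) {μ : ℂ} (hμ : 0 < μ.re) (β : ℂ)
    {s : ℂ} (hs : 0 < s.re) :
    HasDerivAt (laplaceInt η μ β) (-laplaceInt η (μ + 1) β s) s := by
  obtain ⟨C, hC0, hC⟩ := exists_norm_laplaceKernel_le hη β (half_pos hs)
  have hμ' : 0 < (μ + 1).re := by simp; linarith
  have hopen : {z : ℂ | s.re / 2 < z.re} ∈ 𝓝 s :=
    (isOpen_lt continuous_const continuous_re).mem_nhds (by simpa using hs)
  have hint : IntegrableOn (fun p : ℝ => p ^ ((μ + 1).re - 1) *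
      Real.exp (-(s.re / 2 / 2 * p)) * C) (Ioi 0) :=
    (integrableOn_rpow_mul_exp_neg hμ' (by positivity)).mul_const C
  have key := hasDerivAt_integral_of_dominated_loc_of_deriv_le
    (μ := volume.restrict (Ioi (0 : ℝ)))
    (F := fun z (p : ℝ) => (p : ℂ) ^ (μ - 1) * laplaceKernel η β z p)
    (F' := fun z (p : ℝ) => -((p : ℂ) ^ (μ + 1 - 1) * laplaceKernel η β z p)) hopen
    (by
      filter_upwards [(isOpen_lt continuous_const continuous_re).mem_nhds hs] with z hz
      exact (integrableOn_laplaceInt hη hμ β hz).aestronglyMeasurable)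
    (integrableOn_laplaceInt hη hμ β hs)
    (integrableOn_laplaceInt hη hμ' β hs).neg.aestronglyMeasurable
    (ae_restrict_of_forall_mem measurableSet_Ioi fun p hp z hz => by
      rw [norm_neg, norm_mul, norm_cpow_eq_rpow_re_of_pos hp, mul_assoc]
      have h := hC z (le_of_lt hz) p hp
      have hp0 : (0 : ℝ) < p := hp
      simp only [sub_re, one_re]
      gcongr
      linarith)
    hint
    (ae_restrict_of_forall_mem measurableSet_Ioi fun p hp z hz => by
      unfold laplaceKernel
      have h1 : HasDerivAt (fun z : ℂ => -((p : ℂ) * z)) (-p) z :=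
        ((hasDerivAt_id z).const_mul (p : ℂ)).neg.congr_deriv (by simp)
      refine ((h1.cexp.mul_const _).const_mul _).congr_deriv ?_
      rw [show μ + 1 - 1 = μ by ring, ← ofReal_cpow_sub_one_mul hp μ]
      ring)
  refine key.2.congr_deriv ?_
  rw [integral_neg]
  rfl

theorem laplaceKernel_eq {η : ℂ} (hη : η = I ∨ η = -I) (β s : ℂ) (p : ℝ) :
    laplaceKernel η β s p = (1 + 2 * η * p) * laplaceKernel η (β + 1) s p := by
  have h := one_add_unit_mul_ne_zero hη p
  rw [laplaceKernel, laplaceKernel, show -β = -(β + 1) + 1 by ring, cpow_add _ _ h, cpow_one]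
  ring

theorem laplaceInt_eq_add {η : ℂ} (hη : η = I ∨ η = -I) {μ : ℂ} (hμ : 0 < μ.re) (β : ℂ)
    {s : ℂ} (hs : 0 < s.re) :
    laplaceInt η μ β s = laplaceInt η μ (β + 1) s + 2 * η * laplaceInt η (μ + 1) (β + 1) s := by
  have hμ' : 0 < (μ + 1).re := by simp; linarith
  rw [laplaceInt, laplaceInt, laplaceInt, ← integral_const_mul,
    ← integral_add (integrableOn_laplaceInt hη hμ _ hs)
      ((integrableOn_laplaceInt hη hμ' _ hs).const_mul _)]
  refine setIntegral_congr_fun measurableSet_Ioi fun p hp => ?_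
  rw [laplaceKernel_eq hη, show μ + 1 - 1 = μ by ring, ← ofReal_cpow_sub_one_mul hp μ]
  ring

theorem hasDerivAt_laplaceKernel_of_mem_slitPlane {η p : ℂ} (β s : ℂ)
    (hp : 1 + 2 * η * p ∈ slitPlane) :
    HasDerivAt (laplaceKernel η β s)
      (-s * laplaceKernel η β s p + -(2 * η * β) * laplaceKernel η (β + 1) s p) p := by
  have h1 : HasDerivAt (fun p : ℂ => exp (-(p * s))) (exp (-(p * s)) * -s) p := by
    simpa using ((hasDerivAt_id p).mul_const s).neg.cexp
  have h2 : HasDerivAt (fun p : ℂ => 1 + 2 * η * p) (2 * η) p := by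
    simpa using ((hasDerivAt_id p).const_mul (2 * η)).const_add 1
  refine (h1.mul (h2.cpow_const (c := -β) hp)).congr_deriv ?_
  unfold laplaceKernel
  rw [show -(β + 1) = -β - 1 by ring]
  ring

theorem hasDerivAt_laplaceKernel {η : ℂ} (hη : η = I ∨ η = -I) (β s : ℂ) (p : ℝ) :
    HasDerivAt (fun p : ℝ => laplaceKernel η β s p)
      (-s * laplaceKernel η β s p + -(2 * η * β) * laplaceKernel η (β + 1) s p) p :=
  (hasDerivAt_laplaceKernel_of_mem_slitPlane β s
    (one_add_unit_mul_mem_slitPlane hη p)).comp_ofReal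

theorem hasDerivAt_cpow_mul_laplaceKernel {η : ℂ} (hη : η = I ∨ η = -I) (μ β s : ℂ) {p : ℝ}
    (hp : 0 < p) :
    HasDerivAt (fun p : ℝ => (p : ℂ) ^ μ * laplaceKernel η β s p)
      (μ * ((p : ℂ) ^ (μ - 1) * laplaceKernel η β s p) -
        (p : ℂ) ^ μ * (s * laplaceKernel η β s p +
          2 * η * β * laplaceKernel η (β + 1) s p)) p := by
  have h1 : HasDerivAt (fun p : ℝ => (p : ℂ) ^ μ) (μ * (p : ℂ) ^ (μ - 1)) p := by
    have := ((hasDerivAt_id (p : ℂ)).cpow_const (c := μ) (Or.inl hp)).comp_ofReal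
    simpa using this
  refine (h1.mul (hasDerivAt_laplaceKernel hη β s p)).congr_deriv ?_
  ring

theorem tendsto_cpow_mul_laplaceKernel {η : ℂ} (hη : η = I ∨ η = -I) (μ β : ℂ) {s : ℂ}
    (hs : 0 < s.re) :
    Tendsto (fun p : ℝ => (p : ℂ) ^ μ * laplaceKernel η β s p) atTop (𝓝 0) := by
  obtain ⟨C, -, hC⟩ := exists_norm_laplaceKernel_le hη β hs
  have h := (tendsto_rpow_mul_exp_neg_mul_atTop_nhds_zero μ.re (s.re / 2) (half_pos hs)).const_mul C
  rw [mul_zero] at h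
  refine squeeze_zero_norm' ?_ h
  filter_upwards [eventually_gt_atTop 0] with p hp
  rw [norm_mul, norm_cpow_eq_rpow_re_of_pos hp]
  calc p ^ μ.re * ‖laplaceKernel η β s p‖ ≤ p ^ μ.re * (C * Real.exp (-(s.re / 2 * p))) := by
        gcongr
        exact hC s le_rfl p hp
    _ = _ := by rw [neg_mul]; ring

/-- Integration by parts in the Laplace integral. -/
theorem laplaceInt_integration_by_parts {η : ℂ} (hη : η = I ∨ η = -I) {μ : ℂ} (hμ : 0 < μ.re)
    (β : ℂ) {s : ℂ} (hs : 0 < s.re) :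
    μ * laplaceInt η μ β s =
      s * laplaceInt η (μ + 1) β s + 2 * η * β * laplaceInt η (μ + 1) (β + 1) s := by
  have hμ' : 0 < (μ + 1).re := by simp; linarith
  have i1 := integrableOn_laplaceInt hη hμ β hs
  have i2 := integrableOn_laplaceInt hη hμ' β hs
  have i3 := integrableOn_laplaceInt hη hμ' (β + 1) hs
  have hd : ∀ p ∈ Ioi (0 : ℝ), HasDerivAt (fun p : ℝ => (p : ℂ) ^ μ * laplaceKernel η β s p)
      (μ * ((p : ℂ) ^ (μ - 1) * laplaceKernel η β s p) -
        (s * ((p : ℂ) ^ (μ + 1 - 1) * laplaceKernel η β s p) +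
          2 * η * β * ((p : ℂ) ^ (μ + 1 - 1) * laplaceKernel η (β + 1) s p))) p := fun p hp => by
    refine (hasDerivAt_cpow_mul_laplaceKernel hη μ β s hp).congr_deriv ?_
    rw [show μ + 1 - 1 = μ by ring]
    ring
  have hcont : ContinuousWithinAt (fun p : ℝ => (p : ℂ) ^ μ * laplaceKernel η β s p) (Ici 0) 0 :=
    ((continuousAt_ofReal_cpow_const 0 μ (Or.inl hμ)).mul
      (continuous_laplaceKernel hη β s).continuousAt).continuousWithinAt
  have i23 : IntegrableOn (fun p : ℝ => s * ((p : ℂ) ^ (μ + 1 - 1) * laplaceKernel η β s p) +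
      2 * η * β * ((p : ℂ) ^ (μ + 1 - 1) * laplaceKernel η (β + 1) s p)) (Ioi 0) :=
    (i2.const_mul s).add (i3.const_mul (2 * η * β))
  have key := integral_Ioi_of_hasDerivAt_of_tendsto hcont hd ((i1.const_mul μ).sub i23)
    (tendsto_cpow_mul_laplaceKernel hη μ β hs)
  have hμ0 : μ ≠ 0 := fun h => by simp [h] at hμ
  rw [integral_sub (i1.const_mul μ) i23,
    integral_add (i2.const_mul s) (i3.const_mul (2 * η * β)), integral_const_mul,
    integral_const_mul, integral_const_mul, ofReal_zero, zero_cpow hμ0, zero_mul, sub_zero] at key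
  unfold laplaceInt
  linear_combination key

/-! ### The dual form of the Laplace integrals -/

theorem integrableOn_cpow_mul_cexp {μ s : ℂ} (hμ : 0 < μ.re) (hs : 0 < s.re) :
    IntegrableOn (fun p : ℝ => (p : ℂ) ^ (μ - 1) * exp (-(p * s))) (Ioi 0) := by
  refine integrableOn_cpow_mul hμ (by fun_prop) (C := 1) hs fun p _ => ?_
  rw [norm_exp, one_mul]
  refine Real.exp_le_exp.2 (le_of_eq ?_)
  simp [mul_comm]

/-- Euler's integral for `Γ`, with a complex scaling `s` in the right half plane.  Both sides are
analytic in `s` and agree for real `s`. -/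
theorem integral_cpow_mul_cexp {μ s : ℂ} (hμ : 0 < μ.re) (hs : 0 < s.re) :
    ∫ p in Ioi (0 : ℝ), (p : ℂ) ^ (μ - 1) * exp (-(p * s)) = Gamma μ * s ^ (-μ) := by
  have hU : IsOpen {z : ℂ | 0 < z.re} := isOpen_lt continuous_const continuous_re
  have hL (z : ℂ) : laplaceInt I μ 0 z =
      ∫ p in Ioi (0 : ℝ), (p : ℂ) ^ (μ - 1) * exp (-(p * z)) := by
    simp [laplaceInt, laplaceKernel]
  have hf : AnalyticOnNhd ℂ (laplaceInt I μ 0) {z : ℂ | 0 < z.re} :=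
    DifferentiableOn.analyticOnNhd (fun z hz =>
      (hasDerivAt_laplaceInt (Or.inl rfl) hμ 0 hz).differentiableAt.differentiableWithinAt) hU
  have hg : AnalyticOnNhd ℂ (fun z : ℂ => Gamma μ * z ^ (-μ)) {z : ℂ | 0 < z.re} :=
    DifferentiableOn.analyticOnNhd (fun z hz =>
      ((differentiableAt_id.cpow_const (Or.inl hz)).const_mul _).differentiableWithinAt) hU
  have h3 : Tendsto ((↑) : ℝ → ℂ) (𝓝[≠] 1) (𝓝[≠] 1) := by
    rw [tendsto_nhdsWithin_iff]
    constructor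
    · exact tendsto_nhdsWithin_of_tendsto_nhds continuous_ofReal.continuousAt
    · exact eventually_nhdsWithin_iff.mpr (Eventually.of_forall fun t ht => ofReal_ne_one.mpr ht)
  have key := hf.eqOn_of_preconnected_of_frequently_eq hg
    (convex_halfSpace_re_gt 0).isPreconnected (z₀ := 1) (by simp) (h3.frequently ?_) hs
  · rw [← hL]
    exact key
  · refine (Eventually.filter_mono nhdsWithin_le_nhds ?_).frequently
    filter_upwards [eventually_gt_nhds zero_lt_one] with r hr
    rw [hL, mul_comm (Gamma μ), cpow_neg, ← inv_cpow _ _ (by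
      rw [arg_ofReal_of_nonneg (le_of_lt hr)]; exact Real.pi_pos.ne), ← one_div,
      ← integral_cpow_mul_exp_neg_mul_Ioi hμ hr]
    simp only [mul_comm]

theorem re_dual {η : ℂ} (hη : η = I ∨ η = -I) {s : ℂ} {y : ℝ} :
    (s + 2 * (1 + η) * y).re = s.re + 2 * y := by
  rcases hη with rfl | rfl <;> simp

theorem one_sub_mul_re {η : ℂ} (hη : η = I ∨ η = -I) (p : ℝ) :
    ((1 + 2 * η * p) * (1 - η)).re = 1 + 2 * p := by
  rcases hη with rfl | rfl <;> simp

theorem one_sub_re {η : ℂ} (hη : η = I ∨ η = -I) : (1 - η).re = 1 := by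
  simp [unit_re hη]

theorem continuousOn_dual {η : ℂ} (hη : η = I ∨ η = -I) (μ : ℂ) {s : ℂ} (hs : 0 < s.re) :
    ContinuousOn (fun y : ℝ => (s + 2 * (1 + η) * y) ^ (-μ)) (Ioi 0) := by
  refine ContinuousOn.cpow (by fun_prop) (by fun_prop) fun y hy => Or.inl ?_
  have hy' : (0 : ℝ) < y := hy
  rw [re_dual hη]
  linarith

/-- The dual form of the Laplace integral, obtained by writing `(1 + 2 η p) ^ (-β)` as an Euler
integral along the ray of direction `1 - η` and exchanging the two integrations.  The base
`s + 2 (1 + η) y` has norm at least `‖s‖ / 2` for all `Re s > 0`, which gives estimates that are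
uniform up to the boundary of the half plane; `laplaceInt` itself gives none near the imaginary
axis. -/
theorem laplaceInt_dual {η : ℂ} (hη : η = I ∨ η = -I) {μ β s : ℂ} (hμ : 0 < μ.re)
    (hβ : 0 < β.re) (hs : 0 < s.re) :
    Gamma β * (1 - η) ^ (-β) * laplaceInt η μ β s =
      Gamma μ * ∫ y in Ioi (0 : ℝ), (y : ℂ) ^ (β - 1) *
        (exp (-(y * (1 - η))) * (s + 2 * (1 + η) * y) ^ (-μ)) := by
  set f : ℝ → ℝ → ℂ := fun p y => (p : ℂ) ^ (μ - 1) * (y : ℂ) ^ (β - 1) *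
    exp (-(p * s) - y * (1 - η) - 2 * (1 + η) * p * y) with hf
  have h1 : ∀ p ∈ Ioi (0 : ℝ), Gamma β * (1 - η) ^ (-β) *
      ((p : ℂ) ^ (μ - 1) * laplaceKernel η β s p) = ∫ y in Ioi (0 : ℝ), f p y := by
    intro p hp
    have hp' : (0 : ℝ) < p := hp
    have hre : 0 < ((1 + 2 * η * p) * (1 - η)).re := by rw [one_sub_mul_re hη]; linarith
    have e := integral_cpow_mul_cexp hβ hre
    rw [mul_cpow_of_re (one_add_unit_mul_ne_zero hη p) (by rw [one_add_unit_mul_re hη]; norm_num)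
      (by rw [one_sub_re hη]; norm_num)] at e
    calc _ = (p : ℂ) ^ (μ - 1) * exp (-(p * s)) *
          (Gamma β * ((1 + 2 * η * p) ^ (-β) * (1 - η) ^ (-β))) := by
            rw [laplaceKernel]; ring
      _ = _ := by
        rw [← e, ← integral_const_mul]
        refine setIntegral_congr_fun measurableSet_Ioi fun y _ => ?_
        simp only [hf]
        rw [show -((p : ℂ) * s) - y * (1 - η) - 2 * (1 + η) * p * y =
          -(p * s) + -(y * ((1 + 2 * η * p) * (1 - η))) by
            linear_combination (-2 * p * y : ℂ) * unit_sq hη, exp_add]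
        ring
  have h2 : ∀ y ∈ Ioi (0 : ℝ), ∫ p in Ioi (0 : ℝ), f p y = Gamma μ * ((y : ℂ) ^ (β - 1) *
        (exp (-(y * (1 - η))) * (s + 2 * (1 + η) * y) ^ (-μ))) := by
    intro y hy
    have hy' : (0 : ℝ) < y := hy
    have hre : 0 < (s + 2 * (1 + η) * y).re := by rw [re_dual hη]; linarith
    calc _ = ∫ p in Ioi (0 : ℝ), ((y : ℂ) ^ (β - 1) * exp (-(y * (1 - η)))) *
          ((p : ℂ) ^ (μ - 1) * exp (-(p * (s + 2 * (1 + η) * y)))) := by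
            refine setIntegral_congr_fun measurableSet_Ioi fun p _ => ?_
            simp only [hf]
            rw [show -((p : ℂ) * s) - y * (1 - η) - 2 * (1 + η) * p * y =
              -(y * (1 - η)) + -(p * (s + 2 * (1 + η) * y)) by ring, exp_add]
            ring
      _ = _ := by rw [integral_const_mul, integral_cpow_mul_cexp hμ hre]; ring
  have hcont : ContinuousOn (Function.uncurry f) (Ioi (0 : ℝ) ×ˢ Ioi (0 : ℝ)) := by
    have hc (ν : ℂ) : ContinuousOn (fun p : ℝ => (p : ℂ) ^ ν) (Ioi 0) := fun p hp =>
      (continuousAt_ofReal_cpow_const p ν (Or.inr (ne_of_gt hp))).continuousWithinAt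
    refine ContinuousOn.mul (ContinuousOn.mul ?_ ?_) (by fun_prop)
    · exact (hc (μ - 1)).comp continuousOn_fst fun q hq => hq.1
    · exact (hc (β - 1)).comp continuousOn_snd fun q hq => hq.2
  have hint : Integrable (Function.uncurry f)
      ((volume.restrict (Ioi (0 : ℝ))).prod (volume.restrict (Ioi (0 : ℝ)))) := by
    have i1 : Integrable (fun p : ℝ => p ^ (μ.re - 1) * Real.exp (-(s.re * p)))
      (volume.restrict (Ioi (0 : ℝ))) := integrableOn_rpow_mul_exp_neg hμ hs
    have i2 : Integrable (fun y : ℝ => y ^ (β.re - 1) * Real.exp (-(1 * y)))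
      (volume.restrict (Ioi (0 : ℝ))) := integrableOn_rpow_mul_exp_neg hβ one_pos
    refine (i1.mul_prod i2).mono' ?_ ?_
    · rw [Measure.prod_restrict]
      exact hcont.aestronglyMeasurable (measurableSet_Ioi.prod measurableSet_Ioi)
    · rw [Measure.prod_restrict]
      refine ae_restrict_of_forall_mem (measurableSet_Ioi.prod measurableSet_Ioi) ?_
      rintro ⟨p, y⟩ ⟨hp, hy⟩
      have hp' : (0 : ℝ) < p := hp
      have hy' : (0 : ℝ) < y := hy
      simp only [Function.uncurry, hf]
      rw [norm_mul, norm_mul, norm_cpow_eq_rpow_re_of_pos hp', norm_cpow_eq_rpow_re_of_pos hy',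
        norm_exp]
      have hre : (-((p : ℂ) * s) - y * (1 - η) - 2 * (1 + η) * p * y).re =
          -(s.re * p) + -(1 * y) - 2 * p * y := by
        rcases hη with rfl | rfl <;> simp <;> ring
      have hle : Real.exp (-(s.re * p) + -(1 * y) - 2 * p * y) ≤
          Real.exp (-(s.re * p)) * Real.exp (-(1 * y)) := by
        rw [← Real.exp_add]
        refine Real.exp_le_exp.2 ?_
        have : 0 < p * y := mul_pos hp' hy'
        nlinarith
      rw [hre]
      simp only [sub_re, one_re]
      calc _ ≤ p ^ (μ.re - 1) * y ^ (β.re - 1) *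
            (Real.exp (-(s.re * p)) * Real.exp (-(1 * y))) := by gcongr
        _ = _ := by ring
  rw [laplaceInt, ← integral_const_mul, setIntegral_congr_fun measurableSet_Ioi h1,
    integral_integral_swap hint, setIntegral_congr_fun measurableSet_Ioi h2, integral_const_mul]

/-! ### Asymptotics of the Laplace integrals -/

theorem half_norm_le_norm_add {η : ℂ} (hη : η = I ∨ η = -I) {s : ℂ} (hs : 0 < s.re) {t : ℝ}
    (ht : 0 ≤ t) : ‖s‖ / 2 ≤ ‖s + 2 * (1 + η) * t‖ := by
  rw [div_le_iff₀ two_pos]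
  refine le_of_sq_le_sq ?_ (by positivity)
  rw [mul_pow, Complex.sq_norm, Complex.sq_norm, normSq_apply, normSq_apply]
  rcases hη with rfl | rfl <;> simp <;>
  nlinarith [sq_nonneg (s.re + s.im + 4 * t), sq_nonneg (s.re - s.im), mul_nonneg ht hs.le,
    sq_nonneg (s.im + 2 * t), sq_nonneg (s.im - 2 * t), sq_nonneg (s.re - s.im + 4 * t),
    sq_nonneg (s.re + s.im)]

/-- The mean value inequality on the segment from `s` to `s + 2 (1 + η) y`, on which all norms are
comparable to `‖s‖` up to a factor `2 (1 + 4 y)`. -/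
theorem exists_norm_cpow_sub_le {η : ℂ} (hη : η = I ∨ η = -I) (μ : ℂ) :
    ∃ (K : ℝ) (N : ℕ), 0 ≤ K ∧ ∀ s : ℂ, 0 < s.re → 1 ≤ ‖s‖ → ∀ y : ℝ, 0 < y →
      ‖(s + 2 * (1 + η) * y) ^ (-μ) - s ^ (-μ)‖ ≤
        K * ((1 + 4 * y) ^ N * y) * ‖s‖ ^ (-μ.re - 1) := by
  obtain ⟨N, hN⟩ := exists_nat_ge |(-μ - 1).re|
  refine ⟨‖μ‖ * (2 ^ N * Real.exp (Real.pi * |(-μ - 1).im|) * 4), N, by positivity,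
    fun s hs hs1 y hy => ?_⟩
  have hη1 : ‖1 + η‖ ≤ 2 := by
    refine (norm_add_le _ _).trans ?_
    rcases hη with rfl | rfl <;> norm_num
  have hs0 : 0 < ‖s‖ := by linarith
  set g : ℝ → ℂ := fun t => (s + 2 * (1 + η) * (t * y : ℝ)) ^ (-μ) with hg
  have hd : ∀ t ∈ Icc (0 : ℝ) 1, HasDerivWithinAt g
      (-μ * (s + 2 * (1 + η) * (t * y : ℝ)) ^ (-μ - 1) * (2 * (1 + η) * y)) (Icc 0 1) t := by
    intro t ht
    have h0 : HasDerivAt (fun t : ℝ => s + 2 * (1 + η) * (t * y : ℝ)) (2 * (1 + η) * y) t := by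
      have : HasDerivAt (fun t : ℝ => ((t * y : ℝ) : ℂ)) (y : ℂ) t := by
        simpa using ((hasDerivAt_id t).mul_const y).ofReal_comp
      simpa using (this.const_mul (2 * (1 + η))).const_add s
    have hre : 0 < (s + 2 * (1 + η) * (t * y : ℝ)).re := by
      rw [re_dual hη]
      have := mul_nonneg ht.1 hy.le
      linarith
    have h1 := ((hasDerivAt_id (s + 2 * (1 + η) * (t * y : ℝ))).cpow_const (c := -μ)
      (Or.inl hre)).comp t h0
    refine HasDerivAt.hasDerivWithinAt (h1.congr_deriv ?_)
    simp
  have hb : ∀ t ∈ Ico (0 : ℝ) 1,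
      ‖-μ * (s + 2 * (1 + η) * (t * y : ℝ)) ^ (-μ - 1) * (2 * (1 + η) * y)‖ ≤
      ‖μ‖ * (2 ^ N * Real.exp (Real.pi * |(-μ - 1).im|) * 4) * ((1 + 4 * y) ^ N * y) *
        ‖s‖ ^ (-μ.re - 1) := by
    intro t ht
    have hty : 0 ≤ t * y := mul_nonneg ht.1 hy.le
    set r := ‖s + 2 * (1 + η) * (t * y : ℝ)‖ / ‖s‖ with hr
    have hM : (1 : ℝ) ≤ 2 * (1 + 4 * y) := by linarith
    have hr1 : (2 * (1 + 4 * y))⁻¹ ≤ r := by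
      rw [hr, le_div_iff₀ hs0]
      refine le_trans ?_ (half_norm_le_norm_add hη hs hty)
      rw [div_eq_inv_mul]
      gcongr
      linarith
    have hr2 : r ≤ 2 * (1 + 4 * y) := by
      rw [hr, div_le_iff₀ hs0]
      have h1 : ‖2 * (1 + η) * (t * y : ℝ)‖ ≤ 4 * y := by
        rw [norm_mul, norm_mul, Complex.norm_real, Real.norm_of_nonneg hty]
        have : t * y ≤ y := by nlinarith [ht.2]
        have h2 : ‖(2 : ℂ)‖ = 2 := by simp
        rw [h2]
        calc 2 * ‖1 + η‖ * (t * y) ≤ 2 * 2 * y := by gcongr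
          _ = 4 * y := by ring
      calc _ ≤ ‖s‖ + ‖2 * (1 + η) * (t * y : ℝ)‖ := norm_add_le _ _
        _ ≤ ‖s‖ + 4 * y := by gcongr
        _ ≤ 2 * (1 + 4 * y) * ‖s‖ := by nlinarith
    have hz : ‖s + 2 * (1 + η) * (t * y : ℝ)‖ ^ (-μ - 1).re ≤
        (2 * (1 + 4 * y)) ^ N * ‖s‖ ^ (-μ.re - 1) := by
      rw [show ‖s + 2 * (1 + η) * (t * y : ℝ)‖ = r * ‖s‖ by rw [hr]; field_simp,
        Real.mul_rpow (by positivity) hs0.le]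
      refine mul_le_mul (rpow_le_pow_of_mem_Icc hr1 hr2 hM hN) ?_ (by positivity) (by positivity)
      simp
    have hn : ‖2 * (1 + η) * (y : ℂ)‖ ≤ 4 * y := by
      rw [norm_mul, norm_mul, Complex.norm_real, Real.norm_of_nonneg hy.le]
      have h2 : ‖(2 : ℂ)‖ = 2 := by simp
      rw [h2]
      nlinarith
    rw [norm_mul, norm_mul, norm_neg]
    calc _ ≤ ‖μ‖ * ((2 * (1 + 4 * y)) ^ N * ‖s‖ ^ (-μ.re - 1) *
          Real.exp (Real.pi * |(-μ - 1).im|)) * (4 * y) := by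
          gcongr
          refine (norm_cpow_le_rpow_mul_exp _ _).trans ?_
          gcongr
      _ = _ := by rw [mul_pow]; ring
  have key := norm_image_sub_le_of_norm_deriv_le_segment_01' hd hb
  simpa [hg] using key

/-- The first term of the expansion of the Laplace integral, with an error bound that is uniform
in the whole half plane `Re s > 0`. -/
theorem exists_norm_laplaceInt_sub_le {η : ℂ} (hη : η = I ∨ η = -I) {μ β : ℂ} (hμ : 0 < μ.re)
    (hβ : 0 < β.re) :
    ∃ K : ℝ, ∀ s : ℂ, 0 < s.re → 1 ≤ ‖s‖ →
      ‖laplaceInt η μ β s - Gamma μ * s ^ (-μ)‖ ≤ K * ‖s‖ ^ (-μ.re - 1) := by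
  obtain ⟨K, N, hK0, hK⟩ := exists_norm_cpow_sub_le hη μ
  obtain ⟨C, hC0, hC⟩ := exists_one_add_pow_le_exp N (τ := 1 / 2) (by norm_num)
  have hc : 0 < (1 - η).re := by rw [one_sub_re hη]; norm_num
  have hc0 : 1 - η ≠ 0 := fun h => by simp [h] at hc
  have hA : Gamma β * (1 - η) ^ (-β) ≠ 0 :=
    mul_ne_zero (Gamma_ne_zero_of_re_pos hβ) (by simp [cpow_eq_zero_iff, hc0])
  set M := ∫ y in Ioi (0 : ℝ), y ^ (β.re + 1 - 1) * Real.exp (-(1 / 2 * y)) with hM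
  refine ⟨‖Gamma β * (1 - η) ^ (-β)‖⁻¹ * (‖Gamma μ‖ * (K * C * M)), fun s hs hs1 => ?_⟩
  have hi : IntegrableOn (fun y : ℝ => (y : ℂ) ^ (β - 1) *
      (exp (-(y * (1 - η))) * (s + 2 * (1 + η) * y) ^ (-μ))) (Ioi 0) ∧
      ‖(∫ y in Ioi (0 : ℝ), (y : ℂ) ^ (β - 1) *
        (exp (-(y * (1 - η))) * (s + 2 * (1 + η) * y) ^ (-μ))) -
        Gamma β * (1 - η) ^ (-β) * s ^ (-μ)‖ ≤ K * C * M * ‖s‖ ^ (-μ.re - 1) := by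
    have i0 := (integrableOn_cpow_mul_cexp hβ hc).mul_const (s ^ (-μ))
    have hbd : ∀ y ∈ Ioi (0 : ℝ), ‖(y : ℂ) ^ (β - 1) *
        (exp (-(y * (1 - η))) * ((s + 2 * (1 + η) * y) ^ (-μ) - s ^ (-μ)))‖ ≤
        K * C * ‖s‖ ^ (-μ.re - 1) * (y ^ (β.re + 1 - 1) * Real.exp (-(1 / 2 * y))) := by
      intro y hy
      have hy' : (0 : ℝ) < y := hy
      have e1 : ‖exp (-((y : ℂ) * (1 - η)))‖ = Real.exp (-y) := by
        rw [norm_exp]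
        congr 1
        simp [unit_re hη]
      have e2 : Real.exp (-y) * Real.exp (1 / 2 * y) = Real.exp (-(1 / 2 * y)) := by
        rw [← Real.exp_add]; ring_nf
      have e3 : y ^ (β.re + 1 - 1) = y ^ (β.re - 1) * y := by
        rw [← Real.rpow_add_one hy'.ne']; ring_nf
      rw [norm_mul, norm_mul, norm_cpow_eq_rpow_re_of_pos hy', e1, ← e2, e3]
      simp only [sub_re, one_re]
      calc _ ≤ y ^ (β.re - 1) * (Real.exp (-y) *
            (K * (C * Real.exp (1 / 2 * y) * y) * ‖s‖ ^ (-μ.re - 1))) := by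
              gcongr
              refine (hK s hs hs1 y hy').trans ?_
              gcongr
              exact hC y hy'.le
        _ = _ := by ring
    have i1 : IntegrableOn (fun y : ℝ => K * C * ‖s‖ ^ (-μ.re - 1) *
        (y ^ (β.re + 1 - 1) * Real.exp (-(1 / 2 * y)))) (Ioi 0) :=
      (integrableOn_rpow_mul_exp_neg (by linarith) (by norm_num)).const_mul _
    have hcts : ContinuousOn (fun y : ℝ => (y : ℂ) ^ (β - 1) *
        (exp (-(y * (1 - η))) * ((s + 2 * (1 + η) * y) ^ (-μ) - s ^ (-μ)))) (Ioi 0) := by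
      refine ContinuousOn.mul (fun p hp => (continuousAt_ofReal_cpow_const p _
        (Or.inr (ne_of_gt hp))).continuousWithinAt) (ContinuousOn.mul (by fun_prop) ?_)
      exact (continuousOn_dual hη μ hs).sub continuousOn_const
    have i2 : IntegrableOn (fun y : ℝ => (y : ℂ) ^ (β - 1) *
        (exp (-(y * (1 - η))) * ((s + 2 * (1 + η) * y) ^ (-μ) - s ^ (-μ)))) (Ioi 0) :=
      Integrable.mono' i1 (hcts.aestronglyMeasurable measurableSet_Ioi)
        (ae_restrict_of_forall_mem measurableSet_Ioi hbd)
    have i3 : IntegrableOn (fun y : ℝ => (y : ℂ) ^ (β - 1) *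
      (exp (-(y * (1 - η))) * (s + 2 * (1 + η) * y) ^ (-μ))) (Ioi 0) :=
      (i2.add i0).congr (Eventually.of_forall fun y => by simp only [Pi.add_apply]; ring)
    refine ⟨i3, ?_⟩
    rw [← integral_cpow_mul_cexp hβ hc, ← integral_mul_const, ← integral_sub i3 i0]
    calc _ = ‖∫ y in Ioi (0 : ℝ), (y : ℂ) ^ (β - 1) *
        (exp (-(y * (1 - η))) * ((s + 2 * (1 + η) * y) ^ (-μ) - s ^ (-μ)))‖ := by
          congr 1
          refine integral_congr_ae (Eventually.of_forall fun y => ?_)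
          simp only
          ring
      _ ≤ ∫ y in Ioi (0 : ℝ), K * C * ‖s‖ ^ (-μ.re - 1) *
        (y ^ (β.re + 1 - 1) * Real.exp (-(1 / 2 * y))) :=
          norm_integral_le_of_norm_le i1 (ae_restrict_of_forall_mem measurableSet_Ioi hbd)
      _ = _ := by rw [integral_const_mul, ← hM]; ring
  have hdual := laplaceInt_dual hη hμ hβ hs
  -- `Γ(β) (1 - η) ^ (-β)` is the integral of `y ^ (β - 1) e ^ (-y (1 - η))`, so the leading term of
  -- the dual integral is obtained by replacing the base `s + 2 (1 + η) y` by `s`.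
  have heq : laplaceInt η μ β s - Gamma μ * s ^ (-μ) = (Gamma β * (1 - η) ^ (-β))⁻¹ *
      (Gamma μ * ((∫ y in Ioi (0 : ℝ), (y : ℂ) ^ (β - 1) *
        (exp (-(y * (1 - η))) * (s + 2 * (1 + η) * y) ^ (-μ))) -
        Gamma β * (1 - η) ^ (-β) * s ^ (-μ))) := by
    rw [eq_inv_mul_iff_mul_eq₀ hA]
    linear_combination hdual
  rw [heq, norm_mul, norm_mul, norm_inv]
  calc _ ≤ ‖Gamma β * (1 - η) ^ (-β)‖⁻¹ *
        (‖Gamma μ‖ * (K * C * M * ‖s‖ ^ (-μ.re - 1))) := by gcongr; exact hi.2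
    _ = _ := by ring

/-! ### Limits of the Laplace integrals at the origin -/

/-- Dominated convergence: `‖s + d y‖ ≥ ‖d‖ y` because `Re d ≥ 0`. -/
theorem tendsto_integral_cpow_add {ν κ c d : ℂ} (hκ : 0 ≤ κ.re) (hν : 0 < (ν - κ).re)
    (hc : 0 < c.re) (hd : d ∈ slitPlane) (hd0 : 0 ≤ d.re) :
    Tendsto (fun s : ℝ => ∫ y in Ioi (0 : ℝ), (y : ℂ) ^ (ν - 1) *
        (exp (-(y * c)) * (s + d * y) ^ (-κ))) (𝓝[>] 0)
      (𝓝 (d ^ (-κ) * (Gamma (ν - κ) * c ^ (-(ν - κ))))) := by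
  have hdne : d ≠ 0 := slitPlane_ne_zero hd
  have hdn : 0 < ‖d‖ := norm_pos_iff.2 hdne
  have hslit : ∀ y : ℝ, 0 < y → d * y ∈ slitPlane := fun y hy => by
    rcases hd with h | h
    · left; simpa using mul_pos h hy
    · right; simpa using ⟨h, hy.ne'⟩
  have hre : ∀ s : ℝ, 0 < s → ∀ y : ℝ, 0 < y → 0 < ((s : ℂ) + d * y).re := fun s hs y hy => by
    simp
    have := mul_nonneg hd0 hy.le
    linarith
  have hlim : d ^ (-κ) * (Gamma (ν - κ) * c ^ (-(ν - κ))) =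
      ∫ y in Ioi (0 : ℝ), (y : ℂ) ^ (ν - 1) * (exp (-(y * c)) * (d * y) ^ (-κ)) := by
    rw [← integral_cpow_mul_cexp hν hc, ← integral_const_mul]
    refine setIntegral_congr_fun measurableSet_Ioi fun y hy => ?_
    have hy0 : (y : ℂ) ≠ 0 := ofReal_ne_zero.2 (ne_of_gt hy)
    rw [mul_ofReal_cpow hy hdne, show ν - κ - 1 = (ν - 1) + -κ by ring, cpow_add _ _ hy0]
    ring
  rw [hlim]
  refine tendsto_integral_filter_of_dominated_convergence
    (fun y => ‖d‖ ^ (-κ).re * Real.exp (Real.pi * |(-κ).im|) *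
      (y ^ ((ν - κ).re - 1) * Real.exp (-(c.re * y)))) ?_ ?_
    ((integrableOn_rpow_mul_exp_neg hν hc).const_mul _) ?_
  · filter_upwards [self_mem_nhdsWithin] with s hs
    refine ContinuousOn.aestronglyMeasurable ?_ measurableSet_Ioi
    refine ContinuousOn.mul (fun p hp => (continuousAt_ofReal_cpow_const p _
      (Or.inr (ne_of_gt hp))).continuousWithinAt) (ContinuousOn.mul (by fun_prop) ?_)
    exact ContinuousOn.cpow (by fun_prop) (by fun_prop) fun y hy => Or.inl (hre s hs y hy)
  · filter_upwards [self_mem_nhdsWithin] with s hs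
    refine ae_restrict_of_forall_mem measurableSet_Ioi fun y hy => ?_
    have hs' : (0 : ℝ) < s := hs
    have hy' : (0 : ℝ) < y := hy
    have hle : ‖d‖ * y ≤ ‖(s : ℂ) + d * y‖ := by
      refine le_of_sq_le_sq ?_ (norm_nonneg _)
      rw [mul_pow, Complex.sq_norm, Complex.sq_norm, normSq_apply, normSq_apply]
      simp
      nlinarith [mul_nonneg (mul_nonneg hs'.le hd0) hy'.le]
    have h1 : ‖((s : ℂ) + d * y) ^ (-κ)‖ ≤
        ‖d‖ ^ (-κ).re * y ^ (-κ).re * Real.exp (Real.pi * |(-κ).im|) := by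
      refine (norm_cpow_le_rpow_mul_exp _ _).trans ?_
      gcongr
      rw [← Real.mul_rpow hdn.le hy'.le]
      exact Real.rpow_le_rpow_of_nonpos (by positivity) hle (by simpa using hκ)
    have h2 : ‖exp (-((y : ℂ) * c))‖ = Real.exp (-(c.re * y)) := by
      rw [norm_exp]; congr 1; simp [mul_comm]
    rw [norm_mul, norm_mul, norm_cpow_eq_rpow_re_of_pos hy', h2,
      show (ν - κ).re - 1 = (ν - 1).re + (-κ).re by simp; ring, Real.rpow_add hy']
    calc _ ≤ y ^ (ν - 1).re * (Real.exp (-(c.re * y)) *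
          (‖d‖ ^ (-κ).re * y ^ (-κ).re * Real.exp (Real.pi * |(-κ).im|))) := by gcongr
      _ = _ := by ring
  · refine ae_restrict_of_forall_mem measurableSet_Ioi fun y hy => ?_
    refine Tendsto.const_mul _ (Tendsto.const_mul _ ?_)
    have hcont : ContinuousAt (fun s : ℝ => ((s : ℂ) + d * y) ^ (-κ)) 0 :=
      ContinuousAt.cpow (by fun_prop) (by fun_prop) (by simpa using hslit y hy)
    have := hcont.tendsto
    simp only [ofReal_zero, zero_add] at this
    exact this.mono_left nhdsWithin_le_nhds

theorem sqrt_pi_eq_Gamma : Gamma (1 / 2) = (Real.sqrt Real.pi : ℂ) := by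
  rw [Complex.Gamma_one_half_eq, Real.sqrt_eq_rpow, ofReal_cpow Real.pi_pos.le]
  norm_num

theorem two_unit_mem_slitPlane {η : ℂ} (hη : η = I ∨ η = -I) : 2 * η ∈ slitPlane := by
  right
  rcases hη with rfl | rfl <;> simp

/-- The limit at `s = 0`, read off from the dual form by dominated convergence. -/
theorem tendsto_laplaceInt_zero {η : ℂ} (hη : η = I ∨ η = -I) {α : ℂ} (hα : 0 < α.re) :
    Tendsto (fun s : ℝ => laplaceInt η α (α + 1 / 2) s) (𝓝[>] 0)
      (𝓝 (Gamma α * (Real.sqrt Real.pi * (2 * η) ^ (-α) * (Gamma (α + 1 / 2))⁻¹))) := by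
  have hβ : 0 < (α + 1 / 2).re := by simp; linarith
  have hc : 0 < (1 - η).re := by rw [one_sub_re hη]; norm_num
  have hc0 : 1 - η ≠ 0 := fun h => by simp [h] at hc
  have hd : 0 < (2 * (1 + η)).re := by simp [unit_re hη]
  have hG : Gamma (α + 1 / 2) ≠ 0 := Gamma_ne_zero_of_re_pos hβ
  have hA : Gamma (α + 1 / 2) * (1 - η) ^ (-(α + 1 / 2)) ≠ 0 :=
    mul_ne_zero hG (by simp [cpow_eq_zero_iff, hc0])
  have key := tendsto_integral_cpow_add (ν := α + 1 / 2) (κ := α) hα.le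
    (by simp) hc (Or.inl hd) hd.le
  have key2 := (key.const_mul (Gamma α)).const_mul
    (Gamma (α + 1 / 2) * (1 - η) ^ (-(α + 1 / 2)))⁻¹
  refine (key2.congr' ?_).trans (le_of_eq ?_)
  · filter_upwards [self_mem_nhdsWithin] with s hs
    rw [← laplaceInt_dual hη hα hβ (by simpa using hs), inv_mul_cancel_left₀ hA]
  · congr 1
    rw [show 2 * (1 + η) = 2 * η * (1 - η) by linear_combination 2 * unit_sq hη,
      mul_cpow_of_re (slitPlane_ne_zero (two_unit_mem_slitPlane hη)) (by simp [unit_re hη]) hc,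
      show α + 1 / 2 - α = 1 / 2 by ring, sqrt_pi_eq_Gamma,
      show -(α + 1 / 2) = -α + -(1 / 2) by ring, cpow_add _ _ hc0]
    have h1 : (1 - η) ^ (-α) ≠ 0 := by simp [cpow_eq_zero_iff, hc0]
    have h2 : (1 - η) ^ (-(1 / 2) : ℂ) ≠ 0 := by simp [cpow_eq_zero_iff, hc0]
    field_simp

theorem tendsto_sq_nhdsGT_zero : Tendsto (fun x : ℝ => x ^ 2) (𝓝[>] 0) (𝓝[>] 0) := by
  refine tendsto_nhdsWithin_iff.2 ⟨?_, ?_⟩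
  · have : ContinuousAt (fun x : ℝ => x ^ 2) 0 := by fun_prop
    have h := this.tendsto
    simp only [ne_eq, OfNat.ofNat_ne_zero, not_false_eq_true, zero_pow] at h
    exact h.mono_left nhdsWithin_le_nhds
  · filter_upwards [self_mem_nhdsWithin] with x hx
    have : (0 : ℝ) < x := hx
    exact pow_pos this 2

/-- The integral diverges at `s = 0`; under the scaling `p = y / x²` the factor `x` cancels the powers
of `x` that come out, and the remaining integrand is dominated. -/
theorem tendsto_mul_laplaceInt_zero {η : ℂ} (hη : η = I ∨ η = -I) {α : ℂ} (hα : 0 < α.re) :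
    Tendsto (fun x : ℝ => (x : ℂ) * laplaceInt η (α + 1) (α + 1 / 2) ((x : ℂ) ^ 2)) (𝓝[>] 0)
      (𝓝 (Real.sqrt Real.pi * (2 * η) ^ (-α - 1 / 2))) := by
  have key := tendsto_integral_cpow_add (ν := α + 1) (κ := α + 1 / 2) (c := 1) (d := 2 * η)
    (by simp; linarith) (by norm_num) (by simp) (two_unit_mem_slitPlane hη) (by simp [unit_re hη])
  refine ((key.comp tendsto_sq_nhdsGT_zero).congr' ?_).trans (le_of_eq ?_)
  · filter_upwards [self_mem_nhdsWithin] with x hx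
    have hx' : (0 : ℝ) < x := hx
    have hx0 : (x : ℂ) ≠ 0 := ofReal_ne_zero.2 hx'.ne'
    have hs : (0 : ℝ) < x ^ 2 := by positivity
    have hs0 : ((x ^ 2 : ℝ) : ℂ) ≠ 0 := ofReal_ne_zero.2 hs.ne'
    have e := integral_comp_mul_left_Ioi (fun y : ℝ => (y : ℂ) ^ (α + 1 - 1) *
      (exp (-(y * 1)) * (((x ^ 2 : ℝ) : ℂ) + 2 * η * y) ^ (-(α + 1 / 2)))) 0 hs
    rw [mul_zero] at e
    have e2 : ∫ y in Ioi (0 : ℝ), (((x ^ 2 * y : ℝ)) : ℂ) ^ (α + 1 - 1) *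
        (exp (-(((x ^ 2 * y : ℝ) : ℂ) * 1)) *
          (((x ^ 2 : ℝ) : ℂ) + 2 * η * ((x ^ 2 * y : ℝ) : ℂ)) ^ (-(α + 1 / 2))) =
        (x : ℂ)⁻¹ * laplaceInt η (α + 1) (α + 1 / 2) ((x : ℂ) ^ 2) := by
      rw [laplaceInt, ← integral_const_mul]
      refine setIntegral_congr_fun measurableSet_Ioi fun y hy => ?_
      have hy' : (0 : ℝ) < y := hy
      have h1 : ((x ^ 2 * y : ℝ) : ℂ) ^ (α + 1 - 1) =
          ((x ^ 2 : ℝ) : ℂ) ^ α * (y : ℂ) ^ (α + 1 - 1) := by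
        rw [show α + 1 - 1 = α by ring, ofReal_mul, mul_ofReal_cpow hy' hs0]
      have h2 : (((x ^ 2 : ℝ) : ℂ) + 2 * η * ((x ^ 2 * y : ℝ) : ℂ)) ^ (-(α + 1 / 2)) =
          ((x ^ 2 : ℝ) : ℂ) ^ (-(α + 1 / 2)) * (1 + 2 * η * y) ^ (-(α + 1 / 2)) := by
        rw [mul_comm (((x ^ 2 : ℝ) : ℂ) ^ (-(α + 1 / 2))),
          ← mul_ofReal_cpow hs (one_add_unit_mul_ne_zero hη y)]
        congr 1
        push_cast; ring
      have h3 : ((x ^ 2 : ℝ) : ℂ) ^ α * ((x ^ 2 : ℝ) : ℂ) ^ (-(α + 1 / 2)) = (x : ℂ)⁻¹ := by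
        rw [← cpow_add _ _ hs0, show α + -(α + 1 / 2) = ((-(1 / 2) : ℝ) : ℂ) by push_cast; ring,
          ← ofReal_cpow hs.le, ← Real.rpow_natCast, ← Real.rpow_mul hx'.le]
        norm_num
        rw [Real.rpow_neg_one, ofReal_inv]
      rw [h1, h2, laplaceKernel, ← h3]
      push_cast
      ring_nf
    have aux (J L : ℂ) (h : (x : ℂ)⁻¹ * L = (x ^ 2)⁻¹ • J) : J = x * L := by
      rw [real_smul] at h
      push_cast at h
      field_simp at h
      exact h.symm
    rw [e2] at e
    exact aux _ _ e
  · congr 1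
    rw [show α + 1 - (α + 1 / 2) = 1 / 2 by ring, one_cpow, sqrt_pi_eq_Gamma,
      show -(α + 1 / 2) = -α - 1 / 2 by ring]
    ring

/-! ### The solutions `E₊` and `E₋` -/

/-- The exponent `α = η a / 2 + 1 / 4`, where `η = ± i`. -/
def weberAlpha (η a : ℂ) : ℂ := η * a / 2 + 1 / 4

/-- The value at the origin of the normalised solution `weberE η a`.  Since `1 / Γ` is entire, so is
this function of `a`. -/
def weberE₀ (η a : ℂ) : ℂ :=
  Real.sqrt Real.pi * (2 * η) ^ (-weberAlpha η a) * (Gamma (weberAlpha η a + 1 / 2))⁻¹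

/-- The derivative at the origin of the normalised solution `weberE η a`. -/
def weberE₁ (η a : ℂ) : ℂ :=
  -2 * (Real.sqrt Real.pi * (2 * η) ^ (-weberAlpha η a - 1 / 2)) * (Gamma (weberAlpha η a))⁻¹

/-- The normalised solution `E₊` (for `η = i`) or `E₋` (for `η = -i`) of the Weber equation,
given by its initial values at the origin.  The two solutions are treated together: lemmas about
`weberE η` assume `η = I ∨ η = -I`. -/
def weberE (η a x : ℂ) : ℂ := weberE₀ η a * weberEven a x + weberE₁ η a * weberOdd a x

theorem isWeberSolution_weberE (η a : ℂ) : IsWeberSolution a (weberE η a) :=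
  (isWeberSolution_weberEven a).linearCombination (isWeberSolution_weberOdd a) _ _

theorem deriv_weberE (η a x : ℂ) : deriv (weberE η a) x =
    weberE₀ η a * deriv (weberEven a) x + weberE₁ η a * deriv (weberOdd a) x :=
  (isWeberSolution_weberEven a).deriv_linearCombination (isWeberSolution_weberOdd a) _ _ x

@[simp] theorem weberE_zero (η a : ℂ) : weberE η a 0 = weberE₀ η a := by simp [weberE]

@[simp] theorem deriv_weberE_zero (η a : ℂ) : deriv (weberE η a) 0 = weberE₁ η a := by
  simp [deriv_weberE]

theorem differentiable_weberE {η : ℂ} (hη : η = I ∨ η = -I) :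
    Differentiable ℂ fun q : ℂ × ℂ => weberE η q.1 q.2 := by
  have h2 : 2 * η ≠ 0 := mul_ne_zero two_ne_zero (unit_ne_zero hη)
  have hα : Differentiable ℂ fun q : ℂ × ℂ => weberAlpha η q.1 := by
    unfold weberAlpha; fun_prop
  have hΓ {f : ℂ × ℂ → ℂ} (hf : Differentiable ℂ f) : Differentiable ℂ fun q => (Gamma (f q))⁻¹ :=
    differentiable_one_div_Gamma.comp hf
  have hp {f : ℂ × ℂ → ℂ} (hf : Differentiable ℂ f) : Differentiable ℂ fun q => (2 * η) ^ f q :=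
    fun q => (hf q).const_cpow (Or.inl h2)
  have h0 : Differentiable ℂ fun q : ℂ × ℂ => weberE₀ η q.1 :=
    ((differentiable_const _).mul (hp hα.neg)).mul (hΓ (hα.add_const _))
  have h1 : Differentiable ℂ fun q : ℂ × ℂ => weberE₁ η q.1 :=
    ((differentiable_const _).mul ((differentiable_const _).mul
      (hp (hα.neg.sub_const _)))).mul (hΓ hα)
  exact (h0.mul differentiable_weberEven).add (h1.mul differentiable_weberOdd)

/-! ### Identification with the Laplace integral for `Re α > 0` -/

/-- The open convex cone `|Im x| < Re x`.  It equals `sector`; the inequality is easier to use than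
the argument. -/
def cone : Set ℂ := {x : ℂ | |x.im| < x.re}

theorem isOpen_cone : IsOpen cone := isOpen_lt (by fun_prop) (by fun_prop)

theorem convex_cone : Convex ℝ cone := by
  intro x hx y hy s t hs ht hst
  have hx' : |x.im| < x.re := hx
  have hy' : |y.im| < y.re := hy
  have h1 := abs_lt.1 hx'
  have h2 := abs_lt.1 hy'
  show |(s • x + t • y).im| < (s • x + t • y).re
  refine abs_lt.2 ?_
  simp only [add_re, add_im, real_smul, mul_re, mul_im, ofReal_re, ofReal_im, zero_mul, sub_zero,
    add_zero]
  rcases hs.eq_or_lt with rfl | hs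
  · have : t = 1 := by linarith
    subst this
    constructor <;> nlinarith
  · constructor <;> nlinarith

theorem sector_subset_cone : sector ⊆ cone := by
  rintro x ⟨hx0, hx⟩
  have hn : 0 < ‖x‖ := norm_pos_iff.2 hx0
  have h := abs_lt.1 hx
  have hpi := Real.pi_pos
  have hc : 0 < Real.cos (x.arg + Real.pi / 4) :=
    Real.cos_pos_of_mem_Ioo ⟨by linarith, by linarith⟩
  have hs : 0 < Real.cos (x.arg - Real.pi / 4) :=
    Real.cos_pos_of_mem_Ioo ⟨by linarith, by linarith⟩
  rw [Real.cos_add, Real.cos_pi_div_four, Real.sin_pi_div_four, Complex.cos_arg hx0,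
    Complex.sin_arg, ← sub_mul, ← sub_div] at hc
  rw [Real.cos_sub, Real.cos_pi_div_four, Real.sin_pi_div_four, Complex.cos_arg hx0,
    Complex.sin_arg, ← add_mul, ← add_div] at hs
  have h2 : 0 < Real.sqrt 2 / 2 := by positivity
  have hc' := (div_pos_iff_of_pos_right hn).1 ((mul_pos_iff_of_pos_right h2).1 hc)
  have hs' := (div_pos_iff_of_pos_right hn).1 ((mul_pos_iff_of_pos_right h2).1 hs)
  exact show |x.im| < x.re from abs_lt.2 ⟨by linarith, by linarith⟩

theorem re_sq_pos_of_mem_cone {x : ℂ} (hx : x ∈ cone) : 0 < (x ^ 2).re := by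
  have h := abs_lt.1 (show |x.im| < x.re from hx)
  rw [sq, mul_re]
  nlinarith

theorem ne_zero_of_mem_cone {x : ℂ} (hx : x ∈ cone) : x ≠ 0 := by
  rintro rfl
  simp [cone] at hx

theorem ofReal_mem_cone {x : ℝ} (hx : 0 < x) : (x : ℂ) ∈ cone := by simpa [cone] using hx

/-- A solution `v` in the cone, with derivative `v₁`, is determined by its limits at the vertex:
the Wronskians with `weberEven` and `weberOdd` are constant, and can be computed at the vertex. -/
theorem eq_weberEven_add_weberOdd_of_tendsto {a : ℂ} {v v₁ : ℂ → ℂ} {c₀ c₁ : ℂ}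
    (hv : ∀ x ∈ cone, HasDerivAt v (v₁ x) x)
    (hv₁ : ∀ x ∈ cone, HasDerivAt v₁ (-(x ^ 2 / 4 - a) * v x) x)
    (h₀ : Tendsto (fun x : ℝ => v x) (𝓝[>] 0) (𝓝 c₀))
    (h₁ : Tendsto (fun x : ℝ => v₁ x) (𝓝[>] 0) (𝓝 c₁)) {x : ℂ} (hx : x ∈ cone) :
    v x = c₀ * weberEven a x + c₁ * weberOdd a x ∧
      v₁ x = c₀ * deriv (weberEven a) x + c₁ * deriv (weberOdd a) x := by
  have hw {w : ℂ → ℂ} (hw : IsWeberSolution a w) :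
      v x * deriv w x - v₁ x * w x = c₀ * deriv w 0 - c₁ * w 0 := by
    have hcw : ContinuousAt (fun x : ℝ => w x) 0 :=
      (hw.1.continuous.comp continuous_ofReal).continuousAt
    have hcw' : ContinuousAt (fun x : ℝ => deriv w x) 0 :=
      (hw.1.deriv.continuous.comp continuous_ofReal).continuousAt
    have hlim : Tendsto (fun y : ℝ => v y * deriv w y - v₁ y * w y) (𝓝[>] 0)
        (𝓝 (c₀ * deriv w ((0 : ℝ) : ℂ) - c₁ * w ((0 : ℝ) : ℂ))) :=
      (h₀.mul (hcw'.tendsto.mono_left nhdsWithin_le_nhds)).sub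
        (h₁.mul (hcw.tendsto.mono_left nhdsWithin_le_nhds))
    have hconst : Tendsto (fun y : ℝ => v y * deriv w y - v₁ y * w y) (𝓝[>] 0)
        (𝓝 (v x * deriv w x - v₁ x * w x)) := by
      refine tendsto_const_nhds.congr' ?_
      filter_upwards [self_mem_nhdsWithin] with y hy
      exact wronskian_eq isOpen_cone convex_cone.isPreconnected
        (r := fun x => -(x ^ 2 / 4 - a)) hv hv₁ (fun x _ => hw.hasDerivAt x)
        (fun x _ => hw.hasDerivAt_deriv x) hx (ofReal_mem_cone hy)
    simpa using tendsto_nhds_unique hconst hlim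
  have h1 := hw (isWeberSolution_weberEven a)
  have h2 := hw (isWeberSolution_weberOdd a)
  have h3 := wronskian_weberEven_weberOdd a x
  simp only [weberEven_zero, weberOdd_zero, deriv_weberEven_zero, deriv_weberOdd_zero] at h1 h2
  constructor
  · linear_combination -v x * h3 + weberEven a x * h2 - weberOdd a x * h1
  · linear_combination -v₁ x * h3 + deriv (weberEven a) x * h2 - deriv (weberOdd a) x * h1

/-- The relation between three Laplace integrals that expresses the differential equation. -/
theorem laplaceInt_recurrence {η : ℂ} (hη : η = I ∨ η = -I) {α : ℂ} (hα : 0 < α.re) {s : ℂ}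
    (hs : 0 < s.re) :
    α * laplaceInt η α (α + 1 / 2) s + η * laplaceInt η (α + 1) (α + 1 / 2) s =
      s * (laplaceInt η (α + 1) (α + 1 / 2) s +
        2 * η * laplaceInt η (α + 1 + 1) (α + 1 / 2) s) := by
  have hα' : 0 < (α + 1).re := by simp; linarith
  have h1 := laplaceInt_integration_by_parts hη hα (α - 1 / 2) hs
  have h2 := laplaceInt_eq_add hη hα (α - 1 / 2) hs
  have h3 := laplaceInt_eq_add hη hα' (α - 1 / 2) hs
  rw [show α - 1 / 2 + 1 = α + 1 / 2 by ring] at h1 h2 h3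
  linear_combination h1 - α * h2 + s * h3

/-- For `Re α > 0` the Laplace integral with the exponential prefactor solves the Weber equation
in the cone, and its limits at the vertex are `Γ(α)` times the initial values of `weberE`. -/
theorem weberE_eq_laplaceInt {η : ℂ} (hη : η = I ∨ η = -I) {a : ℂ}
    (hα : 0 < (weberAlpha η a).re) {x : ℂ} (hx : x ∈ cone) :
    Gamma (weberAlpha η a) * weberE η a x = exp (η * x ^ 2 / 4) *
        laplaceInt η (weberAlpha η a) (weberAlpha η a + 1 / 2) (x ^ 2) ∧
      Gamma (weberAlpha η a) * deriv (weberE η a) x = exp (η * x ^ 2 / 4) *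
        (η * x / 2 * laplaceInt η (weberAlpha η a) (weberAlpha η a + 1 / 2) (x ^ 2) -
          2 * (x * laplaceInt η (weberAlpha η a + 1) (weberAlpha η a + 1 / 2) (x ^ 2))) := by
  set α := weberAlpha η a with hαdef
  set A : ℂ → ℂ := laplaceInt η α (α + 1 / 2) with hA
  set B : ℂ → ℂ := laplaceInt η (α + 1) (α + 1 / 2) with hB
  have hα' : 0 < (α + 1).re := by simp; linarith
  have hG : Gamma α ≠ 0 := Gamma_ne_zero_of_re_pos hα
  have hsq (x : ℂ) : HasDerivAt (fun x : ℂ => x ^ 2) (2 * x) x := by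
    simpa using hasDerivAt_pow 2 x
  have he (x : ℂ) : HasDerivAt (fun x : ℂ => exp (η * x ^ 2 / 4))
      (exp (η * x ^ 2 / 4) * (η * x / 2)) x := by
    refine (((hsq x).const_mul η).div_const 4).cexp.congr_deriv ?_
    ring
  have hAd {x : ℂ} (hx : x ∈ cone) : HasDerivAt (fun x => A (x ^ 2)) (-B (x ^ 2) * (2 * x)) x :=
    HasDerivAt.comp (h₂ := A) x (hasDerivAt_laplaceInt hη hα _ (re_sq_pos_of_mem_cone hx)) (hsq x)
  have hBd {x : ℂ} (hx : x ∈ cone) : HasDerivAt (fun x => B (x ^ 2))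
      (-laplaceInt η (α + 1 + 1) (α + 1 / 2) (x ^ 2) * (2 * x)) x :=
    HasDerivAt.comp (h₂ := B) x (hasDerivAt_laplaceInt hη hα' _ (re_sq_pos_of_mem_cone hx)) (hsq x)
  have hv : ∀ x ∈ cone, HasDerivAt (fun x => exp (η * x ^ 2 / 4) * A (x ^ 2))
      (exp (η * x ^ 2 / 4) * (η * x / 2 * A (x ^ 2) - 2 * (x * B (x ^ 2)))) x := fun x hx => by
    refine ((he x).mul (hAd hx)).congr_deriv ?_
    ring
  have hv₁ : ∀ x ∈ cone, HasDerivAt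
      (fun x => exp (η * x ^ 2 / 4) * (η * x / 2 * A (x ^ 2) - 2 * (x * B (x ^ 2))))
      (-(x ^ 2 / 4 - a) * (exp (η * x ^ 2 / 4) * A (x ^ 2))) x := fun x hx => by
    have h1 : HasDerivAt (fun x : ℂ => η * x / 2) (η / 2) x := by
      simpa using ((hasDerivAt_id x).const_mul η).div_const 2
    refine ((he x).mul ((h1.mul (hAd hx)).sub
      (((hasDerivAt_id x).mul (hBd hx)).const_mul 2))).congr_deriv ?_
    have hrec := laplaceInt_recurrence hη hα (re_sq_pos_of_mem_cone hx)
    rw [← hA, ← hB] at hrec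
    have hαe : α = η * a / 2 + 1 / 4 := rfl
    set C := laplaceInt η (α + 1 + 1) (α + 1 / 2) (x ^ 2) with hC
    have hrec' : (η * a / 2 + 1 / 4) * A (x ^ 2) + η * B (x ^ 2) =
        x ^ 2 * (B (x ^ 2) + 2 * η * C) := by rw [← hαe]; exact hrec
    simp only [id, Pi.mul_apply, Pi.sub_apply]
    linear_combination 2 * η * exp (η * x ^ 2 / 4) * hrec' + exp (η * x ^ 2 / 4) *
      (x ^ 2 / 4 * A (x ^ 2) - a * A (x ^ 2) - 2 * B (x ^ 2) + 4 * x ^ 2 * C) * unit_sq hη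
  have hexp : Tendsto (fun x : ℝ => exp (η * (x : ℂ) ^ 2 / 4)) (𝓝[>] 0) (𝓝 1) := by
    have : ContinuousAt (fun x : ℝ => exp (η * (x : ℂ) ^ 2 / 4)) 0 := by fun_prop
    simpa using this.tendsto.mono_left nhdsWithin_le_nhds
  have hlin : Tendsto (fun x : ℝ => η * (x : ℂ) / 2) (𝓝[>] 0) (𝓝 0) := by
    have : ContinuousAt (fun x : ℝ => η * (x : ℂ) / 2) 0 := by fun_prop
    simpa using this.tendsto.mono_left nhdsWithin_le_nhds
  have hA0 : Tendsto (fun x : ℝ => A ((x : ℂ) ^ 2)) (𝓝[>] 0) (𝓝 (Gamma α * weberE₀ η a)) := by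
    have := (tendsto_laplaceInt_zero hη hα).comp tendsto_sq_nhdsGT_zero
    refine this.congr fun x => ?_
    simp [hA]
  have hB0 := tendsto_mul_laplaceInt_zero hη hα
  have h₀ := hexp.mul hA0
  have h₁ := hexp.mul ((hlin.mul hA0).sub (hB0.const_mul 2))
  have key := eq_weberEven_add_weberOdd_of_tendsto hv hv₁ h₀ h₁ hx
  have hE₁ : Gamma α * weberE₁ η a =
      1 * (0 * (Gamma α * weberE₀ η a) -
        2 * (Real.sqrt Real.pi * (2 * η) ^ (-α - 1 / 2))) := by
    rw [weberE₁, ← hαdef]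
    field_simp
    ring
  rw [key.1, key.2, ← hE₁, weberE, deriv_weberE]
  constructor <;> ring

/-! ### The recurrence in the parameter -/

theorem weberAlpha_add {η : ℂ} (hη : η = I ∨ η = -I) (a : ℂ) :
    weberAlpha η (a + 2 * η) = weberAlpha η a - 1 := by
  unfold weberAlpha
  linear_combination unit_sq hη

theorem weberE₀_add {η : ℂ} (hη : η = I ∨ η = -I) (a : ℂ) :
    weberE₀ η (a + 2 * η) = -(a + η / 2) * weberE₀ η a := by
  have h2 : 2 * η ≠ 0 := mul_ne_zero two_ne_zero (unit_ne_zero hη)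
  have hG := one_div_Gamma_eq_self_mul_one_div_Gamma_add_one (weberAlpha η a - 1 / 2)
  rw [show weberAlpha η a - 1 / 2 + 1 = weberAlpha η a + 1 / 2 by ring] at hG
  rw [weberE₀, weberE₀, weberAlpha_add hη,
    show weberAlpha η a - 1 + 1 / 2 = weberAlpha η a - 1 / 2 by ring, hG,
    show -(weberAlpha η a - 1) = -weberAlpha η a + 1 by ring, cpow_add _ _ h2, cpow_one]
  have : 2 * η * (weberAlpha η a - 1 / 2) = -(a + η / 2) := by
    unfold weberAlpha
    linear_combination a * unit_sq hη
  rw [← this]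
  ring

theorem weberE₁_add {η : ℂ} (hη : η = I ∨ η = -I) (a : ℂ) :
    weberE₁ η (a + 2 * η) = -(a + 3 * η / 2) * weberE₁ η a := by
  have h2 : 2 * η ≠ 0 := mul_ne_zero two_ne_zero (unit_ne_zero hη)
  have hG := one_div_Gamma_eq_self_mul_one_div_Gamma_add_one (weberAlpha η a - 1)
  rw [sub_add_cancel] at hG
  rw [weberE₁, weberE₁, weberAlpha_add hη, hG,
    show -(weberAlpha η a - 1) - 1 / 2 = -weberAlpha η a - 1 / 2 + 1 by ring,
    cpow_add _ _ h2, cpow_one]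
  have : 2 * η * (weberAlpha η a - 1) = -(a + 3 * η / 2) := by
    unfold weberAlpha
    linear_combination a * unit_sq hη
  rw [← this]
  ring

/-- The ladder relation: the right hand side of the first identity solves the equation with
parameter `a + 2 η` and has the initial values of `weberE η (a + 2 η)`. -/
theorem weberE_add {η : ℂ} (hη : η = I ∨ η = -I) (a x : ℂ) :
    weberE η (a + 2 * η) x =
      (x ^ 2 / 2 - a - η / 2) * weberE η a x - η * x * deriv (weberE η a) x ∧
    deriv (weberE η (a + 2 * η)) x =
      (x + η * x * (x ^ 2 / 4 - a)) * weberE η a x +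
        (x ^ 2 / 2 - a - 3 * η / 2) * deriv (weberE η a) x := by
  have hE := isWeberSolution_weberE η a
  set u := weberE η a with hu
  have hq (x : ℂ) : HasDerivAt (fun x : ℂ => x ^ 2 / 2 - a - η / 2) x x := by
    refine ((((hasDerivAt_pow 2 x).div_const 2).sub_const a).sub_const _).congr_deriv ?_
    push_cast; ring
  have hl (x : ℂ) : HasDerivAt (fun x : ℂ => η * x) η x := by
    simpa using (hasDerivAt_id x).const_mul η
  have h1 (x : ℂ) : HasDerivAt (fun x => (x ^ 2 / 2 - a - η / 2) * u x - η * x * deriv u x)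
      ((x + η * x * (x ^ 2 / 4 - a)) * u x + (x ^ 2 / 2 - a - 3 * η / 2) * deriv u x) x := by
    refine (((hq x).mul (hE.hasDerivAt x)).sub
      ((hl x).mul (hE.hasDerivAt_deriv x))).congr_deriv ?_
    ring
  have hq3 (x : ℂ) : HasDerivAt (fun x : ℂ => x ^ 2 / 2 - a - 3 * η / 2) x x := by
    refine ((((hasDerivAt_pow 2 x).div_const 2).sub_const a).sub_const _).congr_deriv ?_
    push_cast; ring
  have hc (x : ℂ) : HasDerivAt (fun x : ℂ => x + η * x * (x ^ 2 / 4 - a))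
      (1 + η * (3 * x ^ 2 / 4 - a)) x := by
    refine ((hasDerivAt_id x).add ((hl x).mul
      (((hasDerivAt_pow 2 x).div_const 4).sub_const a))).congr_deriv ?_
    push_cast; ring
  have hsol : IsWeberSolution (a + 2 * η)
      fun x => (x ^ 2 / 2 - a - η / 2) * u x - η * x * deriv u x := by
    refine isWeberSolution_of_hasDerivAt h1 fun x => ?_
    refine (((hc x).mul (hE.hasDerivAt x)).add
      ((hq3 x).mul (hE.hasDerivAt_deriv x))).congr_deriv ?_
    linear_combination (u x + 2 * x * deriv u x) * unit_sq hη
  have heq : weberE η (a + 2 * η) = fun x => (x ^ 2 / 2 - a - η / 2) * u x - η * x * deriv u x := by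
    refine (isWeberSolution_weberE η _).ext hsol ?_ ?_
    · rw [weberE_zero, weberE₀_add hη, hu, weberE_zero]; ring
    · rw [deriv_weberE_zero, weberE₁_add hη, (h1 0).deriv, hu, deriv_weberE_zero]; ring
  rw [heq]
  exact ⟨rfl, (h1 x).deriv⟩

/-- The amplitude `e ^ (-η x² / 4) E(a, x)`.  For `Re α > 0` it is `1 / Γ(α)` times the Laplace
integral with exponent `α`. -/
def amplitude (η a x : ℂ) : ℂ := exp (-(η * x ^ 2 / 4)) * weberE η a x

/-- Minus the derivative of the amplitude with respect to `s = x²`.  For `Re α > 0` it is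
`1 / Γ(α)` times the Laplace integral with exponent `α + 1`. -/
def amplitude' (η a x : ℂ) : ℂ :=
  exp (-(η * x ^ 2 / 4)) * (η * x / 2 * weberE η a x - deriv (weberE η a) x) / (2 * x)

theorem amplitude_add {η : ℂ} (hη : η = I ∨ η = -I) (a : ℂ) {x : ℂ} (hx : x ≠ 0) :
    amplitude η (a + 2 * η) x = x ^ 2 * (amplitude η a x + 2 * η * amplitude' η a x) +
      (2 * weberAlpha η a - 1) * η * amplitude η a x := by
  rw [amplitude, amplitude, amplitude', (weberE_add hη a x).1, weberAlpha]
  field_simp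
  linear_combination (-(4 * x ^ 2 * weberE η a x) - 8 * a * weberE η a x) * unit_sq hη

theorem amplitude'_add {η : ℂ} (hη : η = I ∨ η = -I) (a : ℂ) {x : ℂ} (hx : x ≠ 0) :
    amplitude' η (a + 2 * η) x =
      (weberAlpha η a - 1) * (amplitude η a x + 2 * η * amplitude' η a x) := by
  rw [amplitude, amplitude', amplitude', (weberE_add hη a x).1, (weberE_add hη a x).2, weberAlpha]
  field_simp
  linear_combination (8 * x * weberE η a x - 8 * x ^ 2 * deriv (weberE η a) x +
    16 * a * deriv (weberE η a) x - 8 * η * x * a * weberE η a x) * unit_sq hη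

/-- Since `a ↦ a + 2 η` lowers `α` by `1`, a property that holds for `Re α > 0` and is inherited
from `α` by `α - 1` holds for all `a`. -/
theorem weberAlpha_induction {η : ℂ} (hη : η = I ∨ η = -I) {P : ℂ → Prop}
    (base : ∀ a, 0 < (weberAlpha η a).re → P a) (step : ∀ a, P a → P (a + 2 * η)) (a : ℂ) :
    P a := by
  have h (n : ℕ) : ∀ a, 0 < (weberAlpha η a + n).re → P a := by
    induction n with
    | zero => intro a ha; exact base a (by simpa using ha)
    | succ n ih =>
      intro a ha
      have h1 := step (a - 2 * η) (ih _ ?_)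
      · rwa [sub_add_cancel] at h1
      · have := weberAlpha_add hη (a - 2 * η)
        rw [sub_add_cancel] at this
        rw [this] at ha
        push_cast at ha
        convert ha using 2
        ring
  obtain ⟨n, hn⟩ := exists_nat_gt (-(weberAlpha η a).re)
  exact h n a (by simp; linarith)

theorem amplitude_eq_laplaceInt {η : ℂ} (hη : η = I ∨ η = -I) {a : ℂ}
    (hα : 0 < (weberAlpha η a).re) {x : ℂ} (hx : x ∈ cone) :
    Gamma (weberAlpha η a) * amplitude η a x =
      laplaceInt η (weberAlpha η a) (weberAlpha η a + 1 / 2) (x ^ 2) ∧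
    Gamma (weberAlpha η a) * amplitude' η a x =
      laplaceInt η (weberAlpha η a + 1) (weberAlpha η a + 1 / 2) (x ^ 2) := by
  have hx0 := ne_zero_of_mem_cone hx
  obtain ⟨h1, h2⟩ := weberE_eq_laplaceInt hη hα hx
  have he : exp (-(η * x ^ 2 / 4)) * exp (η * x ^ 2 / 4) = 1 := by
    rw [← exp_add]; simp
  constructor
  · rw [amplitude]
    linear_combination exp (-(η * x ^ 2 / 4)) * h1 +
      laplaceInt η (weberAlpha η a) (weberAlpha η a + 1 / 2) (x ^ 2) * he
  · rw [amplitude', mul_div_assoc', div_eq_iff (mul_ne_zero two_ne_zero hx0)]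
    linear_combination exp (-(η * x ^ 2 / 4)) * (η * x / 2 * h1 - h2) +
      2 * x * laplaceInt η (weberAlpha η a + 1) (weberAlpha η a + 1 / 2) (x ^ 2) * he

/-! ### Asymptotics for all parameters -/

/-- The filter `x → ∞` in the cone `|Im x| < Re x`. -/
def coneFilter : Filter ℂ := Bornology.cobounded ℂ ⊓ 𝓟 cone

theorem eventually_coneFilter : ∀ᶠ x in coneFilter, x ∈ cone ∧ 1 ≤ ‖x‖ := by
  refine ((eventually_principal.2 fun x hx => hx).filter_mono inf_le_right).and
    (Eventually.filter_mono inf_le_left ?_)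
  filter_upwards [tendsto_norm_cobounded_atTop.eventually (eventually_ge_atTop 1)] with x hx
    using hx

theorem laplaceInt_isBigO {η : ℂ} (hη : η = I ∨ η = -I) {μ β : ℂ} (hμ : 0 < μ.re)
    (hβ : 0 < β.re) :
    (fun x : ℂ => laplaceInt η μ β (x ^ 2) - Gamma μ * (x ^ 2) ^ (-μ)) =O[coneFilter]
      fun x : ℂ => (x ^ 2) ^ (-μ) / x ^ 2 := by
  obtain ⟨K, hK⟩ := exists_norm_laplaceInt_sub_le hη hμ hβ
  refine IsBigO.of_bound (K * Real.exp (Real.pi * |(-μ).im|)) ?_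
  filter_upwards [eventually_coneFilter] with x hx
  have hx0 : x ^ 2 ≠ 0 := pow_ne_zero 2 (ne_zero_of_mem_cone hx.1)
  have hn : 0 < ‖x ^ 2‖ := norm_pos_iff.2 hx0
  have h1 := hK (x ^ 2) (re_sq_pos_of_mem_cone hx.1) (by
    rw [norm_pow]; exact one_le_pow₀ hx.2)
  have hK0 : 0 ≤ K := by
    have : 0 < ‖x ^ 2‖ ^ (-μ.re - 1) := Real.rpow_pos_of_pos hn _
    exact nonneg_of_mul_nonneg_left ((norm_nonneg _).trans h1) this
  have h2 := rpow_mul_exp_le_norm_cpow hx0 (-μ)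
  have h3 : ‖x ^ 2‖ ^ (-μ.re - 1) = ‖x ^ 2‖ ^ (-μ).re / ‖x ^ 2‖ := by
    rw [Real.rpow_sub_one hn.ne', neg_re]
  refine h1.trans ?_
  rw [h3, norm_div, mul_assoc]
  refine mul_le_mul_of_nonneg_left ?_ hK0
  rw [← mul_div_assoc]
  gcongr
  rw [Real.exp_neg, ← div_eq_mul_inv, div_le_iff₀ (Real.exp_pos _)] at h2
  linarith

/-- The expansions of the amplitude and of its derivative.  The two are proved together because
the ladder relation for each of them involves both. -/
theorem amplitude_isBigO {η : ℂ} (hη : η = I ∨ η = -I) (a : ℂ) :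
    ((fun x : ℂ => amplitude η a x - (x ^ 2) ^ (-weberAlpha η a)) =O[coneFilter]
      fun x : ℂ => (x ^ 2) ^ (-weberAlpha η a) / x ^ 2) ∧
    (fun x : ℂ => amplitude' η a x - weberAlpha η a * ((x ^ 2) ^ (-weberAlpha η a) / x ^ 2))
      =O[coneFilter] fun x : ℂ => (x ^ 2) ^ (-weberAlpha η a) / x ^ 2 / x ^ 2 := by
  refine weberAlpha_induction hη (P := fun a =>
    ((fun x : ℂ => amplitude η a x - (x ^ 2) ^ (-weberAlpha η a)) =O[coneFilter]
      fun x : ℂ => (x ^ 2) ^ (-weberAlpha η a) / x ^ 2) ∧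
    (fun x : ℂ => amplitude' η a x - weberAlpha η a * ((x ^ 2) ^ (-weberAlpha η a) / x ^ 2))
      =O[coneFilter] fun x : ℂ => (x ^ 2) ^ (-weberAlpha η a) / x ^ 2 / x ^ 2) ?_ ?_ a
  · intro a hα
    set α := weberAlpha η a with hαdef
    have hβ : 0 < (α + 1 / 2).re := by simp; linarith
    have hα1 : 0 < (α + 1).re := by simp; linarith
    have hG : Gamma α ≠ 0 := Gamma_ne_zero_of_re_pos hα
    have hα0 : α ≠ 0 := fun h => by simp [h] at hα
    constructor
    · refine ((laplaceInt_isBigO hη hα hβ).const_mul_left (Gamma α)⁻¹).congr' ?_ .rfl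
      filter_upwards [eventually_coneFilter] with x hx
      rw [← (amplitude_eq_laplaceInt hη hα hx.1).1, ← mul_sub, inv_mul_cancel_left₀ hG]
    · have hp {x : ℂ} (hx : x ∈ cone) : (x ^ 2) ^ (-(α + 1)) = (x ^ 2) ^ (-α) / x ^ 2 := by
        rw [neg_add, cpow_add _ _ (pow_ne_zero 2 (ne_zero_of_mem_cone hx)), cpow_neg_one,
          div_eq_mul_inv]
      refine ((laplaceInt_isBigO hη hα1 hβ).const_mul_left (Gamma α)⁻¹).congr' ?_ ?_
      · filter_upwards [eventually_coneFilter] with x hx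
        rw [← (amplitude_eq_laplaceInt hη hα hx.1).2, Gamma_add_one _ hα0, hp hx.1, ← hαdef]
        field_simp
      · filter_upwards [eventually_coneFilter] with x hx
        rw [hp hx.1]
  · rintro a ⟨h1, h2⟩
    set α := weberAlpha η a with hαdef
    set S : ℂ → ℂ := fun x => (x ^ 2) ^ (-α) with hS
    have hx0 {x : ℂ} (hx : x ∈ cone) : x ^ 2 ≠ 0 := pow_ne_zero 2 (ne_zero_of_mem_cone hx)
    have hdiv (f : ℂ → ℂ) : (fun x => f x / x ^ 2) =O[coneFilter] f := by
      refine IsBigO.of_bound 1 ?_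
      filter_upwards [eventually_coneFilter] with x hx
      rw [norm_div, one_mul, norm_pow]
      exact div_le_self (norm_nonneg _) (one_le_pow₀ hx.2)
    have hA : (amplitude η a) =O[coneFilter] S := by
      refine ((h1.trans (hdiv S)).add (isBigO_refl S _)).congr_left fun x => ?_
      simp [hS]
    have hB : (amplitude' η a) =O[coneFilter] fun x => S x / x ^ 2 := by
      refine ((h2.trans (hdiv fun x => S x / x ^ 2)).add
        ((isBigO_refl (fun x => S x / x ^ 2) _).const_mul_left α)).congr_left fun x => ?_
      simp [hS]
    have hmul {f g : ℂ → ℂ} (h : f =O[coneFilter] fun x => g x / x ^ 2) :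
        (fun x => x ^ 2 * f x) =O[coneFilter] g := by
      refine ((isBigO_refl (fun x : ℂ => x ^ 2) _).mul h).congr' .rfl ?_
      filter_upwards [eventually_coneFilter] with x hx
      rw [mul_div_cancel₀ _ (hx0 hx.1)]
    have hS' : ∀ᶠ x in coneFilter, (x ^ 2) ^ (-(α - 1)) = S x * x ^ 2 := by
      filter_upwards [eventually_coneFilter] with x hx
      rw [neg_sub, sub_eq_neg_add, cpow_add _ _ (hx0 hx.1), cpow_one]
    rw [weberAlpha_add hη, ← hαdef]
    constructor
    · have h := ((hmul h1).add ((hmul hB).const_mul_left (2 * η))).add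
        (hA.const_mul_left ((2 * α - 1) * η))
      refine h.congr' ?_ ?_
      · filter_upwards [eventually_coneFilter, hS'] with x hx hx'
        rw [hx', amplitude_add hη a (ne_zero_of_mem_cone hx.1)]
        ring
      · filter_upwards [eventually_coneFilter, hS'] with x hx hx'
        rw [hx', mul_div_cancel_right₀ _ (hx0 hx.1)]
    · have h := (h1.add (hB.const_mul_left (2 * η))).const_mul_left (α - 1)
      refine h.congr' ?_ ?_
      · filter_upwards [eventually_coneFilter, hS'] with x hx hx'
        rw [hx', amplitude'_add hη a (ne_zero_of_mem_cone hx.1),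
          mul_div_cancel_right₀ _ (hx0 hx.1)]
        ring
      · filter_upwards [eventually_coneFilter, hS'] with x hx hx'
        rw [hx', mul_div_cancel_right₀ _ (hx0 hx.1)]

theorem weberE_isBigO {η : ℂ} (hη : η = I ∨ η = -I) (a : ℂ) :
    (fun x : ℂ => weberE η a x / (exp (η * x ^ 2 / 4) * (x ^ 2) ^ (-weberAlpha η a)) - 1)
      =O[Bornology.cobounded ℂ ⊓ 𝓟 sector] fun x : ℂ => (x ^ 2)⁻¹ := by
  have hle : Bornology.cobounded ℂ ⊓ 𝓟 sector ≤ coneFilter :=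
    inf_le_inf_left _ (principal_mono.2 sector_subset_cone)
  refine IsBigO.mono ?_ hle
  have h := (amplitude_isBigO hη a).1.mul
    (isBigO_refl (fun x : ℂ => ((x ^ 2) ^ (-weberAlpha η a))⁻¹) coneFilter)
  have hS {x : ℂ} (hx : x ∈ cone) : (x ^ 2) ^ (-weberAlpha η a) ≠ 0 := by
    simp [cpow_eq_zero_iff, ne_zero_of_mem_cone hx]
  refine h.congr' ?_ ?_
  · filter_upwards [eventually_coneFilter] with x hx
    have h1 := hS hx.1
    have he := exp_ne_zero (η * x ^ 2 / 4)
    simp only [amplitude, exp_neg]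
    field_simp
  · filter_upwards [eventually_coneFilter] with x hx
    have h1 := hS hx.1
    have hx0 := ne_zero_of_mem_cone hx.1
    field_simp

/-! ### Finite parts -/

/-- The Taylor coefficients of the sum of a power series. -/
theorem iteratedDeriv_zero_of_hasSum {ρ : ℝ} (hρ : 0 < ρ) (n : ℕ) {c : ℕ → ℂ} {f : ℂ → ℂ}
    (h : ∀ z ∈ Metric.ball (0 : ℂ) ρ, HasSum (fun n => c n * z ^ n) (f z)) :
    iteratedDeriv n f 0 = n.factorial * c n := by
  induction n generalizing c f with
  | zero =>
    have h0 := h 0 (by simpa using hρ)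
    have h1 : HasSum (fun n => c n * (0 : ℂ) ^ n) (c 0) := by
      have := hasSum_single (f := fun n => c n * (0 : ℂ) ^ n) 0 (fun n hn => by simp [hn])
      simpa using this
    simpa using h0.unique h1
  | succ n ih =>
    rw [iteratedDeriv_succ', ih (fun z hz => hasSum_deriv_powerSeries h hz), Nat.factorial_succ]
    push_cast
    ring

/-- `J` is the finite part of `∫₀^∞ p ^ (μ - 1) f p dp`, computed by splitting the integral at
`1 / 4`, for a function `f` which is the sum of its power series for `|p| < 1 / 2`.  In contrast to
`HasFinitePart`, the radius is fixed and the coefficients are explicit, which makes the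
predicate stable under linear combinations. -/
def IsFinitePart (μ : ℂ) (f : ℂ → ℂ) (J : ℂ) : Prop :=
  IntegrableOn (fun p : ℝ => (p : ℂ) ^ (μ - 1) * f p) (Ioi (1 / 4)) ∧
  ∃ c : ℕ → ℂ, (∀ p ∈ Metric.ball (0 : ℂ) (1 / 2), HasSum (fun n => c n * p ^ n) (f p)) ∧
    HasSum (fun n : ℕ => c n / (n + μ) * ((1 / 4 : ℝ) : ℂ) ^ (n + μ))
      (J - ∫ p in Ioi (1 / 4 : ℝ), (p : ℂ) ^ (μ - 1) * f p)

theorem IsFinitePart.add {μ : ℂ} {f g : ℂ → ℂ} {J K : ℂ} (hf : IsFinitePart μ f J)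
    (hg : IsFinitePart μ g K) : IsFinitePart μ (fun p => f p + g p) (J + K) := by
  obtain ⟨i1, c, hc, s1⟩ := hf
  obtain ⟨i2, d, hd, s2⟩ := hg
  have e : (fun p : ℝ => (p : ℂ) ^ (μ - 1) * (f p + g p)) =
      fun p : ℝ => (p : ℂ) ^ (μ - 1) * f p + (p : ℂ) ^ (μ - 1) * g p := by
    funext p; ring
  refine ⟨by rw [e]; exact i1.add i2, fun n => c n + d n, fun p hp => ?_, ?_⟩
  · refine ((hc p hp).add (hd p hp)).congr_fun fun n => ?_
    ring
  · rw [e, integral_add i1 i2]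
    have := (s1.add s2).congr_fun (g := fun n : ℕ =>
      (c n + d n) / (n + μ) * ((1 / 4 : ℝ) : ℂ) ^ (n + μ)) fun n => by ring
    rwa [sub_add_sub_comm] at this

theorem IsFinitePart.const_mul {μ : ℂ} {f : ℂ → ℂ} {J : ℂ} (hf : IsFinitePart μ f J) (k : ℂ) :
    IsFinitePart μ (fun p => k * f p) (k * J) := by
  obtain ⟨i1, c, hc, s1⟩ := hf
  have e : (fun p : ℝ => (p : ℂ) ^ (μ - 1) * (k * f p)) =
      fun p : ℝ => k * ((p : ℂ) ^ (μ - 1) * f p) := by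
    funext p; ring
  refine ⟨by rw [e]; exact i1.const_mul k, fun n => k * c n, fun p hp => ?_, ?_⟩
  · refine ((hc p hp).mul_left k).congr_fun fun n => ?_
    ring
  · rw [e, integral_const_mul, ← mul_sub]
    exact (s1.mul_left k).congr_fun fun n => by ring

theorem IsFinitePart.congr {μ : ℂ} {f g : ℂ → ℂ} {J : ℂ} (hf : IsFinitePart μ f J)
    (h : ∀ p ∈ Metric.ball (0 : ℂ) (1 / 2), f p = g p) (h' : ∀ p : ℝ, f p = g p) :
    IsFinitePart μ g J := by
  obtain ⟨i1, c, hc, s1⟩ := hf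
  have e : (fun p : ℝ => (p : ℂ) ^ (μ - 1) * f p) = fun p : ℝ => (p : ℂ) ^ (μ - 1) * g p := by
    funext p; rw [h']
  rw [e] at i1 s1
  exact ⟨i1, c, fun p hp => by rw [← h p hp]; exact hc p hp, s1⟩

theorem IsFinitePart.mul_id {μ : ℂ} {f : ℂ → ℂ} {J : ℂ} (hf : IsFinitePart (μ + 1) f J) :
    IsFinitePart μ (fun p => p * f p) J := by
  obtain ⟨i1, c, hc, s1⟩ := hf
  have e : EqOn (fun p : ℝ => (p : ℂ) ^ (μ + 1 - 1) * f p)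
      (fun p : ℝ => (p : ℂ) ^ (μ - 1) * (p * f p)) (Ioi (1 / 4)) := fun p hp => by
    have hp' : (0 : ℝ) < p := lt_trans (by norm_num) (show (1 / 4 : ℝ) < p from hp)
    simp only
    rw [show μ + 1 - 1 = μ by ring, ← ofReal_cpow_sub_one_mul hp']
    ring
  rw [setIntegral_congr_fun measurableSet_Ioi e] at s1
  refine ⟨i1.congr_fun e measurableSet_Ioi, fun n => if n = 0 then 0 else c (n - 1),
    fun p hp => ?_, ?_⟩
  · rw [← hasSum_nat_add_iff' 1]
    simp only [Finset.sum_range_one, if_true, zero_mul, sub_zero, Nat.add_eq_zero_iff,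
      one_ne_zero, and_false, if_false, Nat.add_sub_cancel]
    refine ((hc p hp).mul_left p).congr_fun fun n => ?_
    ring
  · rw [← hasSum_nat_add_iff' 1]
    simp only [Finset.sum_range_one, if_true, zero_div, zero_mul, sub_zero, Nat.add_eq_zero_iff,
      one_ne_zero, and_false, if_false, Nat.add_sub_cancel]
    refine s1.congr_fun fun n => ?_
    push_cast
    rw [show (n : ℂ) + 1 + μ = n + (μ + 1) by ring]

/-- Integration by parts without boundary terms: the finite part of `∫₀^∞ d(p ^ μ f p)` vanishes,
because the value of `p ^ μ f p` at `1 / 4` cancels between the series and the integral. -/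
theorem IsFinitePart.of_deriv {μ : ℂ} (hμ : ∀ n : ℕ, μ ≠ -(n : ℂ)) {f f₁ : ℂ → ℂ} {J : ℂ}
    (hf : DifferentiableOn ℂ f (Metric.ball 0 (1 / 2)))
    (hf₁ : ∀ p ∈ Metric.ball (0 : ℂ) (1 / 2), deriv f p = f₁ p)
    (hd : ∀ p : ℝ, HasDerivAt (fun p : ℝ => f p) (f₁ p) p)
    (hint : IntegrableOn (fun p : ℝ => (p : ℂ) ^ (μ - 1) * f p) (Ioi (1 / 4)))
    (hlim : Tendsto (fun p : ℝ => (p : ℂ) ^ μ * f p) atTop (𝓝 0))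
    (h : IsFinitePart (μ + 1) f₁ J) : IsFinitePart μ f (-J / μ) := by
  obtain ⟨i1, d, hd', s1⟩ := h
  have hμ0 : μ ≠ 0 := by simpa using hμ 0
  set c : ℕ → ℂ := fun n => (n.factorial : ℂ)⁻¹ * iteratedDeriv n f 0 with hc
  have hsum : ∀ p ∈ Metric.ball (0 : ℂ) (1 / 2), HasSum (fun n => c n * p ^ n) (f p) := by
    intro p hp
    have := Complex.hasSum_taylorSeries_on_ball hf hp
    refine this.congr_fun fun n => ?_
    simp [hc]
    ring
  have hdc (n : ℕ) : d n = (n + 1) * c (n + 1) := by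
    have h1 := iteratedDeriv_zero_of_hasSum (by norm_num) n hd'
    have h2 := iteratedDeriv_zero_of_hasSum (f := f₁) (by norm_num : (0 : ℝ) < 1 / 2) n
      (fun p hp => by rw [← hf₁ p hp]; exact hasSum_deriv_powerSeries hsum hp)
    exact mul_left_cancel₀ (Nat.cast_ne_zero.2 n.factorial_ne_zero) (h1.symm.trans h2)
  have hR : (0 : ℝ) < 1 / 4 := by norm_num
  have hR0 : (((1 / 4 : ℝ) : ℂ)) ≠ 0 := ofReal_ne_zero.2 hR.ne'
  have ftc := integral_Ioi_of_hasDerivAt_of_tendsto' (a := (1 / 4 : ℝ))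
    (f := fun p : ℝ => (p : ℂ) ^ μ * f p)
    (f' := fun p : ℝ => μ * ((p : ℂ) ^ (μ - 1) * f p) + (p : ℂ) ^ (μ + 1 - 1) * f₁ p)
    (fun p hp => by
      have hp' : (0 : ℝ) < p := hR.trans_le hp
      have h1 : HasDerivAt (fun p : ℝ => (p : ℂ) ^ μ) (μ * (p : ℂ) ^ (μ - 1)) p := by
        have := ((hasDerivAt_id (p : ℂ)).cpow_const (c := μ) (Or.inl hp')).comp_ofReal
        simpa using this
      refine (h1.mul (hd p)).congr_deriv ?_
      rw [show μ + 1 - 1 = μ by ring]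
      ring) ((hint.const_mul μ).add i1) hlim
  rw [integral_add (hint.const_mul μ) i1, integral_const_mul] at ftc
  refine ⟨hint, c, hsum, ?_⟩
  have hbd := (hsum ((1 / 4 : ℝ) : ℂ) (by simp; norm_num)).mul_left (((1 / 4 : ℝ) : ℂ) ^ μ)
  have hs2 : HasSum (fun n : ℕ => n * c n / (n + μ) * ((1 / 4 : ℝ) : ℂ) ^ (n + μ))
      (J - ∫ p in Ioi (1 / 4 : ℝ), (p : ℂ) ^ (μ + 1 - 1) * f₁ p) := by
    rw [← hasSum_nat_add_iff' 1]
    simp only [Finset.sum_range_one, Nat.cast_zero, zero_mul, zero_div, sub_zero]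
    refine s1.congr_fun fun n => ?_
    rw [hdc]
    push_cast
    rw [show (n : ℂ) + 1 + μ = n + (μ + 1) by ring]
  have h3 := ((hbd.sub hs2).mul_left μ⁻¹).congr_fun
    (g := fun n : ℕ => c n / (n + μ) * ((1 / 4 : ℝ) : ℂ) ^ (n + μ)) fun n => by
      have hn : (n : ℂ) + μ ≠ 0 := fun h => hμ n (by linear_combination h)
      rw [cpow_add _ _ hR0, cpow_natCast]
      field_simp
      ring
  have e : -J / μ - ∫ p in Ioi (1 / 4 : ℝ), (p : ℂ) ^ (μ - 1) * f p =
      μ⁻¹ * (((1 / 4 : ℝ) : ℂ) ^ μ * f ((1 / 4 : ℝ) : ℂ) -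
        (J - ∫ p in Ioi (1 / 4 : ℝ), (p : ℂ) ^ (μ + 1 - 1) * f₁ p)) := by
    rw [eq_inv_mul_iff_mul_eq₀ hμ0, mul_sub, mul_div_cancel₀ _ hμ0]
    linear_combination -ftc
  rw [e]
  exact h3

theorem one_add_unit_mul_mem_slitPlane_of_mem_ball {η : ℂ} (hη : η = I ∨ η = -I) {p : ℂ}
    (hp : p ∈ Metric.ball (0 : ℂ) (1 / 2)) : 1 + 2 * η * p ∈ slitPlane := by
  refine mem_slitPlane_of_norm_lt_one ?_
  have h1 : ‖η‖ = 1 := by rcases hη with rfl | rfl <;> simp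
  have h2 : ‖p‖ < 1 / 2 := by simpa using hp
  rw [norm_mul, norm_mul, h1]
  norm_num
  linarith

theorem differentiableOn_laplaceKernel {η : ℂ} (hη : η = I ∨ η = -I) (β s : ℂ) :
    DifferentiableOn ℂ (laplaceKernel η β s) (Metric.ball 0 (1 / 2)) := fun _ hp =>
  (hasDerivAt_laplaceKernel_of_mem_slitPlane β s
    (one_add_unit_mul_mem_slitPlane_of_mem_ball hη hp)).differentiableAt.differentiableWithinAt

/-- For `Re μ > 0` the finite part of a convergent integral is the integral. -/
theorem isFinitePart_laplaceInt {η : ℂ} (hη : η = I ∨ η = -I) {μ : ℂ} (hμ : 0 < μ.re) (β : ℂ)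
    {s : ℂ} (hs : 0 < s.re) :
    IsFinitePart μ (laplaceKernel η β s) (laplaceInt η μ β s) := by
  have hi := integrableOn_laplaceInt hη hμ β hs
  set f := laplaceKernel η β s with hf
  have hR : (0 : ℝ) < 1 / 4 := by norm_num
  have hsum : ∀ p ∈ Metric.ball (0 : ℂ) (1 / 2),
      HasSum (fun n : ℕ => ((n.factorial : ℂ)⁻¹ * iteratedDeriv n f 0) * p ^ n) (f p) := by
    intro p hp
    refine (Complex.hasSum_taylorSeries_on_ball (differentiableOn_laplaceKernel hη β s)
      hp).congr_fun fun n => ?_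
    simp [hf]
    ring
  set c : ℕ → ℂ := fun n => (n.factorial : ℂ)⁻¹ * iteratedDeriv n f 0 with hc
  refine ⟨hi.mono_set (Ioi_subset_Ioi hR.le), c, hsum, ?_⟩
  have hsplit : laplaceInt η μ β s - ∫ p in Ioi (1 / 4 : ℝ), (p : ℂ) ^ (μ - 1) * f p =
      ∫ p in Ioc (0 : ℝ) (1 / 4), (p : ℂ) ^ (μ - 1) * f p := by
    rw [laplaceInt, ← Ioc_union_Ioi_eq_Ioi hR.le, setIntegral_union
      (Ioc_disjoint_Ioi le_rfl) measurableSet_Ioi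
      (hi.mono_set Ioc_subset_Ioi_self) (hi.mono_set (Ioi_subset_Ioi hR.le))]
    ring
  rw [hsplit]
  have hne {p : ℝ} (hp : p ∈ Ioc (0 : ℝ) (1 / 4)) (n : ℕ) :
      (p : ℂ) ^ (μ - 1) * (c n * (p : ℂ) ^ n) = c n * (p : ℂ) ^ (n + μ - 1) := by
    rw [show (n : ℂ) + μ - 1 = μ - 1 + n by ring,
      cpow_add _ _ (ofReal_ne_zero.2 hp.1.ne'), cpow_natCast]
    ring
  have hre (n : ℕ) : -1 < ((n : ℂ) + μ - 1).re := by
    have : (0 : ℝ) ≤ n := n.cast_nonneg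
    simp; linarith
  have hint (n : ℕ) : IntegrableOn (fun p : ℝ => (p : ℂ) ^ (μ - 1) * (c n * (p : ℂ) ^ n))
      (Ioc 0 (1 / 4)) := by
    have h1 := (intervalIntegral.intervalIntegrable_cpow' (a := 0) (b := 1 / 4) (hre n)).const_mul
      (c n)
    rw [intervalIntegrable_iff_integrableOn_Ioc_of_le hR.le] at h1
    exact h1.congr_fun (fun p hp => (hne hp n).symm) measurableSet_Ioc
  have hnorm (n : ℕ) : ∫ p in Ioc (0 : ℝ) (1 / 4), ‖(p : ℂ) ^ (μ - 1) * (c n * (p : ℂ) ^ n)‖ ≤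
      ‖c n‖ * (1 / 4) ^ n * ∫ p in Ioc (0 : ℝ) (1 / 4), ‖(p : ℂ) ^ (μ - 1)‖ := by
    have h0 : IntegrableOn (fun p : ℝ => (p : ℂ) ^ (μ - 1)) (Ioc 0 (1 / 4)) := by
      have h1 := intervalIntegral.intervalIntegrable_cpow' (a := 0) (b := 1 / 4) (r := μ - 1)
        (by simpa using hμ)
      rwa [intervalIntegrable_iff_integrableOn_Ioc_of_le hR.le] at h1
    rw [← integral_const_mul]
    refine setIntegral_mono_on (hint n).norm (h0.norm.const_mul _) measurableSet_Ioc
      fun p hp => ?_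
    rw [norm_mul, norm_mul, norm_pow, Complex.norm_real, Real.norm_of_nonneg hp.1.le, mul_comm]
    have hpow := pow_le_pow_left₀ hp.1.le hp.2 n
    gcongr
  have hsummable : Summable fun n : ℕ =>
      ∫ p in Ioc (0 : ℝ) (1 / 4), ‖(p : ℂ) ^ (μ - 1) * (c n * (p : ℂ) ^ n)‖ := by
    have h1 := (hsum ((1 / 4 : ℝ) : ℂ) (by simp; norm_num)).summable.norm
    refine Summable.of_nonneg_of_le (fun n => by positivity) hnorm (Summable.mul_right _ ?_)
    refine h1.congr fun n => ?_
    rw [norm_mul, norm_pow, Complex.norm_real, Real.norm_of_nonneg hR.le]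
  have key := hasSum_integral_of_summable_integral_norm hint hsummable
  have e1 : ∫ p in Ioc (0 : ℝ) (1 / 4), ∑' n : ℕ, (p : ℂ) ^ (μ - 1) * (c n * (p : ℂ) ^ n) =
      ∫ p in Ioc (0 : ℝ) (1 / 4), (p : ℂ) ^ (μ - 1) * f p := by
    refine setIntegral_congr_fun measurableSet_Ioc fun p hp => ?_
    have hpb : (p : ℂ) ∈ Metric.ball (0 : ℂ) (1 / 2) := by
      simp [abs_of_pos hp.1]
      linarith [hp.2]
    exact ((hsum p hpb).mul_left ((p : ℂ) ^ (μ - 1))).tsum_eq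
  rw [e1] at key
  refine key.congr_fun fun n => ?_
  have hn : (n : ℂ) + μ ≠ 0 := fun h => by
    have := hre n
    rw [h] at this
    simp at this
  rw [setIntegral_congr_fun measurableSet_Ioc fun p hp => hne hp n, integral_const_mul,
    ← intervalIntegral.integral_of_le hR.le, integral_cpow (Or.inl (hre n)), ofReal_zero,
    sub_add_cancel, zero_cpow hn]
  ring

theorem integrableOn_cpow_sub_one {η : ℂ} (hη : η = I ∨ η = -I) {μ β s : ℂ}
    (h : IntegrableOn (fun p : ℝ => (p : ℂ) ^ μ * laplaceKernel η β s p) (Ioi (1 / 4))) :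
    IntegrableOn (fun p : ℝ => (p : ℂ) ^ (μ - 1) * laplaceKernel η β s p) (Ioi (1 / 4)) := by
  have hpos {p : ℝ} (hp : p ∈ Ioi (1 / 4 : ℝ)) : 0 < p :=
    lt_trans (by norm_num) (show (1 / 4 : ℝ) < p from hp)
  have hc : ContinuousOn (fun p : ℝ => (p : ℂ) ^ (μ - 1) * laplaceKernel η β s p)
      (Ioi (1 / 4)) := by
    refine ContinuousOn.mul (fun p hp => ?_) (continuous_laplaceKernel hη β s).continuousOn
    exact (continuousAt_ofReal_cpow_const p (μ - 1)
      (Or.inr (hpos hp).ne')).continuousWithinAt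
  refine Integrable.mono' (h.norm.const_mul 4) (hc.aestronglyMeasurable measurableSet_Ioi)
    (ae_restrict_of_forall_mem measurableSet_Ioi fun p hp => ?_)
  have hp4 : (1 / 4 : ℝ) < p := hp
  rw [← ofReal_cpow_sub_one_mul (hpos hp) μ, norm_mul, norm_mul, norm_mul, Complex.norm_real,
    Real.norm_of_nonneg (hpos hp).le]
  have := mul_nonneg (norm_nonneg ((p : ℂ) ^ (μ - 1))) (norm_nonneg (laplaceKernel η β s p))
  nlinarith

/-- The finite parts satisfy the same ladder relation as the amplitude, by linearity and
integration by parts; so the Laplace representation is inherited from `α` by `α - 1` as long as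
`α - 1` is not a pole of `Γ`. -/
theorem isFinitePart_amplitude {η : ℂ} (hη : η = I ∨ η = -I) {x : ℂ} (hx : x ∈ cone) (a : ℂ)
    (hα : ∀ n : ℕ, weberAlpha η a ≠ -(n : ℂ)) :
    IsFinitePart (weberAlpha η a) (laplaceKernel η (weberAlpha η a + 1 / 2) (x ^ 2))
      (Gamma (weberAlpha η a) * amplitude η a x) ∧
    IsFinitePart (weberAlpha η a + 1) (laplaceKernel η (weberAlpha η a + 1 / 2) (x ^ 2))
      (Gamma (weberAlpha η a) * amplitude' η a x) := by
  have hs := re_sq_pos_of_mem_cone hx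
  refine weberAlpha_induction hη (P := fun a => (∀ n : ℕ, weberAlpha η a ≠ -(n : ℂ)) →
    IsFinitePart (weberAlpha η a) (laplaceKernel η (weberAlpha η a + 1 / 2) (x ^ 2))
      (Gamma (weberAlpha η a) * amplitude η a x) ∧
    IsFinitePart (weberAlpha η a + 1) (laplaceKernel η (weberAlpha η a + 1 / 2) (x ^ 2))
      (Gamma (weberAlpha η a) * amplitude' η a x)) ?_ ?_ a hα
  · intro a ha _
    have hα1 : 0 < (weberAlpha η a + 1).re := by simp; linarith
    rw [(amplitude_eq_laplaceInt hη ha hx).1, (amplitude_eq_laplaceInt hη ha hx).2]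
    exact ⟨isFinitePart_laplaceInt hη ha _ hs, isFinitePart_laplaceInt hη hα1 _ hs⟩
  · intro a ih hα
    have hx0 := ne_zero_of_mem_cone hx
    rw [weberAlpha_add hη] at hα ⊢
    obtain ⟨hA, hB⟩ := ih fun n h => hα (n + 1) (by rw [h]; push_cast; ring)
    rw [amplitude_add hη a hx0, amplitude'_add hη a hx0]
    set α := weberAlpha η a with hαdef
    have hα1 : α - 1 ≠ 0 := by simpa using hα 0
    have hG : Gamma α = (α - 1) * Gamma (α - 1) := by
      have := Gamma_add_one (α - 1) hα1
      rwa [sub_add_cancel] at this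
    have hker : ∀ p : ℂ, 1 + 2 * η * p ≠ 0 → laplaceKernel η (α - 1 / 2) (x ^ 2) p =
        laplaceKernel η (α + 1 / 2) (x ^ 2) p +
          2 * η * (p * laplaceKernel η (α + 1 / 2) (x ^ 2) p) := by
      intro p hp
      rw [laplaceKernel, laplaceKernel, show -(α - 1 / 2) = -(α + 1 / 2) + 1 by ring,
        cpow_add _ _ hp, cpow_one]
      ring
    have hF : IsFinitePart α (laplaceKernel η (α - 1 / 2) (x ^ 2))
        (Gamma α * amplitude η a x + 2 * η * (Gamma α * amplitude' η a x)) := by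
      refine (hA.add (hB.mul_id.const_mul (2 * η))).congr (fun p hp => (hker p ?_).symm)
        fun p => (hker p (one_add_unit_mul_ne_zero hη p)).symm
      exact slitPlane_ne_zero (one_add_unit_mul_mem_slitPlane_of_mem_ball hη hp)
    have hF₁ := (hF.const_mul (-x ^ 2)).add (hA.const_mul (-(2 * η * (α - 1 / 2))))
    have hderiv {p : ℂ} (hp : 1 + 2 * η * p ∈ slitPlane) :
        HasDerivAt (laplaceKernel η (α - 1 / 2) (x ^ 2))
          (-x ^ 2 * laplaceKernel η (α - 1 / 2) (x ^ 2) p +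
            -(2 * η * (α - 1 / 2)) * laplaceKernel η (α + 1 / 2) (x ^ 2) p) p := by
      have := hasDerivAt_laplaceKernel_of_mem_slitPlane (α - 1 / 2) (x ^ 2) hp
      rwa [show α - 1 / 2 + 1 = α + 1 / 2 by ring] at this
    -- Integrating `d(p ^ (α - 1) f)` for the kernel `f` with exponent `-(α - 1 / 2)` lowers `α`.
    have hres := IsFinitePart.of_deriv hα (differentiableOn_laplaceKernel hη (α - 1 / 2) (x ^ 2))
      (fun p hp => (hderiv (one_add_unit_mul_mem_slitPlane_of_mem_ball hη hp)).deriv)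
      (fun p => (hderiv (one_add_unit_mul_mem_slitPlane hη p)).comp_ofReal)
      (integrableOn_cpow_sub_one hη hF.1)
      (tendsto_cpow_mul_laplaceKernel hη (α - 1) (α - 1 / 2) hs)
      (by rw [sub_add_cancel]; exact hF₁)
    rw [show α - 1 + 1 / 2 = α - 1 / 2 by ring, sub_add_cancel]
    constructor
    · convert hres using 1
      rw [hG]
      field_simp
      ring
    · convert hF using 1
      rw [hG]
      ring

theorem IsFinitePart.hasFinitePart {η : ℂ} (hη : η = I ∨ η = -I) {μ β s J : ℂ}
    (hμ : ∀ n : ℕ, μ ≠ -(n : ℂ)) (h : IsFinitePart μ (laplaceKernel η β s) J) :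
    HasFinitePart μ (laplaceKernel η β s) J := by
  obtain ⟨i1, c, hc, hs⟩ := h
  refine ⟨hμ, 1 / 4, by norm_num, ?_, i1, ?_⟩
  · refine DifferentiableOn.diffContOnCl ((differentiableOn_laplaceKernel hη β s).mono ?_)
    refine (Metric.closure_ball_subset_closedBall).trans (Metric.closedBall_subset_ball ?_)
    norm_num
  · refine hs.congr_fun fun n => ?_
    rw [iteratedDeriv_zero_of_hasSum (by norm_num) n hc,
      mul_div_cancel_left₀ _ (Nat.cast_ne_zero.2 n.factorial_ne_zero)]

theorem isRegularizedIntegral_laplaceKernel {η : ℂ} (hη : η = I ∨ η = -I) {x : ℂ} (hx : x ∈ cone)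
    {a : ℂ} (hα : ∀ n : ℕ, weberAlpha η a ≠ -(n : ℂ)) :
    IsRegularizedIntegral (weberAlpha η a) (laplaceKernel η (weberAlpha η a + 1 / 2) (x ^ 2))
      (Gamma (weberAlpha η a) * amplitude η a x) :=
  ⟨(isFinitePart_amplitude hη hx a hα).1.hasFinitePart hη hα, fun h =>
    ⟨integrableOn_laplaceInt hη h _ (re_sq_pos_of_mem_cone hx),
      (amplitude_eq_laplaceInt hη h hx).1.symm⟩⟩

theorem weberE_eq_amplitude {η a : ℂ} (hα : ∀ n : ℕ, weberAlpha η a ≠ -(n : ℂ)) (x : ℂ) :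
    weberE η a x = 1 / Gamma (weberAlpha η a) * exp (η * x ^ 2 / 4) *
      (Gamma (weberAlpha η a) * amplitude η a x) := by
  have hG := Gamma_ne_zero hα
  have he : exp (-(η * x ^ 2 / 4)) * exp (η * x ^ 2 / 4) = 1 := by
    rw [← exp_add]; simp
  rw [amplitude]
  field_simp
  linear_combination -weberE η a x * he

/-! ### Connection formulas -/

theorem unit_neg {η : ℂ} (hη : η = I ∨ η = -I) : -η = I ∨ -η = -I := by
  rcases hη with rfl | rfl <;> simp

theorem two_unit_cpow {η : ℂ} (hη : η = I ∨ η = -I) (w : ℂ) :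
    (2 * η) ^ w = 2 ^ w * exp (η * Real.pi / 2 * w) := by
  have h := mul_ofReal_cpow (y := 2) two_pos (unit_ne_zero hη) w
  rw [ofReal_ofNat] at h
  rw [mul_comm, h, mul_comm, cpow_def_of_ne_zero (unit_ne_zero hη)]
  rcases hη with rfl | rfl
  · rw [log_I]; ring_nf
  · rw [log_neg_I]; ring_nf

theorem sin_eq_exp_unit {η : ℂ} (hη : η = I ∨ η = -I) (z : ℂ) :
    sin z = (exp (-(η * z)) - exp (η * z)) * η / 2 := by
  rcases hη with rfl | rfl
  · rw [Complex.sin]; ring_nf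
  · rw [Complex.sin]; ring_nf

theorem exp_unit_mul_pi_div_two {η : ℂ} (hη : η = I ∨ η = -I) : exp (η * Real.pi / 2) = η := by
  rcases hη with rfl | rfl
  · rw [show I * (Real.pi : ℂ) / 2 = Real.pi / 2 * I by ring, exp_pi_div_two_mul_I]
  · rw [show -I * (Real.pi : ℂ) / 2 = -Real.pi / 2 * I by ring, exp_neg_pi_div_two_mul_I]

theorem exp_unit_mul_pi_div_four_sq {η : ℂ} (hη : η = I ∨ η = -I) :
    exp (η * Real.pi / 4) ^ 2 = η := by
  rw [← exp_nat_mul, show ((2 : ℕ) : ℂ) * (η * Real.pi / 4) = η * Real.pi / 2 by push_cast; ring,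
    exp_unit_mul_pi_div_two hη]

theorem unit_inv {η : ℂ} (hη : η = I ∨ η = -I) : η⁻¹ = -η := by
  rcases hη with rfl | rfl <;> simp

theorem inv_Gamma_mul_inv_Gamma_one_sub (z : ℂ) :
    (Gamma z)⁻¹ * (Gamma (1 - z))⁻¹ = sin (Real.pi * z) / Real.pi := by
  rw [← mul_inv, Gamma_mul_Gamma_one_sub, inv_div]

/-- Legendre's duplication formula for the entire function `1 / Γ`. -/
theorem inv_Gamma_two_mul (z : ℂ) :
    (Gamma (2 * z))⁻¹ = (2 : ℂ) ^ (1 - 2 * z) * Real.sqrt Real.pi *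
      ((Gamma z)⁻¹ * (Gamma (z + 1 / 2))⁻¹) := by
  have h2 : (2 : ℂ) ^ (1 - 2 * z) ≠ 0 := by simp [cpow_eq_zero_iff]
  have hpi : (Real.sqrt Real.pi : ℂ) ≠ 0 := by
    exact_mod_cast (Real.sqrt_pos.2 Real.pi_pos).ne'
  rw [← mul_inv, Gamma_mul_Gamma_add_half, mul_inv, mul_inv]
  field_simp

theorem sqrt_pi_sq : (Real.sqrt Real.pi : ℂ) ^ 2 = Real.pi := by
  rw [← ofReal_pow, Real.sq_sqrt Real.pi_pos.le]

theorem sqrt_two_sq : (Real.sqrt 2 : ℂ) ^ 2 = 2 := by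
  rw [← ofReal_pow, Real.sq_sqrt two_pos.le]; norm_num

theorem two_cpow_half : (2 : ℂ) ^ (1 / 2 : ℂ) = Real.sqrt 2 := by
  rw [Real.sqrt_eq_rpow, ofReal_cpow two_pos.le]; norm_num

/-- The exponentials occurring in the connection formulas, expressed through
`t = e ^ (η π γ / 2)` and `r = e ^ (η π / 4)`, where `γ = weberAlpha (-η) a`. -/
theorem exp_pi_mul_eq {η : ℂ} (hη : η = I ∨ η = -I) (a : ℂ) :
    exp (Real.pi * a / 2) =
      (exp (η * Real.pi / 4))⁻¹ * exp (η * Real.pi / 2 * weberAlpha (-η) a) ^ 2 ∧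
    exp (Real.pi * a) = -η * exp (η * Real.pi / 2 * weberAlpha (-η) a) ^ 4 := by
  have h1 : exp (Real.pi * a / 2) =
      (exp (η * Real.pi / 4))⁻¹ * exp (η * Real.pi / 2 * weberAlpha (-η) a) ^ 2 := by
    rw [← exp_neg, ← exp_nat_mul, ← exp_add]
    congr 1
    unfold weberAlpha
    push_cast
    linear_combination (Real.pi * a / 2) * unit_sq hη
  refine ⟨h1, ?_⟩
  have h2 : exp (Real.pi * a) = exp (Real.pi * a / 2) ^ 2 := by
    rw [← exp_nat_mul]; push_cast; ring_nf
  rw [h2, h1, mul_pow, inv_pow, exp_unit_mul_pi_div_four_sq hη, ← pow_mul, unit_inv hη]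

/-- The powers in the initial values of `weberE (-η)` and `weberE η`, expressed through
`2 ^ (-γ)`, `t = e ^ (η π γ / 2)` and `r = e ^ (η π / 4)`, where `γ = weberAlpha (-η) a`. -/
theorem two_unit_cpow_weberAlpha {η : ℂ} (hη : η = I ∨ η = -I) (a : ℂ) :
    (2 * -η) ^ (-weberAlpha (-η) a) =
      2 ^ (-weberAlpha (-η) a) * exp (η * Real.pi / 2 * weberAlpha (-η) a) ∧
    (2 * -η) ^ (-weberAlpha (-η) a - 1 / 2) =
      2 ^ (-weberAlpha (-η) a) * (Real.sqrt 2 : ℂ)⁻¹ *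
        (exp (η * Real.pi / 2 * weberAlpha (-η) a) * exp (η * Real.pi / 4)) ∧
    (2 * η) ^ (-weberAlpha η a) =
      (2 ^ (-weberAlpha (-η) a))⁻¹ * (Real.sqrt 2 : ℂ)⁻¹ *
        (exp (η * Real.pi / 2 * weberAlpha (-η) a) * (exp (η * Real.pi / 4))⁻¹) ∧
    (2 * η) ^ (-weberAlpha η a - 1 / 2) =
      (2 ^ (-weberAlpha (-η) a))⁻¹ * 2⁻¹ *
        (exp (η * Real.pi / 2 * weberAlpha (-η) a) * (exp (η * Real.pi / 4) ^ 2)⁻¹) := by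
  have hα : weberAlpha η a = 1 / 2 - weberAlpha (-η) a := by unfold weberAlpha; ring
  set γ := weberAlpha (-η) a
  have h2 : (2 : ℂ) ≠ 0 := two_ne_zero
  refine ⟨?_, ?_, ?_, ?_⟩
  · rw [two_unit_cpow (unit_neg hη)]
    ring_nf
  · rw [two_unit_cpow (unit_neg hη), sub_eq_add_neg (-γ), cpow_add _ _ h2, cpow_neg _ (1 / 2),
      two_cpow_half, ← exp_add]
    ring_nf
  · rw [two_unit_cpow hη, hα, show -(1 / 2 - γ) = -(-γ) + -(1 / 2) by ring, cpow_add _ _ h2,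
      cpow_neg _ (1 / 2), two_cpow_half, cpow_neg _ (-γ), ← exp_neg (η * Real.pi / 4), ← exp_add]
    ring_nf
  · rw [two_unit_cpow hη, hα, show -(1 / 2 - γ) - 1 / 2 = -(-γ) + -1 by ring, cpow_add _ _ h2,
      cpow_neg_one, cpow_neg _ (-γ), ← exp_nat_mul, ← exp_neg (_ * (η * Real.pi / 4)), ← exp_add]
    push_cast
    ring_nf

theorem sin_pi_mul_weberAlpha {η : ℂ} (hη : η = I ∨ η = -I) (a : ℂ) :
    sin (Real.pi * weberAlpha (-η) a) =
      ((exp (η * Real.pi / 2 * weberAlpha (-η) a) ^ 2)⁻¹ -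
        exp (η * Real.pi / 2 * weberAlpha (-η) a) ^ 2) * η / 2 ∧
    sin (Real.pi * weberAlpha η a) =
      ((exp (η * Real.pi / 2 * weberAlpha (-η) a) ^ 2)⁻¹ +
        exp (η * Real.pi / 2 * weberAlpha (-η) a) ^ 2) / 2 := by
  have hα : weberAlpha η a = 1 / 2 - weberAlpha (-η) a := by unfold weberAlpha; ring
  set γ := weberAlpha (-η) a
  have h1 : exp (η * Real.pi / 2 * γ) ^ 2 = exp (η * (Real.pi * γ)) := by
    rw [← exp_nat_mul]; push_cast; ring_nf
  rw [h1, ← exp_neg]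
  refine ⟨sin_eq_exp_unit hη _, ?_⟩
  rw [hα, sin_eq_exp_unit hη,
    show η * (Real.pi * (1 / 2 - γ)) = η * Real.pi / 2 + -(η * (Real.pi * γ)) by ring,
    neg_add, neg_neg, exp_add, exp_add, exp_neg (η * Real.pi / 2), exp_unit_mul_pi_div_two hη,
    unit_inv hη]
  linear_combination (-(exp (η * (Real.pi * γ)) + exp (-(η * (Real.pi * γ)))) / 2) * unit_sq hη

/-- The reflection formula, since `weberAlpha (-η) a + weberAlpha η a = 1 / 2`. -/
theorem inv_Gamma_weberAlpha {η : ℂ} (a : ℂ) :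
    (Gamma (weberAlpha (-η) a))⁻¹ * (Gamma (weberAlpha η a + 1 / 2))⁻¹ =
      sin (Real.pi * weberAlpha (-η) a) / Real.pi ∧
    (Gamma (weberAlpha η a))⁻¹ * (Gamma (weberAlpha (-η) a + 1 / 2))⁻¹ =
      sin (Real.pi * weberAlpha η a) / Real.pi := by
  constructor
  · rw [← inv_Gamma_mul_inv_Gamma_one_sub]
    congr 3
    unfold weberAlpha; ring
  · rw [← inv_Gamma_mul_inv_Gamma_one_sub]
    congr 3
    unfold weberAlpha; ring

/-- Both sides solve the Weber equation, so only the initial values at the origin are compared. -/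
theorem weberE_connection {η : ℂ} (hη : η = I ∨ η = -I) (a x : ℂ) :
    weberE (-η) a (-x) = η * exp (Real.pi * a) * weberE (-η) a x +
      Real.sqrt (2 * Real.pi) / Gamma (1 / 2 - η * a) * exp (Real.pi * a / 2) * weberE η a x := by
  have hS := (isWeberSolution_weberE (-η) a).linearCombination (isWeberSolution_weberE η a)
    (η * exp (Real.pi * a))
    (Real.sqrt (2 * Real.pi) / Gamma (1 / 2 - η * a) * exp (Real.pi * a / 2))
  have hN := (isWeberSolution_weberE (-η) a).comp_neg
  refine congrFun (hN.ext hS ?_ ?_) x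
  all_goals
    have hΓ : (Gamma (1 / 2 - η * a))⁻¹ =
        (2 : ℂ) ^ (1 - 2 * weberAlpha (-η) a) * Real.sqrt Real.pi *
          ((Gamma (weberAlpha (-η) a))⁻¹ * (Gamma (weberAlpha (-η) a + 1 / 2))⁻¹) := by
      rw [show 1 / 2 - η * a = 2 * weberAlpha (-η) a by unfold weberAlpha; ring]
      exact inv_Gamma_two_mul _
    obtain ⟨e1, e2⟩ := exp_pi_mul_eq hη a
    obtain ⟨p1, p2, p3, p4⟩ := two_unit_cpow_weberAlpha hη a
    obtain ⟨s1, s2⟩ := sin_pi_mul_weberAlpha hη a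
    obtain ⟨g1, g2⟩ := inv_Gamma_weberAlpha (η := η) a
    have hq : (2 : ℂ) ^ (1 - 2 * weberAlpha (-η) a) = 2 * (2 ^ (-weberAlpha (-η) a)) ^ 2 := by
      rw [show 1 - 2 * weberAlpha (-η) a = 1 + (-weberAlpha (-η) a + -weberAlpha (-η) a) by ring,
        cpow_add _ _ two_ne_zero, cpow_add _ _ two_ne_zero, cpow_one]
      ring
    have hsq : (Real.sqrt (2 * Real.pi) : ℂ) = Real.sqrt 2 * Real.sqrt Real.pi := by
      rw [Real.sqrt_mul two_pos.le, ofReal_mul]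
    have hq0 : (2 : ℂ) ^ (-weberAlpha (-η) a) ≠ 0 := by simp [cpow_eq_zero_iff]
    have hw0 : (Real.sqrt 2 : ℂ) ≠ 0 := by
      exact_mod_cast (Real.sqrt_pos.2 two_pos).ne'
    have hpi : (Real.pi : ℂ) ≠ 0 := ofReal_ne_zero.2 Real.pi_pos.ne'
    have hr := exp_unit_mul_pi_div_four_sq hη
    have hr0 := exp_ne_zero (η * Real.pi / 4)
    have ht0 := exp_ne_zero (η * Real.pi / 2 * weberAlpha (-η) a)
    have hη0 := unit_ne_zero hη
    have hη2 := unit_sq hη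
    have hpi2 := sqrt_pi_sq
    have hw2 := sqrt_two_sq
  -- In terms of `t`, `r`, `q = 2 ^ (-γ)` and the reciprocal Gamma values the identity is algebraic.
  · simp only [neg_zero, weberE_zero, weberE₀]
    rw [div_eq_mul_inv _ (Gamma (1 / 2 - η * a)), hΓ, hsq, e1, e2, p1, p3, hq]
    rw [s1] at g1
    generalize exp (η * Real.pi / 2 * weberAlpha (-η) a) = t at *
    generalize exp (η * Real.pi / 4) = r at *
    generalize (2 : ℂ) ^ (-weberAlpha (-η) a) = q at *
    generalize (Real.sqrt Real.pi : ℂ) = P at *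
    generalize (Real.sqrt 2 : ℂ) = w at *
    generalize (Gamma (weberAlpha (-η) a))⁻¹ = G1 at *
    generalize (Gamma (weberAlpha η a + 1 / 2))⁻¹ = G2 at *
    generalize (Gamma (weberAlpha (-η) a + 1 / 2))⁻¹ = G3 at *
    have key : w * P * (2 * q ^ 2 * P * (G1 * G3)) * (r⁻¹ * t ^ 2) *
        (P * (q⁻¹ * w⁻¹ * (t * r⁻¹)) * G2) =
        2 * P ^ 2 * P * q * t ^ 3 * (r ^ 2)⁻¹ * (G1 * G2) * G3 := by
      field_simp
    rw [key, g1, hr, hpi2]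
    field_simp
    linear_combination (P * G3 * t ^ 4) * hη2
  · rw [((isWeberSolution_weberE (-η) a).hasDerivAt_comp_neg 0).deriv,
      (isWeberSolution_weberE (-η) a).deriv_linearCombination (isWeberSolution_weberE η a)]
    simp only [neg_zero, deriv_weberE_zero, weberE₁]
    rw [div_eq_mul_inv _ (Gamma (1 / 2 - η * a)), hΓ, hsq, e1, e2, p2, p4, hq]
    rw [s2] at g2
    generalize exp (η * Real.pi / 2 * weberAlpha (-η) a) = t at *
    generalize exp (η * Real.pi / 4) = r at *
    generalize (2 : ℂ) ^ (-weberAlpha (-η) a) = q at *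
    generalize (Real.sqrt Real.pi : ℂ) = P at *
    generalize (Real.sqrt 2 : ℂ) = w at *
    generalize (Gamma (weberAlpha (-η) a))⁻¹ = G1 at *
    generalize (Gamma (weberAlpha η a))⁻¹ = G2 at *
    generalize (Gamma (weberAlpha (-η) a + 1 / 2))⁻¹ = G3 at *
    have hr4 : r ^ 4 = -1 := by rw [show r ^ 4 = (r ^ 2) ^ 2 by ring, hr, hη2]
    have key : w * P * (2 * q ^ 2 * P * (G1 * G3)) * (r⁻¹ * t ^ 2) *
        (-2 * (P * (q⁻¹ * 2⁻¹ * (t * (r ^ 2)⁻¹))) * G2) =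
        -(2 * w * P ^ 2 * P * q * t ^ 3 * r * (r ^ 4)⁻¹ * (G2 * G3) * G1) := by
      field_simp
    rw [key, g2, hr4, hpi2]
    field_simp
    rw [hη2, hw2]
    ring

/-- The Wronskian of `weberE η a` and `weberE (-η) a`. -/
theorem weberE_wronskian {η : ℂ} (hη : η = I ∨ η = -I) (a : ℂ) :
    weberE₀ η a * weberE₁ (-η) a - weberE₁ η a * weberE₀ (-η) a = -η := by
  obtain ⟨p1, p2, p3, p4⟩ := two_unit_cpow_weberAlpha hη a
  obtain ⟨s1, s2⟩ := sin_pi_mul_weberAlpha hη a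
  obtain ⟨g1, g2⟩ := inv_Gamma_weberAlpha (η := η) a
  have hq0 : (2 : ℂ) ^ (-weberAlpha (-η) a) ≠ 0 := by simp [cpow_eq_zero_iff]
  have hw0 : (Real.sqrt 2 : ℂ) ≠ 0 := by
    exact_mod_cast (Real.sqrt_pos.2 two_pos).ne'
  have hpi : (Real.pi : ℂ) ≠ 0 := ofReal_ne_zero.2 Real.pi_pos.ne'
  have hr := exp_unit_mul_pi_div_four_sq hη
  have hr0 := exp_ne_zero (η * Real.pi / 4)
  have ht0 := exp_ne_zero (η * Real.pi / 2 * weberAlpha (-η) a)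
  have hη0 := unit_ne_zero hη
  have hη2 := unit_sq hη
  have hpi2 := sqrt_pi_sq
  have hw2 := sqrt_two_sq
  rw [s1] at g1
  rw [s2] at g2
  -- In terms of `t`, `r`, `q = 2 ^ (-γ)` and the reciprocal Gamma values the identity is algebraic.
  rw [weberE₀, weberE₀, weberE₁, weberE₁, p1, p2, p3, p4]
  generalize exp (η * Real.pi / 2 * weberAlpha (-η) a) = t at *
  generalize exp (η * Real.pi / 4) = r at *
  generalize (2 : ℂ) ^ (-weberAlpha (-η) a) = q at *
  generalize (Real.sqrt Real.pi : ℂ) = P at *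
  generalize (Real.sqrt 2 : ℂ) = w at *
  generalize (Gamma (weberAlpha (-η) a))⁻¹ = G1 at *
  generalize (Gamma (weberAlpha η a))⁻¹ = G2 at *
  generalize (Gamma (weberAlpha (-η) a + 1 / 2))⁻¹ = G3 at *
  generalize (Gamma (weberAlpha η a + 1 / 2))⁻¹ = G4 at *
  have key : P * (q⁻¹ * w⁻¹ * (t * r⁻¹)) * G4 * (-2 * (P * (q * w⁻¹ * (t * r))) * G1) -
      -2 * (P * (q⁻¹ * 2⁻¹ * (t * (r ^ 2)⁻¹))) * G2 * (P * (q * t) * G3) =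
      P ^ 2 * t ^ 2 * ((r ^ 2)⁻¹ * (G2 * G3) - 2 * (w ^ 2)⁻¹ * (G1 * G4)) := by
    field_simp
    ring
  rw [key, g1, g2, hr, hw2, hpi2, unit_inv hη]
  field_simp
  ring

theorem linearIndependent_weberE {η : ℂ} (hη : η = I ∨ η = -I) (a : ℂ) :
    LinearIndependent ℂ ![weberE η a, weberE (-η) a] := by
  rw [LinearIndependent.pair_iff]
  intro s t h
  have h0 : s * weberE₀ η a + t * weberE₀ (-η) a = 0 := by
    have := congrFun h 0
    simpa using this
  have h1 : s * weberE₁ η a + t * weberE₁ (-η) a = 0 := by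
    have := (isWeberSolution_weberE η a).deriv_linearCombination
      (isWeberSolution_weberE (-η) a) s t 0
    rw [deriv_weberE_zero, deriv_weberE_zero] at this
    rw [← this]
    have h' : (fun x => s * weberE η a x + t * weberE (-η) a x) = fun _ => 0 := by
      funext x
      simpa using congrFun h x
    rw [h', deriv_const]
  have hW := weberE_wronskian hη a
  have hη0 := unit_ne_zero hη
  constructor
  · refine (mul_eq_zero.1 (?_ : s * η = 0)).resolve_right hη0
    linear_combination s * hW - weberE₁ (-η) a * h0 + weberE₀ (-η) a * h1
  · refine (mul_eq_zero.1 (?_ : t * η = 0)).resolve_right hη0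
    linear_combination t * hW + weberE₁ η a * h0 - weberE₀ η a * h1

/-! ### The parabolic cylinder function -/

/-- The parabolic cylinder function `U(η a, ·)`, expressed through `weberE η a`. -/
def parabolicU (η a z : ℂ) : ℂ :=
  exp (η * Real.pi / 8 - Real.pi * a / 4) * weberE η a (z * exp (η * Real.pi / 4))

theorem isParabolicU_parabolicU {η : ℂ} (hη : η = I ∨ η = -I) (a : ℂ) :
    IsParabolicU (η * a) (parabolicU η a) := by
  set C := exp (η * Real.pi / 8 - Real.pi * a / 4) with hC
  set r := exp (η * Real.pi / 4) with hr
  have hr2 : r ^ 2 = η := exp_unit_mul_pi_div_four_sq hη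
  have hE := isWeberSolution_weberE η a
  have hl (z : ℂ) : HasDerivAt (fun z => z * r) r z := by
    simpa using (hasDerivAt_id z).mul_const r
  have h1 (z : ℂ) : HasDerivAt (parabolicU η a) (C * (deriv (weberE η a) (z * r) * r)) z :=
    (HasDerivAt.comp (h₂ := weberE η a) z (hE.hasDerivAt (z * r)) (hl z)).const_mul C
  have h2 (z : ℂ) : HasDerivAt (fun z => C * (deriv (weberE η a) (z * r) * r))
      (C * (-((z * r) ^ 2 / 4 - a) * weberE η a (z * r) * r * r)) z :=
    ((HasDerivAt.comp (h₂ := deriv (weberE η a)) z (hE.hasDerivAt_deriv (z * r))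
      (hl z)).mul_const r).const_mul C
  have hd : deriv (parabolicU η a) = fun z => C * (deriv (weberE η a) (z * r) * r) :=
    funext fun z => (h1 z).deriv
  have hCα : C * exp (η * Real.pi / 2 * -weberAlpha η a) = 1 := by
    rw [hC, ← exp_add, exp_eq_one_iff]
    refine ⟨0, ?_⟩
    unfold weberAlpha
    push_cast
    linear_combination (-(Real.pi * a / 4)) * unit_sq hη
  refine ⟨fun z => (h1 z).differentiableAt, fun z => ?_, ?_, ?_⟩
  · rw [hd, (h2 z).deriv, parabolicU]
    linear_combination (-C * weberE η a (z * r) * (z ^ 2 / 4 * r ^ 2 + z ^ 2 / 4 * η - a)) * hr2 +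
      (-C * weberE η a (z * r) * z ^ 2 / 4) * unit_sq hη
  · have e : (2 : ℂ) ^ (η * a / 2 + 1 / 4) = (2 ^ (-weberAlpha η a))⁻¹ := by
      rw [cpow_neg, inv_inv, weberAlpha]
    rw [parabolicU, zero_mul, weberE_zero, weberE₀, two_unit_cpow hη, e,
      show 3 / 4 + η * a / 2 = weberAlpha η a + 1 / 2 by unfold weberAlpha; ring,
      div_eq_mul_inv (Real.sqrt Real.pi : ℂ), mul_inv (_ : ℂ)⁻¹, inv_inv]
    linear_combination (Real.sqrt Real.pi * 2 ^ (-weberAlpha η a) *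
      (Gamma (weberAlpha η a + 1 / 2))⁻¹ : ℂ) * hCα
  · have e : (2 : ℂ) ^ (η * a / 2 - 1 / 4) = (2 * 2 ^ (-weberAlpha η a - 1 / 2))⁻¹ := by
      have : (2 : ℂ) * 2 ^ (-weberAlpha η a - 1 / 2) = 2 ^ (-(η * a / 2 - 1 / 4)) := by
        rw [show -(η * a / 2 - 1 / 4) = (-weberAlpha η a - 1 / 2) + 1 by unfold weberAlpha; ring,
          cpow_add _ _ two_ne_zero, cpow_one, mul_comm]
      rw [this, cpow_neg, inv_inv]
    have e2 : exp (η * Real.pi / 2 * (-weberAlpha η a - 1 / 2)) * r =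
        exp (η * Real.pi / 2 * -weberAlpha η a) := by
      rw [hr, ← exp_add]
      ring_nf
    rw [hd]
    simp only [zero_mul, deriv_weberE_zero]
    rw [weberE₁, two_unit_cpow hη, e,
      show 1 / 4 + η * a / 2 = weberAlpha η a by unfold weberAlpha; ring,
      div_eq_mul_inv (Real.sqrt Real.pi : ℂ), mul_inv (_ : ℂ)⁻¹, inv_inv]
    linear_combination (-2 * Real.sqrt Real.pi * 2 ^ (-weberAlpha η a - 1 / 2) *
      (Gamma (weberAlpha η a))⁻¹ : ℂ) * (C * e2 + hCα)

/-! ### The phase of the Gamma function -/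

theorem half_add_ne_neg_nat (a : ℝ) (n : ℕ) : (1 / 2 + I * a : ℂ) ≠ -(n : ℂ) := by
  intro h
  have := congrArg re h
  simp at this
  have hn : (0 : ℝ) ≤ n := n.cast_nonneg
  linarith

theorem Gamma_half_ne_zero (a : ℝ) : Gamma (1 / 2 + I * a) ≠ 0 :=
  Gamma_ne_zero (half_add_ne_neg_nat a)

theorem continuous_deriv_Gamma_half : Continuous fun a : ℝ => deriv Gamma (1 / 2 + I * a) := by
  have hd : DifferentiableOn ℂ Gamma {z : ℂ | 0 < z.re} := fun z hz =>
    (differentiableAt_Gamma z fun n h => by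
      have hz' : 0 < z.re := hz
      rw [h] at hz'
      simp at hz'
      exact absurd hz' (not_lt.2 n.cast_nonneg)).differentiableWithinAt
  have ho : IsOpen {z : ℂ | 0 < z.re} := isOpen_lt continuous_const continuous_re
  refine (hd.deriv ho).continuousOn.comp_continuous (by fun_prop) fun a => ?_
  simp

/-- The phase is the imaginary part of the integral of the logarithmic derivative of
`a ↦ Γ(1/2 + i a)`, which has no zero. -/
theorem exists_isGammaPhase : ∃ φ : ℝ → ℝ, IsGammaPhase φ := by
  set g : ℝ → ℂ := fun a => Gamma (1 / 2 + I * a) with hg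
  set g' : ℝ → ℂ := fun a => deriv Gamma (1 / 2 + I * a) * I with hg'
  have hgd (a : ℝ) : HasDerivAt g (g' a) a := by
    have h1 : HasDerivAt (fun t : ℝ => (1 / 2 + I * t : ℂ)) I a := by
      simpa using ((ofRealCLM.hasDerivAt (x := a)).const_mul I).const_add (1 / 2 : ℂ)
    exact HasDerivAt.comp (h₂ := Gamma) a
      (differentiableAt_Gamma _ (half_add_ne_neg_nat a)).hasDerivAt h1
  have hg0 (a : ℝ) : g a ≠ 0 := Gamma_half_ne_zero a
  have hgc : Continuous g := continuous_iff_continuousAt.2 fun a => (hgd a).continuousAt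
  have hq : Continuous fun a => g' a / g a :=
    (continuous_deriv_Gamma_half.mul continuous_const).div hgc hg0
  set l : ℝ → ℂ := fun a => ∫ t in (0 : ℝ)..a, g' t / g t with hl
  have hld (a : ℝ) : HasDerivAt l (g' a / g a) a := (hq.integral_hasStrictDerivAt 0 a).hasDerivAt
  have hlc : Continuous l := continuous_iff_continuousAt.2 fun a => (hld a).continuousAt
  have hl0 : l 0 = 0 := intervalIntegral.integral_same
  have hconst (a : ℝ) : exp (-l a) * g a = g 0 := by
    have hd (a : ℝ) : HasDerivAt (fun a => exp (-l a) * g a) 0 a := by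
      refine ((hld a).neg.cexp.mul (hgd a)).congr_deriv ?_
      field_simp [hg0 a]
      ring
    have := is_const_of_deriv_eq_zero (fun a => (hd a).differentiableAt) (fun a => (hd a).deriv) a 0
    simpa [hl0] using this
  have hg00 : g 0 = Real.sqrt Real.pi := by
    simp only [hg, ofReal_zero, mul_zero, add_zero]
    exact sqrt_pi_eq_Gamma
  have hge (a : ℝ) : g a = Real.sqrt Real.pi * exp (l a) := by
    rw [← hg00, ← hconst a, mul_right_comm, ← exp_add, neg_add_cancel, exp_zero, one_mul]
  refine ⟨fun a => (l a).im, continuous_im.comp hlc, by simp [hl0], fun a => ?_⟩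
  change g a = ‖g a‖ * exp (I * (l a).im)
  have hn : ‖g a‖ = Real.sqrt Real.pi * Real.exp (l a).re := by
    rw [hge, norm_mul, Complex.norm_real, Real.norm_of_nonneg (Real.sqrt_nonneg _), norm_exp]
  rw [hn, hge, ofReal_mul, ofReal_exp, mul_assoc, ← exp_add, mul_comm I, re_add_im]

/-! ### The classical pair for real parameter -/

theorem weberAlpha_ofReal_ne (a : ℝ) (n : ℕ) : weberAlpha I a ≠ -(n : ℂ) := by
  intro h
  have := congrArg re h
  simp [weberAlpha] at this
  have hn : (0 : ℝ) ≤ n := n.cast_nonneg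
  linarith

theorem weberAlpha_ofReal_add_half_ne (a : ℝ) (n : ℕ) : weberAlpha I a + 1 / 2 ≠ -(n : ℂ) := by
  intro h
  have := congrArg re h
  simp [weberAlpha] at this
  have hn : (0 : ℝ) ≤ n := n.cast_nonneg
  linarith

theorem conj_weberAlpha (a : ℝ) :
    (starRingEnd ℂ) (weberAlpha I a) = weberAlpha (-I) a := by
  simp [weberAlpha, map_ofNat]

theorem conj_two_I_cpow (w : ℂ) :
    (starRingEnd ℂ) ((2 * I) ^ w) = (2 * -I) ^ (starRingEnd ℂ) w := by
  have h : (2 * -I : ℂ).arg ≠ Real.pi := fun h => by simpa using (arg_eq_pi_iff.1 h).2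
  rw [cpow_conj _ _ h]
  simp [map_ofNat]

theorem conj_weberE₀ (a : ℝ) : (starRingEnd ℂ) (weberE₀ I a) = weberE₀ (-I) a := by
  rw [weberE₀, weberE₀, ← conj_weberAlpha]
  simp only [map_mul, conj_ofReal, map_inv₀, ← Gamma_conj, conj_two_I_cpow, map_neg, map_add,
    map_div₀, map_one, map_ofNat]

theorem conj_weberE₁ (a : ℝ) : (starRingEnd ℂ) (weberE₁ I a) = weberE₁ (-I) a := by
  rw [weberE₁, weberE₁, ← conj_weberAlpha]
  simp only [map_mul, conj_ofReal, map_inv₀, ← Gamma_conj, conj_two_I_cpow, map_neg, map_sub,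
    map_div₀, map_one, map_ofNat]

theorem weberK_pos (a : ℝ) : 0 < weberK a := by
  unfold weberK
  have h : Real.exp (Real.pi * a) ^ 2 = Real.exp (2 * Real.pi * a) := by
    rw [← Real.exp_nat_mul]; push_cast; ring_nf
  rw [sub_pos]
  exact Real.lt_sqrt_of_sq_lt (by rw [h]; linarith)

theorem inv_weberK (a : ℝ) :
    (weberK a)⁻¹ = Real.sqrt (1 + Real.exp (2 * Real.pi * a)) + Real.exp (Real.pi * a) := by
  have h : Real.exp (2 * Real.pi * a) = Real.exp (Real.pi * a) ^ 2 := by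
    rw [← Real.exp_nat_mul]; push_cast; ring_nf
  refine inv_eq_of_mul_eq_one_right ?_
  have hs := Real.sq_sqrt (show 0 ≤ 1 + Real.exp (2 * Real.pi * a) by positivity)
  unfold weberK
  linear_combination hs + h

theorem continuous_weberK : Continuous weberK := by
  unfold weberK; fun_prop

/-- The initial value `W(a, 0)` of Whittaker's function. -/
def whittaker₀ (a : ℝ) : ℝ :=
  (2 : ℝ) ^ (-(3 / 4) : ℝ) *
    Real.sqrt ‖Gamma (1 / 4 + I * a / 2) / Gamma (3 / 4 + I * a / 2)‖

/-- The initial derivative `W'(a, 0)` of Whittaker's function. -/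
def whittaker₁ (a : ℝ) : ℝ :=
  -(2 : ℝ) ^ (-(1 / 4) : ℝ) *
    Real.sqrt ‖Gamma (3 / 4 + I * a / 2) / Gamma (1 / 4 + I * a / 2)‖

theorem weberAlpha_I (a : ℂ) : 1 / 4 + I * a / 2 = weberAlpha I a := by
  unfold weberAlpha; ring

theorem weberAlpha_I_add_half (a : ℂ) : 3 / 4 + I * a / 2 = weberAlpha I a + 1 / 2 := by
  unfold weberAlpha; ring

theorem whittaker₀_pos (a : ℝ) : 0 < whittaker₀ a := by
  rw [whittaker₀, weberAlpha_I, weberAlpha_I_add_half]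
  have h := norm_pos_iff.2 (div_ne_zero (Gamma_ne_zero (weberAlpha_ofReal_ne a))
    (Gamma_ne_zero (weberAlpha_ofReal_add_half_ne a)))
  exact mul_pos (Real.rpow_pos_of_pos two_pos _) (Real.sqrt_pos.2 h)

theorem whittaker₀_mul_whittaker₁ (a : ℝ) : whittaker₀ a * whittaker₁ a = -(1 / 2) := by
  have hG := norm_ne_zero_iff.2 (Gamma_ne_zero (weberAlpha_ofReal_ne a))
  have hH := norm_ne_zero_iff.2 (Gamma_ne_zero (weberAlpha_ofReal_add_half_ne a))
  rw [whittaker₀, whittaker₁, weberAlpha_I, weberAlpha_I_add_half]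
  have h1 : Real.sqrt ‖Gamma (weberAlpha I a) / Gamma (weberAlpha I a + 1 / 2)‖ *
      Real.sqrt ‖Gamma (weberAlpha I a + 1 / 2) / Gamma (weberAlpha I a)‖ = 1 := by
    rw [← Real.sqrt_mul (norm_nonneg _), norm_div, norm_div, div_mul_div_cancel₀ hH,
      div_self hG, Real.sqrt_one]
  have h2 : (2 : ℝ) ^ (-(3 / 4) : ℝ) * (2 : ℝ) ^ (-(1 / 4) : ℝ) = 1 / 2 := by
    rw [← Real.rpow_add two_pos, show (-(3 / 4) + -(1 / 4) : ℝ) = -1 by norm_num, Real.rpow_neg_one]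
    norm_num
  linear_combination (-(2 : ℝ) ^ (-(3 / 4) : ℝ) * (2 : ℝ) ^ (-(1 / 4) : ℝ)) * h1 - h2

theorem whittaker₀_sq (a : ℝ) :
    whittaker₀ a ^ 2 = (2 * Real.sqrt 2)⁻¹ *
      (‖Gamma (weberAlpha I a)‖ / ‖Gamma (weberAlpha I a + 1 / 2)‖) := by
  have h2 : ((2 : ℝ) ^ (-(3 / 4) : ℝ)) ^ 2 = (2 * Real.sqrt 2)⁻¹ := by
    rw [← Real.rpow_natCast, ← Real.rpow_mul two_pos.le, Real.sqrt_eq_rpow]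
    nth_rw 2 [← Real.rpow_one 2]
    rw [← Real.rpow_add two_pos, ← Real.rpow_neg two_pos.le]
    norm_num
  rw [whittaker₀, weberAlpha_I, weberAlpha_I_add_half, mul_pow, h2, Real.sq_sqrt (norm_nonneg _),
    norm_div]

theorem continuous_whittaker₀ : Continuous whittaker₀ := by
  have hG {f : ℝ → ℂ} (hf : Continuous f) (h : ∀ a n, f a ≠ -(n : ℕ)) :
      Continuous fun a => Gamma (f a) :=
    continuous_iff_continuousAt.2 fun a =>
      ContinuousAt.comp (g := Gamma) (differentiableAt_Gamma _ (h a)).continuousAt hf.continuousAt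
  have h1 : Continuous fun a : ℝ => Gamma (1 / 4 + I * a / 2) :=
    hG (by fun_prop) fun a => by rw [weberAlpha_I]; exact weberAlpha_ofReal_ne a
  have h2 : Continuous fun a : ℝ => Gamma (3 / 4 + I * a / 2) :=
    hG (by fun_prop) fun a => by rw [weberAlpha_I_add_half]; exact weberAlpha_ofReal_add_half_ne a
  refine continuous_const.mul (Real.continuous_sqrt.comp (h1.div h2 fun a => ?_).norm)
  rw [weberAlpha_I_add_half]
  exact Gamma_ne_zero (weberAlpha_ofReal_add_half_ne a)

/-- The duplication formula for `Γ(1/2 + i a)`, where `1/2 + i a = 2 α`. -/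
theorem Gamma_half_eq (a : ℝ) :
    Gamma (1 / 2 + I * a) * ((2 : ℂ) ^ (-weberAlpha I a)) ^ 2 * 2 * Real.sqrt Real.pi =
      Gamma (weberAlpha I a) * Gamma (weberAlpha I a + 1 / 2) := by
  have hG := Gamma_ne_zero (weberAlpha_ofReal_ne a)
  have hH := Gamma_ne_zero (weberAlpha_ofReal_add_half_ne a)
  have hg := Gamma_half_ne_zero a
  have h := inv_Gamma_two_mul (weberAlpha I a)
  have hq : (2 : ℂ) ^ (1 - 2 * weberAlpha I a) = 2 * (2 ^ (-weberAlpha I a)) ^ 2 := by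
    rw [show 1 - 2 * weberAlpha I a = 1 + (-weberAlpha I a + -weberAlpha I a) by ring,
      cpow_add _ _ two_ne_zero, cpow_add _ _ two_ne_zero, cpow_one]
    ring
  rw [hq, show 2 * weberAlpha I a = 1 / 2 + I * a by unfold weberAlpha; ring] at h
  generalize Gamma (1 / 2 + I * a) = g at *
  generalize Gamma (weberAlpha I a) = G at *
  generalize Gamma (weberAlpha I a + 1 / 2) = H at *
  field_simp at h
  linear_combination -h

theorem norm_two_cpow_neg_weberAlpha_sq (a : ℝ) :
    ‖(2 : ℂ) ^ (-weberAlpha I a)‖ ^ 2 = (Real.sqrt 2)⁻¹ := by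
  have h := norm_cpow_eq_rpow_re_of_pos two_pos (-weberAlpha I a)
  rw [ofReal_ofNat] at h
  rw [h, ← Real.rpow_natCast, ← Real.rpow_mul two_pos.le, Real.sqrt_eq_rpow,
    ← Real.rpow_neg two_pos.le]
  congr 1
  simp [weberAlpha]
  norm_num

theorem norm_Gamma_half (a : ℝ) :
    ‖Gamma (1 / 2 + I * a)‖ * Real.sqrt 2 * Real.sqrt Real.pi =
      ‖Gamma (weberAlpha I a)‖ * ‖Gamma (weberAlpha I a + 1 / 2)‖ := by
  have h := congrArg norm (Gamma_half_eq a)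
  rw [norm_mul, norm_mul, norm_mul, norm_mul, norm_pow, norm_two_cpow_neg_weberAlpha_sq,
    Complex.norm_real, Real.norm_of_nonneg (Real.sqrt_nonneg _), Complex.norm_ofNat] at h
  rw [← h]
  have h2 := Real.sq_sqrt (show (0 : ℝ) ≤ 2 by norm_num)
  have h20 : Real.sqrt 2 ≠ 0 := by positivity
  field_simp
  rw [h2]

/-- The reflection formula `|Γ(1/2 + i a)|² = π / cosh (π a)`, with `cosh` cleared. -/
theorem norm_Gamma_half_sq (a : ℝ) :
    ‖Gamma (1 / 2 + I * a)‖ ^ 2 * (1 + Real.exp (2 * Real.pi * a)) =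
      2 * Real.pi * Real.exp (Real.pi * a) := by
  have h : Gamma (1 / 2 + I * a) * (starRingEnd ℂ) (Gamma (1 / 2 + I * a)) =
      Real.pi / Complex.sin (Real.pi * (1 / 2 + I * a)) := by
    rw [← Gamma_conj, ← Gamma_mul_Gamma_one_sub]
    congr 2
    simp [map_ofNat]
    ring
  have hs : Complex.sin (Real.pi * (1 / 2 + I * a)) = (Real.cosh (Real.pi * a) : ℝ) := by
    rw [show (Real.pi * (1 / 2 + I * a) : ℂ) = Real.pi * a * I + Real.pi / 2 by ring,
      Complex.sin_add_pi_div_two, Complex.cos_mul_I]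
    push_cast
    rfl
  rw [mul_conj, hs, ← ofReal_div, ofReal_inj, normSq_eq_norm_sq] at h
  have he : Real.exp (2 * Real.pi * a) = Real.exp (Real.pi * a) ^ 2 := by
    rw [← Real.exp_nat_mul]; push_cast; ring_nf
  have hc : 2 * Real.cosh (Real.pi * a) * Real.exp (Real.pi * a) =
      1 + Real.exp (2 * Real.pi * a) := by
    rw [he, Real.cosh_eq, Real.exp_neg]
    have := Real.exp_ne_zero (Real.pi * a)
    field_simp
    ring
  have hc0 := (Real.cosh_pos (Real.pi * a)).ne'
  rw [← hc, h]
  field_simp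

theorem two_I_exp_mul_sin (a : ℝ) :
    2 * I * exp (-(I * Real.pi * weberAlpha I a)) * Complex.sin (Real.pi * weberAlpha (-I) a) =
      exp (Real.pi * a) + I := by
  have h1 : exp (-(I * Real.pi * weberAlpha I a)) * exp (I * (Real.pi * weberAlpha (-I) a)) =
      exp (Real.pi * a) := by
    rw [← exp_add]
    congr 1
    unfold weberAlpha
    linear_combination (-(Real.pi * a)) * I_sq
  have h2 : exp (-(I * Real.pi * weberAlpha I a)) * exp (-(I * (Real.pi * weberAlpha (-I) a))) =
      -I := by
    rw [← exp_add]
    refine Eq.trans ?_ (exp_unit_mul_pi_div_two (Or.inr rfl))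
    congr 1
    unfold weberAlpha
    ring
  rw [sin_eq_exp_unit (Or.inl rfl)]
  linear_combination h1 - h2 + (exp (-(I * Real.pi * weberAlpha I a)) *
    (exp (-(I * (Real.pi * weberAlpha (-I) a))) - exp (I * (Real.pi * weberAlpha (-I) a)))) * I_sq

/-- The factor `√2 e ^ (i π / 4 + i φ / 2)`, the quotient of the classical `E` and `weberE I`. -/
def classicalFactor (φ : ℝ) : ℂ := Real.sqrt 2 * exp (Real.pi * I / 4 + I * φ / 2)

theorem classicalFactor_sq {φ : ℝ → ℝ} (hφ : IsGammaPhase φ) (a : ℝ) :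
    classicalFactor (φ a) ^ 2 * ‖Gamma (1 / 2 + I * a)‖ = 2 * I * Gamma (1 / 2 + I * a) := by
  have h := hφ.2.2 a
  have he : exp (Real.pi * I / 4 + I * φ a / 2) ^ 2 = I * exp (I * φ a) := by
    have hI := exp_unit_mul_pi_div_two (η := I) (Or.inl rfl)
    nth_rw 3 [← hI]
    rw [← exp_add, ← exp_nat_mul]
    congr 1
    push_cast
    ring
  rw [classicalFactor, mul_pow, sqrt_two_sq, he]
  linear_combination -2 * I * h

/-- Together with `whittakerFactor_sq` this determines `E(a, 0)` up to sign.  Half of the phase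
`φ` and the square roots in `W(a, 0)` and `k` are removed by squaring. -/
theorem classicalFactor_mul_weberE₀_sq {φ : ℝ → ℝ} (hφ : IsGammaPhase φ) (a : ℝ) :
    (classicalFactor (φ a) * weberE₀ I a) ^ 2 =
      2 * (whittaker₀ a : ℂ) ^ 2 * (exp (Real.pi * a) + I) := by
  have hw : (whittaker₀ a : ℂ) ^ 2 = (2 * (Real.sqrt 2 : ℂ))⁻¹ *
      (‖Gamma (weberAlpha I a)‖ / ‖Gamma (weberAlpha I a + 1 / 2)‖) := by
    exact_mod_cast congrArg ofReal (whittaker₀_sq a)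
  have hn : (‖Gamma (1 / 2 + I * a)‖ : ℂ) * Real.sqrt 2 * Real.sqrt Real.pi =
      ‖Gamma (weberAlpha I a)‖ * ‖Gamma (weberAlpha I a + 1 / 2)‖ := by
    exact_mod_cast congrArg ofReal (norm_Gamma_half a)
  have hGG := mul_conj (Gamma (weberAlpha I a))
  rw [normSq_eq_norm_sq, ← Gamma_conj, conj_weberAlpha, ofReal_pow] at hGG
  have hs := (inv_Gamma_weberAlpha (η := I) a).1
  have hsq := classicalFactor_sq hφ a
  have hg := Gamma_half_eq a
  have he := two_I_exp_mul_sin a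
  have hG := Gamma_ne_zero (weberAlpha_ofReal_ne a)
  have hH := Gamma_ne_zero (weberAlpha_ofReal_add_half_ne a)
  have hN := ofReal_ne_zero.2 (norm_ne_zero_iff.2 (Gamma_half_ne_zero a))
  have hNG := ofReal_ne_zero.2 (norm_ne_zero_iff.2 hG)
  have hNH := ofReal_ne_zero.2 (norm_ne_zero_iff.2 hH)
  have hG' : Gamma (weberAlpha (-I) a) ≠ 0 := by
    rw [← conj_weberAlpha, Gamma_conj]
    exact (map_ne_zero _).2 hG
  have hpi : (Real.pi : ℂ) ≠ 0 := ofReal_ne_zero.2 Real.pi_pos.ne'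
  have hP : (Real.sqrt Real.pi : ℂ) ≠ 0 := ofReal_ne_zero.2 (Real.sqrt_pos.2 Real.pi_pos).ne'
  have hw0 : (Real.sqrt 2 : ℂ) ≠ 0 := ofReal_ne_zero.2 (Real.sqrt_pos.2 two_pos).ne'
  have hpi2 := sqrt_pi_sq
  have hw2 := sqrt_two_sq
  have hexp : exp (I * Real.pi / 2 * -weberAlpha I a) ^ 2 =
      exp (-(I * Real.pi * weberAlpha I a)) := by
    rw [← exp_nat_mul]
    congr 1
    push_cast
    ring
  -- What remains is algebraic in `Γ(1/2 + i a)`, `Γ(α)`, `Γ(α + 1/2)`, their norms, and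
  -- `Γ(1/4 - i a / 2)`, the conjugate of `Γ(α)`.
  rw [← he, ← hexp, hw, weberE₀, two_unit_cpow (Or.inl rfl)]
  generalize exp (I * Real.pi / 2 * -weberAlpha I a) = e at *
  generalize classicalFactor (φ a) = c at *
  generalize Gamma (1 / 2 + I * a) = g at *
  generalize Gamma (weberAlpha I a) = G at *
  generalize Gamma (weberAlpha I a + 1 / 2) = H at *
  generalize Gamma (weberAlpha (-I) a) = G' at *
  generalize (2 : ℂ) ^ (-weberAlpha I a) = q at *
  generalize (Real.sqrt Real.pi : ℂ) = P at *
  generalize (Real.sqrt 2 : ℂ) = w at *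
  generalize (‖g‖ : ℂ) = ng at *
  generalize (‖G‖ : ℂ) = nG at *
  generalize (‖H‖ : ℂ) = nH at *
  generalize Complex.sin (Real.pi * weberAlpha (-I) a) = s at *
  generalize (Real.pi : ℂ) = p at *
  subst hpi2
  have hs' : s = P ^ 2 * (G' * H)⁻¹ := by
    rw [mul_inv, hs]; field_simp
  have hc : c ^ 2 * q ^ 2 = I * (G * H) * (ng * P)⁻¹ := by
    field_simp
    linear_combination (q ^ 2 * P) * hsq + I * hg
  have key : (c * (P * (q * e) * H⁻¹)) ^ 2 = P ^ 2 * (c ^ 2 * q ^ 2) * e ^ 2 * (H⁻¹) ^ 2 := by ring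
  rw [key, hc, hs']
  field_simp
  linear_combination e ^ 2 * w * nH * hGG + e ^ 2 * nG * (ng * P * hw2 - w * hn)

/-- The product of the value and the derivative of `√2 e ^ (i π / 4 + i φ / 2) E₊` at the origin.
The phase `e ^ (i φ)` makes it real. -/
theorem classicalFactor_mul_weberE₀_mul {φ : ℝ → ℝ} (hφ : IsGammaPhase φ) (a : ℝ) :
    classicalFactor (φ a) * weberE₀ I a * (classicalFactor (φ a) * weberE₁ I a) =
      -(Real.sqrt (1 + Real.exp (2 * Real.pi * a)) : ℝ) := by
  have hr : Real.sqrt (1 + Real.exp (2 * Real.pi * a)) =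
      Real.sqrt 2 * Real.sqrt Real.pi * Real.exp (Real.pi * a / 2) / ‖Gamma (1 / 2 + I * a)‖ := by
    have hn : 0 < ‖Gamma (1 / 2 + I * a)‖ := norm_pos_iff.2 (Gamma_half_ne_zero a)
    rw [Real.sqrt_eq_iff_mul_self_eq (by positivity) (by positivity)]
    have h := norm_Gamma_half_sq a
    have he : Real.exp (Real.pi * a) = Real.exp (Real.pi * a / 2) ^ 2 := by
      rw [← Real.exp_nat_mul]; push_cast; ring_nf
    have h1 := Real.sq_sqrt (show (0 : ℝ) ≤ 2 by norm_num)
    have h2 := Real.sq_sqrt Real.pi_pos.le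
    rw [he] at h
    generalize ‖Gamma (1 / 2 + I * a)‖ = n at *
    field_simp
    rw [h1, h2]
    linear_combination h
  have hsq := classicalFactor_sq hφ a
  have hg := Gamma_half_eq a
  have hG := Gamma_ne_zero (weberAlpha_ofReal_ne a)
  have hH := Gamma_ne_zero (weberAlpha_ofReal_add_half_ne a)
  have hN := ofReal_ne_zero.2 (norm_ne_zero_iff.2 (Gamma_half_ne_zero a))
  have hP : (Real.sqrt Real.pi : ℂ) ≠ 0 := ofReal_ne_zero.2 (Real.sqrt_pos.2 Real.pi_pos).ne'
  have hw0 : (Real.sqrt 2 : ℂ) ≠ 0 := ofReal_ne_zero.2 (Real.sqrt_pos.2 two_pos).ne'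
  have hw2 := sqrt_two_sq
  have hexp : exp (I * Real.pi / 2 * -weberAlpha I a) *
      exp (I * Real.pi / 2 * (-weberAlpha I a - 1 / 2)) = -I * exp (Real.pi * a / 2) := by
    have hI := exp_unit_mul_pi_div_two (η := -I) (Or.inr rfl)
    refine Eq.trans ?_ (congrArg (· * exp (Real.pi * a / 2 : ℂ)) hI)
    rw [← exp_add, ← exp_add]
    congr 1
    unfold weberAlpha
    linear_combination (-(Real.pi * a / 2)) * I_sq
  have hq : (2 : ℂ) ^ (-weberAlpha I a - 1 / 2) = 2 ^ (-weberAlpha I a) * (Real.sqrt 2 : ℂ)⁻¹ := by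
    rw [sub_eq_add_neg (-weberAlpha I a), cpow_add _ _ two_ne_zero, cpow_neg _ (1 / 2),
      two_cpow_half]
  -- The Gamma factors of the two initial values combine to `Γ(1/2 + i a)`, whose phase cancels
  -- against the one in `classicalFactor`.
  rw [hr, weberE₀, weberE₁, two_unit_cpow (Or.inl rfl), two_unit_cpow (Or.inl rfl), hq]
  push_cast
  generalize exp (I * Real.pi / 2 * -weberAlpha I a) = e at *
  generalize exp (I * Real.pi / 2 * (-weberAlpha I a - 1 / 2)) = e' at *
  generalize exp (Real.pi * a / 2 : ℂ) = f at *
  generalize classicalFactor (φ a) = c at *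
  generalize Gamma (1 / 2 + I * a) = g at *
  generalize Gamma (weberAlpha I a) = G at *
  generalize Gamma (weberAlpha I a + 1 / 2) = H at *
  generalize (2 : ℂ) ^ (-weberAlpha I a) = q at *
  generalize (Real.sqrt Real.pi : ℂ) = P at *
  generalize (Real.sqrt 2 : ℂ) = w at *
  generalize (‖g‖ : ℂ) = ng at *
  have hc : c ^ 2 * q ^ 2 = I * (G * H) * (ng * P)⁻¹ := by
    field_simp
    linear_combination (q ^ 2 * P) * hsq + I * hg
  have key : c * (P * (q * e) * H⁻¹) * (c * (-2 * (P * (q * w⁻¹ * e')) * G⁻¹)) =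
      -2 * P ^ 2 * (c ^ 2 * q ^ 2) * (e * e') * w⁻¹ * (G * H)⁻¹ := by
    rw [mul_inv]; ring
  rw [key, hc, hexp]
  field_simp
  rw [hw2, I_sq]
  ring

/-- The coefficient `k ^ (-1/2) + i k ^ (1/2)` of `W(a, 0)` in `E(a, 0)`. -/
def whittakerFactor (a : ℝ) : ℂ :=
  ((Real.sqrt (weberK a))⁻¹ : ℝ) + I * (Real.sqrt (weberK a) : ℝ)

theorem conj_whittakerFactor (a : ℝ) : (starRingEnd ℂ) (whittakerFactor a) =
    ((Real.sqrt (weberK a))⁻¹ : ℝ) - I * (Real.sqrt (weberK a) : ℝ) := by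
  simp [whittakerFactor, sub_eq_add_neg]

theorem whittakerFactor_re (a : ℝ) : 0 < (whittakerFactor a).re := by
  have := weberK_pos a
  have h : (whittakerFactor a).re = (Real.sqrt (weberK a))⁻¹ := by
    simp only [whittakerFactor, add_re, ofReal_re, mul_re, I_re, I_im, ofReal_im]
    ring
  rw [h]
  positivity

theorem whittakerFactor_sq (a : ℝ) :
    whittakerFactor a ^ 2 = 2 * (exp (Real.pi * a) + I) := by
  have hk := weberK_pos a
  have h1 : ((Real.sqrt (weberK a))⁻¹) ^ 2 - Real.sqrt (weberK a) ^ 2 =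
      2 * Real.exp (Real.pi * a) := by
    rw [inv_pow, Real.sq_sqrt hk.le, inv_weberK, weberK]
    ring
  have h2 : (Real.sqrt (weberK a))⁻¹ * Real.sqrt (weberK a) = 1 :=
    inv_mul_cancel₀ (Real.sqrt_pos.2 hk).ne'
  have h1' := congrArg ofReal h1
  have h2' := congrArg ofReal h2
  rw [whittakerFactor]
  generalize (Real.sqrt (weberK a))⁻¹ = u at *
  generalize Real.sqrt (weberK a) = v at *
  push_cast at h1' h2'
  linear_combination h1' + 2 * I * h2' + (v : ℂ) ^ 2 * I_sq

theorem whittakerFactor_mul_conj (a : ℝ) :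
    whittakerFactor a * (starRingEnd ℂ) (whittakerFactor a) =
      2 * (Real.sqrt (1 + Real.exp (2 * Real.pi * a)) : ℝ) := by
  have hk := weberK_pos a
  have h1 : ((Real.sqrt (weberK a))⁻¹) ^ 2 + Real.sqrt (weberK a) ^ 2 =
      2 * Real.sqrt (1 + Real.exp (2 * Real.pi * a)) := by
    rw [inv_pow, Real.sq_sqrt hk.le, inv_weberK, weberK]
    ring
  have h1' := congrArg ofReal h1
  rw [conj_whittakerFactor, whittakerFactor]
  generalize (Real.sqrt (weberK a))⁻¹ = u at *
  generalize Real.sqrt (weberK a) = v at *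
  push_cast at h1' ⊢
  linear_combination h1' - (v : ℂ) ^ 2 * I_sq

theorem continuous_whittakerFactor : Continuous whittakerFactor := by
  have h := Real.continuous_sqrt.comp continuous_weberK
  have h' : Continuous fun a => (Real.sqrt (weberK a))⁻¹ :=
    h.inv₀ fun a => (Real.sqrt_pos.2 (weberK_pos a)).ne'
  exact (continuous_ofReal.comp h').add (continuous_const.mul (continuous_ofReal.comp h))

theorem classicalFactor_mul_weberE₀_zero_re :
    0 < (classicalFactor 0 * weberE₀ I 0).re := by
  have h34 : Gamma (weberAlpha I 0 + 1 / 2) = (Real.Gamma (3 / 4) : ℝ) := by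
    rw [← Gamma_ofReal]
    congr 1
    simp [weberAlpha]
    norm_num
  have h2 : (2 : ℂ) ^ (-weberAlpha I 0) = ((2 : ℝ) ^ (-(1 / 4) : ℝ) : ℝ) := by
    rw [ofReal_cpow two_pos.le]
    simp [weberAlpha]
  have he : exp (Real.pi * I / 4 + I * (0 : ℝ) / 2) * exp (I * Real.pi / 2 * -weberAlpha I 0) =
      exp ((Real.pi / 8 : ℝ) * I) := by
    rw [← exp_add]
    congr 1
    simp [weberAlpha]
    ring
  have h : classicalFactor 0 * weberE₀ I 0 =
      (Real.sqrt 2 * Real.sqrt Real.pi * (2 : ℝ) ^ (-(1 / 4) : ℝ) * (Real.Gamma (3 / 4))⁻¹ : ℝ) *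
        exp ((Real.pi / 8 : ℝ) * I) := by
    rw [← he, classicalFactor, weberE₀, two_unit_cpow (Or.inl rfl), h34, h2]
    push_cast
    ring
  rw [h, re_ofReal_mul, exp_ofReal_mul_I_re]
  have hc : 0 < Real.cos (Real.pi / 8) :=
    Real.cos_pos_of_mem_Ioo ⟨by linarith [Real.pi_pos], by linarith [Real.pi_pos]⟩
  have hG : 0 < Real.Gamma (3 / 4) := Real.Gamma_pos_of_pos (by norm_num)
  positivity

/-- Both sides have the same square.  Being continuous and zero-free in the real parameter,
they agree everywhere because they agree at `a = 0`. -/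
theorem classicalFactor_mul_weberE₀ {φ : ℝ → ℝ} (hφ : IsGammaPhase φ) (a : ℝ) :
    classicalFactor (φ a) * weberE₀ I a = whittakerFactor a * whittaker₀ a := by
  have hsq (a : ℝ) : (classicalFactor (φ a) * weberE₀ I a) ^ 2 =
      (whittakerFactor a * whittaker₀ a) ^ 2 := by
    rw [classicalFactor_mul_weberE₀_sq hφ, mul_pow, whittakerFactor_sq]
    ring
  have hre (a : ℝ) : 0 < (whittakerFactor a * whittaker₀ a).re := by
    rw [re_mul_ofReal]
    exact mul_pos (whittakerFactor_re a) (whittaker₀_pos a)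
  have hE : Continuous fun a : ℝ => weberE₀ I a := by
    have h : Continuous fun a : ℝ => weberE I a 0 :=
      (differentiable_weberE (Or.inl rfl)).continuous.comp
        (g := fun q : ℂ × ℂ => weberE I q.1 q.2) (f := fun a : ℝ => ((a : ℂ), (0 : ℂ)))
        (by fun_prop)
    simpa using h
  have hL : Continuous fun a : ℝ => classicalFactor (φ a) * weberE₀ I a := by
    have := hφ.1
    refine Continuous.mul ?_ hE
    unfold classicalFactor
    fun_prop
  have hR : Continuous fun a : ℝ => whittakerFactor a * whittaker₀ a :=
    continuous_whittakerFactor.mul (continuous_ofReal.comp continuous_whittaker₀)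
  refine isPreconnected_univ.eq_of_sq_eq hL.continuousOn hR.continuousOn (fun a _ => hsq a)
    (fun {a} _ h => ?_) (mem_univ 0) ?_ (mem_univ a)
  · have := hre a
    rw [h] at this
    simp at this
  · rcases sq_eq_sq_iff_eq_or_eq_neg.1 (hsq 0) with h | h
    · exact h
    · have h0 := classicalFactor_mul_weberE₀_zero_re
      rw [hφ.2.1, ofReal_zero] at h
      rw [h, neg_re] at h0
      exact absurd (hre 0) (by linarith)

/-- The derivative at the origin follows from the value and the product of both. -/
theorem classicalFactor_mul_weberE₁ {φ : ℝ → ℝ} (hφ : IsGammaPhase φ) (a : ℝ) :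
    classicalFactor (φ a) * weberE₁ I a = (starRingEnd ℂ) (whittakerFactor a) * whittaker₁ a := by
  have h0 := classicalFactor_mul_weberE₀ hφ a
  have h1 := classicalFactor_mul_weberE₀_mul hφ a
  have hne : whittakerFactor a * whittaker₀ a ≠ 0 := by
    refine mul_ne_zero (fun h => ?_) (ofReal_ne_zero.2 (whittaker₀_pos a).ne')
    have := whittakerFactor_re a
    simp [h] at this
  have hW : (whittaker₀ a * whittaker₁ a : ℂ) = -(1 / 2) := by
    rw [← ofReal_mul, whittaker₀_mul_whittaker₁]
    push_cast
    rfl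
  refine mul_left_cancel₀ hne ?_
  rw [h0] at h1
  rw [h1]
  linear_combination (-(whittaker₀ a * whittaker₁ a : ℂ)) * whittakerFactor_mul_conj a -
    2 * (Real.sqrt (1 + Real.exp (2 * Real.pi * a)) : ℝ) * hW

/-- Whittaker's function `W(a, ·)`. -/
def whittakerW (a : ℝ) (x : ℂ) : ℂ := whittaker₀ a * weberEven a x + whittaker₁ a * weberOdd a x

theorem isWhittakerW_whittakerW (a : ℝ) : IsWhittakerW a (whittakerW a) := by
  refine ⟨(isWeberSolution_weberEven a).linearCombination (isWeberSolution_weberOdd a) _ _,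
    by simp [whittakerW, whittaker₀], ?_⟩
  refine ((isWeberSolution_weberEven a).deriv_linearCombination (isWeberSolution_weberOdd a)
    _ _ 0).trans ?_
  simp [whittaker₁]

/-- `W(a, -x)` has the initial values `W(a, 0)` and `-W'(a, 0)`. -/
theorem linearCombination_whittakerW {a : ℝ} {u v : ℂ} {E : ℂ → ℂ} (hE : IsWeberSolution a E)
    (h0 : E 0 = (u + v) * whittaker₀ a) (h1 : deriv E 0 = (u - v) * whittaker₁ a) (x : ℂ) :
    u * whittakerW a x + v * whittakerW a (-x) = E x := by
  have hS := (isWhittakerW_whittakerW a).1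
  have hd : deriv (whittakerW a) 0 = whittaker₁ a := (isWhittakerW_whittakerW a).2.2
  refine congrFun ((hS.linearCombination hS.comp_neg u v).ext hE ?_ ?_) x
  · rw [h0, neg_zero]
    simp only [whittakerW, weberEven_zero, weberOdd_zero]
    ring
  · rw [hS.deriv_linearCombination hS.comp_neg, (hS.hasDerivAt_comp_neg 0).deriv, neg_zero, hd, h1]
    ring

theorem classicalE_whittakerW {φ : ℝ → ℝ} (hφ : IsGammaPhase φ) (a : ℝ) (x : ℂ) :
    classicalE a (whittakerW a) x = classicalFactor (φ a) * weberE I a x := by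
  have hS := isWeberSolution_weberE I a
  have hS' := hS.linearCombination hS (classicalFactor (φ a)) 0
  have hd := hS.deriv_linearCombination hS (classicalFactor (φ a)) 0 0
  simp only [zero_mul, add_zero] at hS' hd
  refine linearCombination_whittakerW hS' ?_ ?_ x
  · rw [weberE_zero, classicalFactor_mul_weberE₀ hφ, whittakerFactor]
  · rw [hd, deriv_weberE_zero, classicalFactor_mul_weberE₁ hφ, conj_whittakerFactor]

theorem conj_classicalFactor (φ : ℝ) : (starRingEnd ℂ) (classicalFactor φ) =
    Real.sqrt 2 * exp (-(Real.pi * I / 4) - I * φ / 2) := by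
  rw [classicalFactor, map_mul, conj_ofReal, ← exp_conj]
  congr 2
  simp [map_ofNat]
  ring

theorem classicalEStar_whittakerW {φ : ℝ → ℝ} (hφ : IsGammaPhase φ) (a : ℝ) (x : ℂ) :
    classicalEStar a (whittakerW a) x =
      (starRingEnd ℂ) (classicalFactor (φ a)) * weberE (-I) a x := by
  have hS := isWeberSolution_weberE (-I) a
  have hS' := hS.linearCombination hS ((starRingEnd ℂ) (classicalFactor (φ a))) 0
  have hd := hS.deriv_linearCombination hS ((starRingEnd ℂ) (classicalFactor (φ a))) 0 0
  simp only [zero_mul, add_zero] at hS' hd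
  have h0 := congrArg (starRingEnd ℂ) (classicalFactor_mul_weberE₀ hφ a)
  have h1 := congrArg (starRingEnd ℂ) (classicalFactor_mul_weberE₁ hφ a)
  rw [map_mul, map_mul, conj_ofReal, conj_weberE₀, conj_whittakerFactor] at h0
  rw [map_mul, map_mul, conj_ofReal, conj_weberE₁, conj_conj, whittakerFactor] at h1
  rw [classicalEStar, sub_eq_add_neg, ← neg_mul]
  refine linearCombination_whittakerW hS' ?_ ?_ x
  · rw [weberE_zero, h0]
    ring
  · rw [hd, deriv_weberE_zero, h1]
    ring

end Weber

end

theorem theorem2 :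
    ∃ Ep Em : ℂ → ℂ → ℂ,
      -- `E₊` and `E₋` are entire in `(a, x)`
      Differentiable ℂ (fun q : ℂ × ℂ => Ep q.1 q.2) ∧
      Differentiable ℂ (fun q : ℂ × ℂ => Em q.1 q.2) ∧
      -- they are linearly independent solutions of the Weber equation
      (∀ a : ℂ, Weber.IsWeberSolution a (Ep a) ∧ Weber.IsWeberSolution a (Em a) ∧
        LinearIndependent ℂ ![Ep a, Em a]) ∧
      -- Laplace integral representations off the (therefore removable) singularities
      (∀ a : ℂ, (∀ n : ℕ, Weber.alphaPlus a ≠ -(n : ℂ)) →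
        ∀ x ∈ Weber.sector, Weber.IsLaplacePlus a (x ^ 2) (Ep a x)) ∧
      (∀ a : ℂ, (∀ n : ℕ, Weber.alphaMinus a ≠ -(n : ℂ)) →
        ∀ x ∈ Weber.sector, Weber.IsLaplaceMinus a (x ^ 2) (Em a x)) ∧
      -- asymptotic behaviour as `x → ∞` in `|arg x| < π / 4`
      (∀ a : ℂ,
        Asymptotics.IsBigO (Bornology.cobounded ℂ ⊓ Filter.principal Weber.sector)
          (fun x : ℂ => Ep a x /
            (Complex.exp (Complex.I * x ^ 2 / 4) *
              (x ^ 2) ^ (-(Complex.I * a / 2) - 1 / 4)) - 1)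
          (fun x : ℂ => (x ^ 2)⁻¹)) ∧
      (∀ a : ℂ,
        Asymptotics.IsBigO (Bornology.cobounded ℂ ⊓ Filter.principal Weber.sector)
          (fun x : ℂ => Em a x /
            (Complex.exp (-(Complex.I * x ^ 2 / 4)) *
              (x ^ 2) ^ (Complex.I * a / 2 - 1 / 4)) - 1)
          (fun x : ℂ => (x ^ 2)⁻¹)) ∧
      -- connection formulas
      (∀ a x : ℂ,
        Em a (-x) = Complex.I * Complex.exp (Real.pi * a) * Em a x +
          (Real.sqrt (2 * Real.pi) : ℂ) / Complex.Gamma (1 / 2 - Complex.I * a) *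
            Complex.exp (Real.pi * a / 2) * Ep a x) ∧
      (∀ a x : ℂ,
        Ep a (-x) = -Complex.I * Complex.exp (Real.pi * a) * Ep a x +
          (Real.sqrt (2 * Real.pi) : ℂ) / Complex.Gamma (1 / 2 + Complex.I * a) *
            Complex.exp (Real.pi * a / 2) * Em a x) ∧
      -- relation with the classical pair `E`, `E*` of real parameter `a`
      (∃ φ : ℝ → ℝ, Weber.IsGammaPhase φ ∧
        ∀ a : ℝ, ∃ W : ℂ → ℂ, Weber.IsWhittakerW a W ∧
          ∀ x : ℂ,
            Weber.classicalE a W x =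
              (Real.sqrt 2 : ℂ) *
                Complex.exp (Real.pi * Complex.I / 4 + Complex.I * φ a / 2) * Ep a x ∧
            Weber.classicalEStar a W x =
              (Real.sqrt 2 : ℂ) *
                Complex.exp (-(Real.pi * Complex.I / 4) - Complex.I * φ a / 2) * Em a x) ∧
      -- the same relation for complex `a`, with `E`, `E*` expressed through `U`,
      -- whatever value is used as the phase
      (∀ a : ℂ, ∃ U₁ U₂ : ℂ → ℂ,
        Weber.IsParabolicU (Complex.I * a) U₁ ∧ Weber.IsParabolicU (-(Complex.I * a)) U₂ ∧
        ∀ φ x : ℂ,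
          Weber.complexE a φ U₁ x =
            (Real.sqrt 2 : ℂ) *
              Complex.exp (Real.pi * Complex.I / 4 + Complex.I * φ / 2) * Ep a x ∧
          Weber.complexEStar a φ U₂ x =
            (Real.sqrt 2 : ℂ) *
              Complex.exp (-(Real.pi * Complex.I / 4) - Complex.I * φ / 2) * Em a x) := by
  have hp : (Complex.I = Complex.I ∨ Complex.I = -Complex.I) := Or.inl rfl
  have hm : (-Complex.I = Complex.I ∨ -Complex.I = -Complex.I) := Or.inr rfl
  have hαm (a : ℂ) : Weber.alphaMinus a = Weber.weberAlpha (-Complex.I) a := by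
    unfold Weber.alphaMinus Weber.weberAlpha; ring
  refine ⟨Weber.weberE Complex.I, Weber.weberE (-Complex.I), Weber.differentiable_weberE hp,
    Weber.differentiable_weberE hm, fun a => ⟨Weber.isWeberSolution_weberE _ a,
    Weber.isWeberSolution_weberE _ a, Weber.linearIndependent_weberE hp a⟩, ?_, ?_, ?_, ?_, ?_, ?_,
    ?_, ?_⟩
  · intro a hα x hx
    refine ⟨_, ?_, Weber.weberE_eq_amplitude hα x⟩
    have hk : Weber.kernelPlus a (x ^ 2) =
        Weber.laplaceKernel Complex.I (Weber.weberAlpha Complex.I a + 1 / 2) (x ^ 2) := by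
      funext p
      rw [Weber.kernelPlus, Weber.laplaceKernel]
      congr 2
      unfold Weber.weberAlpha; ring
    rw [hk]
    exact Weber.isRegularizedIntegral_laplaceKernel hp (Weber.sector_subset_cone hx) hα
  · intro a hα x hx
    simp only [hαm] at hα
    have hk : Weber.kernelMinus a (x ^ 2) =
        Weber.laplaceKernel (-Complex.I) (Weber.weberAlpha (-Complex.I) a + 1 / 2) (x ^ 2) := by
      funext p
      rw [Weber.kernelMinus, Weber.laplaceKernel]
      congr 2
      · ring
      · unfold Weber.weberAlpha; ring
    refine ⟨Complex.Gamma (Weber.weberAlpha (-Complex.I) a) * Weber.amplitude (-Complex.I) a x,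
      ?_, ?_⟩
    · rw [hk, hαm]
      exact Weber.isRegularizedIntegral_laplaceKernel hm (Weber.sector_subset_cone hx) hα
    · rw [hαm, Weber.weberE_eq_amplitude hα x]
      ring_nf
  · intro a
    have h := Weber.weberE_isBigO hp a
    have e : -(Complex.I * a / 2) - 1 / 4 = -Weber.weberAlpha Complex.I a := by
      unfold Weber.weberAlpha; ring
    rw [e]
    exact h
  · intro a
    have h := Weber.weberE_isBigO hm a
    have e : Complex.I * a / 2 - 1 / 4 = -Weber.weberAlpha (-Complex.I) a := by
      unfold Weber.weberAlpha; ring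
    simp only [neg_mul, neg_div] at h
    rw [e]
    exact h
  · exact Weber.weberE_connection hp
  · intro a x
    have h := Weber.weberE_connection hm a x
    rwa [neg_neg, neg_mul Complex.I a, sub_neg_eq_add] at h
  · obtain ⟨φ, hφ⟩ := Weber.exists_isGammaPhase
    refine ⟨φ, hφ, fun a => ⟨_, Weber.isWhittakerW_whittakerW a, fun x =>
      ⟨Weber.classicalE_whittakerW hφ a x, ?_⟩⟩⟩
    rw [Weber.classicalEStar_whittakerW hφ, Weber.conj_classicalFactor]
  · intro a
    refine ⟨Weber.parabolicU Complex.I a, Weber.parabolicU (-Complex.I) a,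
      Weber.isParabolicU_parabolicU hp a, ?_, fun φ x => ⟨?_, ?_⟩⟩
    · have h := Weber.isParabolicU_parabolicU hm a
      rwa [neg_mul] at h
    · have hx : x * Complex.exp (-(Real.pi * Complex.I / 4)) *
          Complex.exp (Complex.I * Real.pi / 4) = x := by
        rw [mul_assoc, ← Complex.exp_add, mul_comm Complex.I, neg_add_cancel, Complex.exp_zero,
          mul_one]
      have he : Complex.exp (Real.pi * a / 4) * Complex.exp (Complex.I * (Real.pi / 8 + φ / 2)) *
          Complex.exp (Complex.I * Real.pi / 8 - Real.pi * a / 4) =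
            Complex.exp (Real.pi * Complex.I / 4 + Complex.I * φ / 2) := by
        rw [← Complex.exp_add, ← Complex.exp_add]
        ring_nf
      rw [Weber.complexE, Weber.parabolicU, hx, ← he]
      ring
    · have hx : x * Complex.exp (Real.pi * Complex.I / 4) *
          Complex.exp (-Complex.I * Real.pi / 4) = x := by
        rw [mul_assoc, ← Complex.exp_add,
          show Real.pi * Complex.I / 4 + -Complex.I * Real.pi / 4 = 0 by ring, Complex.exp_zero,
          mul_one]
      have he : Complex.exp (Real.pi * a / 4) * Complex.exp (-(Complex.I * (Real.pi / 8 + φ / 2))) *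
          Complex.exp (-Complex.I * Real.pi / 8 - Real.pi * a / 4) =
            Complex.exp (-(Real.pi * Complex.I / 4) - Complex.I * φ / 2) := by
        rw [← Complex.exp_add, ← Complex.exp_add]
        ring_nf
      rw [Weber.complexEStar, Weber.parabolicU, hx, ← he]
      ring
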